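/- **Setting.** Let $\mathbb X,\mathbb Y$ be finite-dimensional real normed spaces, $\mathcal X\subseteq\mathbb X$ and $\mathcal Y\subseteq\mathbb Y$ nonempty closed convex sets, $\mathcal Y$ bounded. Consider $$\min_{x\in\mathcal X}\ q(x)=f(x)+r(x),\qquad f(x)=\max_{y\in\mathcal Y}\ \Phi(x,y)-g(y),\qquad q^*=\inf_{\mathcal X}q>-\infty,$$ where $r$ and $g$ are closed convex proper functions, Lipschitz on $\mathcal X$ and $\mathcal Y$ with constants $M_r,M_g<\infty$. Assume: * $\Phi(\cdot,y)$ is differentiable on an open set $\mathcal X'\supseteq\mathcal X$ for every $y\in\mathcal Y$, and on $\mathcal X\times\mathcal Y$ the map $\nabla_x\Phi$ is $L_{xx}$-Lipschitz in $x$ and $\overline L_{xy}$-Lipschitz in $y$ (dual norms); * $\Phi$ is continuous on $\mathcal X\times\mathcal Y$; $\Phi(x,\cdot)$ is concave on $\mathcal Y$ for $x\in\mathcal X$; and, for some $\gamma\in(0,L_{xx}]$, $\Phi(x',y)-\Phi(x,y)-\langle\nabla_x\Phi(x,y),x'-x\rangle\ge-\frac\gamma2\|x'-x\|^2$ for $x,x'\in\mathcal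 X$, $y\in\mathcal Y$; * (dual smoothness) $\Phi(x,\cdot)$ is differentiable on an open set $\mathcal Y'\supseteq\mathcal Y$ for every $x\in\mathcal X$, and on $\mathcal X\times\mathcal Y$ the map $\nabla_y\Phi$ is $L_{yx}$-Lipschitz in $x$ and $L_{yy}$-Lipschitz in $y$. Put $L_{xy}=\max\{\overline L_{xy},L_{yx}\}$ and assume $L_{xy}>0$. A distance generating function (DGF) on a closed convex set $\mathcal U$ is an essentially smooth function $\omega$ (continuously differentiable on $\operatorname{int}\operatorname{dom}\omega\ne\emptyset$, with $\|\nabla\omega\|_*\to\infty$ at the boundary of $\operatorname{dom}\omega$) that is finite, continuous and $1$-strongly convex on $\mathcal U$; $D_\omega(u',u)=\omega(u')-\omega(u)-\langle\nabla\omega(u),u'-u\rangle$ and $\mathcal U^o=\mathcal U\cap\operatorname{int}\operatorname{dom}\omega$. A function $\varphi$ has tractable Bregman proximal projections on $\mathcal U$ (under $\omega$) if $\min_{u'\in\mathcal U}\varphi(u')+\langle\xi,u'\rangle+s^{-1}D_\omega(u',u)$ has a unique (easily computable) solution, lying in $\mathcal U^o$, for all $u\in\mathcal U^o$, all covectors $\xi$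 and all $s>0$. Let $\omega_{\mathcal X},\omega_{\mathcal Y}$ be DGFs on $\mathcal X,\mathcal Y$ such that $r$ has tractable projections on $\mathcal X$ under $\omega_{\mathcal X}$ and $g$ has tractable projections on $\mathcal Y$ under $\omega_{\mathcal Y}$; let $\omega_{\mathcal X}$ be twice differentiable on $\mathcal X'\subseteq\operatorname{dom}\omega_{\mathcal X}$ with $\nabla\omega_{\mathcal X}$ $\beta$-Lipschitz on $\mathcal X$, $\beta=\beta_{\mathcal X}\ge1$; and let $\Omega=\sup_{\mathcal Y}|\omega_{\mathcal Y}|>0$. Put $\lambda=1/(2\gamma)$. A point $x\in\mathcal X$ is called *$\varepsilon$-near-stationary* if $\|x-\mathrm{prox}(q,x,\lambda)\|\le\varepsilon\lambda/\beta$, where $\mathrm{prox}(q,x,\lambda)$ is the unique minimizer over $\mathcal X$ of $q(\cdot)+\lambda^{-1}D_{\omega_{\mathcal X}}(\cdot,x)$. A primal (dual) oracle call is an evaluation of $\nabla_x\Phi$ (of $\nabla_y\Phi$) at a point of $\mathcal X\times\mathcal Y$; all other computations are free. **APG.** For $\min_{\mathcal U}h+\varphi+\mu\omega$ with smoothness constant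 $L$ of $h$, the accelerated proximal gradient method from $u^{-1}=u^0=\hat u^0\in\mathcal U^o$ with $\tau=\sqrt{L/\mu}$, $\alpha=\tau/(1+\tau)$ computes, for $t\ge1$, $\hat u^t=\big(\alpha(u^{t-1}-u^{t-2})+u^{t-1}+\tau\hat u^{t-1}\big)/(1+\tau)$ and $u^t=\arg\min_{u\in\mathcal U}\varphi(u)+\mu\omega(u)+\langle G^t,u\rangle+\sqrt{L\mu}\,D_\omega(u,u^{t-1})$, where $G^t$ is the available (possibly inexact) gradient of $h$ at $\hat u^t$. Its output after $k$ iterations is $\big(\sum_{t=1}^k\alpha^{-t}\big)^{-1}\sum_{t=1}^k\alpha^{-t}u^t$. It is stopped at the first iteration $k\ge1$ whose output has the prescribed accuracy in objective value. **Case II method** at a centre $x_k$, with target accuracy $\eta$. Let $\mu=\lambda^{-1}-\gamma=\gamma$, $\Psi(x,y)=\gamma\omega_{\mathcal X}(x)+\Phi(x,y)-\lambda^{-1}\langle\nabla\omega_{\mathcal X}(x_k),x\rangle$, $\psi(x,y)=\Psi(x,y)+r(x)+\mu\omega_{\mathcal X}(x)$, $\pi(y)=\min_{x\in\mathcal X}\psi(x,y)$,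 $d_\rho(y)=\pi(y)-g(y)-\rho\,\omega_{\mathcal Y}(y)$; $L'_{xx}=L_{xx}+\lambda^{-1}\beta$, $L'_\rho=L'_{xx}+L_{xy}^2/\rho$, $L_\pi=L_{yy}+L_{xy}^2/\mu$. Fix starting points $x^0\in\mathcal X^o$, $y^0\in\mathcal Y^o$. * $\mathrm{Primal}(y,\delta)$: exact APG on $\psi(\cdot,y)$ over $\mathcal X$ ($h=\Psi(\cdot,y)$, $\varphi=r$, $L=L'_{xx}$) from $x^0$ to accuracy $\delta$; one primal call per iteration. * $\mathrm{Dual}(\rho,\delta)$: APG for maximizing $d_\rho$ over $\mathcal Y$ ($h=-\pi$, $\varphi=g$, strong convexity $\rho$, $L=\max\{L_\pi,\rho\}$) from $y^0$ to accuracy $\delta$. The inexact gradient at $\hat u^t$ is $-\nabla_y\Phi(x^t,\hat u^t)$ with $x^t=\mathrm{Primal}(\hat u^t,\delta_2)$, $\delta_2=\delta\mu\rho^{3/2}\big/\big[(14\sqrt2)^2L_{xy}^2L^{1/2}(1+\sqrt{L/\rho})^2\big]$; each iteration makes one dual call, plus the primal calls used for $x^t$. Let $\rho=\eta/(4\Omega)$.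 First compute $y_r=\mathrm{Dual}(1,\frac12)$ and $x_r=\mathrm{Primal}(y_r,\frac12)$, and put $$B=L_{xy}\operatorname{diam}\mathcal Y+\sup_{y\in\mathcal Y}\|\nabla_x\Psi(x_r,y)\|_*+\tfrac{L'_{xx}}{\sqrt\mu}\big(1+\tfrac{L_{xy}}{\sqrt\mu}+2\sqrt\Omega\big)+2L'_\rho\sqrt{\rho\Omega/\mu},$$ $$B'=\|\nabla\omega_{\mathcal X}(x_r)\|_*+\tfrac{\beta}{\sqrt\mu}\big(1+\tfrac{L_{xy}}{\sqrt\mu}+2\sqrt\Omega(1+\sqrt\rho)\big),\qquad m=\min\Big\{\frac{\eta}{8(B+M_r+\mu B')^2},\frac1{L'_\rho+\mu\beta}\Big\},$$ $\varepsilon_3=\min\{\eta\mu^2\rho\, m/(64L_{xy}^2),\ \eta/4\}$, $\varepsilon_4=\eta\mu m/64$ (the supremum in $B$ is not charged as oracle calls). Then compute $y=\mathrm{Dual}(\rho,\varepsilon_3)$ and output $x_{k+1}=\mathrm{Primal}(y,\varepsilon_4)$. **Algorithm.** From $x_1\in\mathcal X^o$, for $k=1,2,\dots$ compute $x_{k+1}$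 from $x_k$ by the Case II method; stop at the first $k=K$ with $\|x_{k+1}-x_k\|\le4\sqrt{\lambda\eta}$ and output $x_K$. **Theorem.** Choose $\eta=\varepsilon^2\lambda/(64\beta^2)$. For every $\varepsilon>0$ all loops terminate; every step satisfies $x_{k+1}\in\mathcal X^o$ and $Q_\rho^\lambda(x_{k+1};x_k)\le\inf_{x\in\mathcal X}Q_\rho^\lambda(x;x_k)+\eta$, where $Q_\rho^\lambda(x;x_k)=\max_{y\in\mathcal Y}\{\Phi(x,y)-g(y)-\rho\,\omega_{\mathcal Y}(y)\}+r(x)+\lambda^{-1}D_{\omega_{\mathcal X}}(x,x_k)$; and the output $x_K$ is $\varepsilon$-near-stationary. Moreover, as $\varepsilon\to0$, the whole run makes at most $$C\,\sqrt{\gamma(L_{xx}+\gamma)}\,\big(\sqrt{L_{yy}\gamma}+L_{xy}\big)\,\varepsilon^{-3}\log^2(1/\varepsilon)$$ primal oracle calls and at most $$C\,\gamma\big(\sqrt{L_{yy}\gamma}+L_{xy}\big)\,\varepsilon^{-3}\log(1/\varepsilon)$$ dual oracle calls: these bounds hold for all $0<\varepsilon<\varepsilon_0$, where $C$ depends only on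 $\beta$, $\Omega$ and $q(x_1)-q^*$, and $\varepsilon_0>0$ depends on the problem instance and on the starting points $x_1,x^0,y^0$. -/

import Mathlib

open Set Filter Topology

universe u v

noncomputable section

namespace PDSmooth

/-! ### Distance generating functions and Bregman proximal projections

An extended-real-valued distance generating function is represented by its effective domain `W`
and its (finite) values `ω` on `W`; the values of `ω` off `W` are never used. -/

section Bregman

variable {E : Type*} [NormedAddCommGroup E] [NormedSpace ℝ E]

/-- Bregman divergence `D_ω(u', u) = ω(u') - ω(u) - ⟨∇ω(u), u' - u⟩`. -/
def bregman (ω : E → ℝ) (u' u : E) : ℝ := ω u' - ω u - fderiv ℝ ω u (u' - u)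

/-- `ω`, with effective domain `W`, is a distance generating function on `U`: it is essentially
smooth (continuously differentiable on `int W ≠ ∅`, with `‖∇ω‖ → ∞` at the boundary of `W`), and
it is (finite,) continuous and `1`-strongly convex on `U`. -/
structure IsDGF (U W : Set E) (ω : E → ℝ) : Prop where
  subset_dom : U ⊆ W
  interior_nonempty : (interior W).Nonempty
  contDiffOn : ContDiffOn ℝ 1 ω (interior W)
  blowup : ∀ u ∈ frontier W,
    Tendsto (fun v => ‖fderiv ℝ ω v‖) (𝓝[interior W] u) atTop
  continuousOn : ContinuousOn ω U
  strongConvexOn : StrongConvexOn U 1 ω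

/-- `U^o = U ∩ int dom ω`. -/
def core (U W : Set E) : Set E := U ∩ interior W

/-- The function `φ` has tractable Bregman proximal projections on `U` under the distance
generating function `ω` (with domain `W`): for all `u ∈ U^o`, `ξ ∈ 𝕌*` and `s > 0`, the problem
`min_{u' ∈ U} φ(u') + ⟨ξ, u'⟩ + s⁻¹ D_ω(u', u)` has a unique solution, and it lies in `U^o`.
(Computing it involves no oracle call.) -/
def TractableBPP (U W : Set E) (ω φ : E → ℝ) : Prop :=
  ∀ u ∈ core U W, ∀ ξ : E →L[ℝ] ℝ, ∀ s : ℝ, 0 < s →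
    ∃ p ∈ core U W,
      IsMinOn (fun u' => φ u' + ξ u' + s⁻¹ * bregman ω u' u) U p ∧
      ∀ p' ∈ U, IsMinOn (fun u' => φ u' + ξ u' + s⁻¹ * bregman ω u' u) U p' → p' = p

/-! ### The (inexact) accelerated proximal gradient method for `min_{u ∈ U} h(u) + φ(u) + μ ω(u)` -/

/-- The parameter `τ = √(L/μ)`. -/
def apgTau (L μ : ℝ) : ℝ := Real.sqrt (L / μ)

/-- The parameter `α = τ/(1+τ)`. -/
def apgAlpha (L μ : ℝ) : ℝ := apgTau L μ / (1 + apgTau L μ)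

/-- The parameter (step size weight) `√(L μ)`. -/
def apgEta (L μ : ℝ) : ℝ := Real.sqrt (L * μ)

/-- `u 0, …, u k` and `uh 0, …, uh k` are the first iterates of the method started at `u0`, where
the covector `G t` is the (possibly inexact) gradient of `h` that is used at the query point `uh t`
in iteration `t`.  The convention `u^{-1} = u^0` is the truncated subtraction in `u (t - 1)`. -/
structure IsAPG (U : Set E) (ω φ : E → ℝ) (L μ : ℝ) (u0 : E) (k : ℕ)
    (u uh : ℕ → E) (G : ℕ → (E →L[ℝ] ℝ)) : Prop where
  init : u 0 = u0
  init_hat : uh 0 = u0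
  hat : ∀ t < k, uh (t + 1) = (1 + apgTau L μ)⁻¹ •
    ((apgAlpha L μ • (u t - u (t - 1)) + u t) + apgTau L μ • uh t)
  mem : ∀ t < k, u (t + 1) ∈ U
  isMin : ∀ t < k, IsMinOn
    (fun w => φ w + μ * ω w + G (t + 1) w + apgEta L μ * bregman ω w (u t)) U (u (t + 1))

/-- The output `(∑_{t=1}^k θ_t)⁻¹ ∑_{t=1}^k θ_t u^t`, with weights `θ_t = α^{-t}`. -/
def apgAvg (L μ : ℝ) (u : ℕ → E) (k : ℕ) : E :=
  (∑ t ∈ Finset.Icc 1 k, (apgAlpha L μ ^ t)⁻¹)⁻¹ •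
    ∑ t ∈ Finset.Icc 1 k, (apgAlpha L μ ^ t)⁻¹ • u t

end Bregman

/-! ### The max-structured problem -/

/-- The data of `min_{x ∈ X} q(x) = f(x) + r(x)`, `f(x) = max_{y ∈ Y} Φ(x,y) - g(y)`.  The values
of `r` off `X`, of `g` off `Y` and of `Φ` off `X' × Y` and `X × Y'` play no role, so the
functions are taken real-valued. -/
structure Problem (E : Type u) (F : Type v) [NormedAddCommGroup E] [NormedSpace ℝ E]
    [NormedAddCommGroup F] [NormedSpace ℝ F] where
  /-- the primal feasible set -/
  X : Set E
  /-- the open set containing `X` on which `Φ(·,y)` and `ωX` are differentiable -/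
  Xn : Set E
  /-- the dual feasible set -/
  Y : Set F
  /-- the open set containing `Y` on which `Φ(x,·)` is differentiable -/
  Yn : Set F
  Φ : E → F → ℝ
  r : E → ℝ
  g : F → ℝ
  /-- distance generating function on `X`, and its effective domain -/
  ωX : E → ℝ
  domX : Set E
  /-- distance generating function on `Y`, and its effective domain -/
  ωY : F → ℝ
  domY : Set F
  Lxx : ℝ
  /-- Lipschitz constant of `∇ₓΦ(x,·)` -/
  Lxyb : ℝ
  /-- Lipschitz constant of `∇_yΦ(·,y)` -/
  Lyx : ℝ
  Lyy : ℝ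
  /-- weak convexity modulus of `Φ(·,y)` -/
  γ : ℝ
  Mr : ℝ
  Mg : ℝ
  /-- Lipschitz constant of `∇ωX` -/
  β : ℝ

namespace Problem

variable {E : Type u} {F : Type v} [NormedAddCommGroup E] [NormedSpace ℝ E]
  [NormedAddCommGroup F] [NormedSpace ℝ F] (P : Problem E F)

/-- The primal first-order oracle `(x,y) ↦ ∇ₓΦ(x,y)`. -/
def oracleP (x : E) (y : F) : E →L[ℝ] ℝ := fderiv ℝ (fun x' => P.Φ x' y) x

/-- The dual first-order oracle `(x,y) ↦ ∇_yΦ(x,y)`. -/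
def oracleD (x : E) (y : F) : F →L[ℝ] ℝ := fderiv ℝ (fun y' => P.Φ x y') y

/-- `f(x) = max_{y ∈ Y} Φ(x,y) - g(y)`. -/
def f (x : E) : ℝ := sSup ((fun y => P.Φ x y - P.g y) '' P.Y)

/-- `q = f + r`. -/
def q (x : E) : ℝ := P.f x + P.r x

/-- `q^* = inf_{x ∈ X} q(x)`. -/
def qStar : ℝ := sInf (P.q '' P.X)

/-- The standing assumptions on the problem. -/
structure Standing : Prop where
  X_nonempty : P.X.Nonempty
  X_closed : IsClosed P.X
  X_convex : Convex ℝ P.X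
  Y_nonempty : P.Y.Nonempty
  Y_closed : IsClosed P.Y
  Y_convex : Convex ℝ P.Y
  Y_bounded : Bornology.IsBounded P.Y
  q_bddBelow : BddBelow (P.q '' P.X)
  r_convex : ConvexOn ℝ P.X P.r
  Mr_nonneg : 0 ≤ P.Mr
  r_lip : ∀ x ∈ P.X, ∀ x' ∈ P.X, |P.r x - P.r x'| ≤ P.Mr * ‖x - x'‖
  g_convex : ConvexOn ℝ P.Y P.g
  Mg_nonneg : 0 ≤ P.Mg
  g_lip : ∀ y ∈ P.Y, ∀ y' ∈ P.Y, |P.g y - P.g y'| ≤ P.Mg * ‖y - y'‖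
  /- smoothness of `Φ(·,y)` -/
  Xn_open : IsOpen P.Xn
  X_subset : P.X ⊆ P.Xn
  diff_x : ∀ y ∈ P.Y, ∀ x ∈ P.Xn, DifferentiableAt ℝ (fun x' => P.Φ x' y) x
  Lxyb_nonneg : 0 ≤ P.Lxyb
  lip_xx : ∀ x ∈ P.X, ∀ x' ∈ P.X, ∀ y ∈ P.Y,
    ‖P.oracleP x y - P.oracleP x' y‖ ≤ P.Lxx * ‖x - x'‖
  lip_xy : ∀ x ∈ P.X, ∀ y ∈ P.Y, ∀ y' ∈ P.Y,
    ‖P.oracleP x y - P.oracleP x y'‖ ≤ P.Lxyb * ‖y - y'‖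
  /- joint continuity of `Φ` -/
  continuousOn : ContinuousOn (fun z : E × F => P.Φ z.1 z.2) (P.X ×ˢ P.Y)
  /- weak convexity of `Φ(·,y)` -/
  γ_pos : 0 < P.γ
  γ_le : P.γ ≤ P.Lxx
  weak_convex : ∀ y ∈ P.Y, ∀ x ∈ P.X, ∀ x' ∈ P.X,
    -(P.γ / 2) * ‖x' - x‖ ^ 2 ≤ P.Φ x' y - P.Φ x y - P.oracleP x y (x' - x)
  /- concavity of `Φ(x,·)` -/
  concave : ∀ x ∈ P.X, ConcaveOn ℝ P.Y (P.Φ x)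
  /- the distance generating functions -/
  dgfX : IsDGF P.X P.domX P.ωX
  dgfY : IsDGF P.Y P.domY P.ωY
  Xn_subset_domX : P.Xn ⊆ P.domX
  ωX_diff : DifferentiableOn ℝ P.ωX P.Xn
  ωX_diff2 : DifferentiableOn ℝ (fderiv ℝ P.ωX) P.Xn
  one_le_β : 1 ≤ P.β
  ωX_lip : ∀ x ∈ P.X, ∀ x' ∈ P.X,
    ‖fderiv ℝ P.ωX x - fderiv ℝ P.ωX x'‖ ≤ P.β * ‖x - x'‖
  /- `r` has tractable Bregman proximal projections on `X` -/
  r_tractable : TractableBPP P.X P.domX P.ωX P.r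

/-- Smoothness of `Φ(x,·)`. -/
structure DualSmooth : Prop where
  Yn_open : IsOpen P.Yn
  Y_subset : P.Y ⊆ P.Yn
  diff_y : ∀ x ∈ P.X, ∀ y ∈ P.Yn, DifferentiableAt ℝ (fun y' => P.Φ x y') y
  Lyx_nonneg : 0 ≤ P.Lyx
  Lyy_nonneg : 0 ≤ P.Lyy
  lip_yx : ∀ x ∈ P.X, ∀ x' ∈ P.X, ∀ y ∈ P.Y,
    ‖P.oracleD x y - P.oracleD x' y‖ ≤ P.Lyx * ‖x - x'‖
  lip_yy : ∀ x ∈ P.X, ∀ y ∈ P.Y, ∀ y' ∈ P.Y,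
    ‖P.oracleD x y - P.oracleD x y'‖ ≤ P.Lyy * ‖y - y'‖

/-- `g` has tractable Bregman proximal projections on `Y`. -/
def DualTractable : Prop := TractableBPP P.Y P.domY P.ωY P.g

/-! ### Derived constants, smoothing, near-stationarity -/

/-- `L_xy`, the larger of the two cross Lipschitz constants. -/
def Lxy : ℝ := max P.Lxyb P.Lyx

/-- `Ω = sup_{y ∈ Y} |ωY(y)|`. -/
def Omega : ℝ := sSup ((fun y => |P.ωY y|) '' P.Y)

/-- `λ = 1/(2γ)`. -/
def lam : ℝ := 1 / (2 * P.γ)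

/-- The proximal objective `Q^λ(x'; x) = q(x') + λ⁻¹ D(x', x)`. -/
def Q (x' x : E) : ℝ := P.q x' + P.lam⁻¹ * bregman P.ωX x' x

/-- `x` is an `ε`-near-stationary point: `x ∈ X`, the minimizer `p = prox(q,x,λ)` of `Q^λ(·;x)`
over `X` exists and is unique, and `‖x - p‖ ≤ ε λ / β`. -/
def NearStationary (ε : ℝ) (x : E) : Prop :=
  x ∈ P.X ∧ ∃ p : E, (∀ p', (p' ∈ P.X ∧ IsMinOn (fun x' => P.Q x' x) P.X p') ↔ p' = p) ∧
    ‖x - p‖ ≤ ε * P.lam / P.β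

/-- The dually smoothed `f_ρ(x) = max_{y ∈ Y} Φ(x,y) - g(y) - ρ ωY(y)`. -/
def fRho (ρ : ℝ) (x : E) : ℝ := sSup ((fun y => P.Φ x y - P.g y - ρ * P.ωY y) '' P.Y)

/-- `Q_ρ^λ(x'; x) = f_ρ(x') + r(x') + λ⁻¹ D(x', x)`. -/
def QRho (ρ : ℝ) (x' x : E) : ℝ :=
  P.fRho ρ x' + P.r x' + P.lam⁻¹ * bregman P.ωX x' x

/-- `q_ρ^λ(x) = inf_{x' ∈ X} Q_ρ^λ(x'; x)`. -/
def qRhoEnv (ρ : ℝ) (x : E) : ℝ := sInf ((fun x' => P.QRho ρ x' x) '' P.X)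

/-! ### The saddle-point subproblem of one proximal step centred at `xk`

`min_{x ∈ X} max_{y ∈ Y} μ ωX(x) + r(x) + Ψ(x,y) - g(y) - ρ ωY(y)`, with
`Ψ(x,y) = (λ⁻¹ - μ) ωX(x) + Φ(x,y) - λ⁻¹ ⟨∇ωX(xk), x⟩` and `μ = λ⁻¹ - γ`. -/

/-- `μ = λ⁻¹ - γ` (which equals `γ`). -/
def mu : ℝ := P.lam⁻¹ - P.γ

/-- `L'_xx = L_xx + λ⁻¹ β`. -/
def Lxx' : ℝ := P.Lxx + P.lam⁻¹ * P.β

/-- `L'_ρ = L'_xx + L_xy²/ρ`. -/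
def Lrho' (ρ : ℝ) : ℝ := P.Lxx' + P.Lxy ^ 2 / ρ

/-- `L_π = L_yy + L_xy²/μ`. -/
def Lpi : ℝ := P.Lyy + P.Lxy ^ 2 / P.mu

/-- The coupling function `Ψ`. -/
def Psi (xk x : E) (y : F) : ℝ :=
  (P.lam⁻¹ - P.mu) * P.ωX x + P.Φ x y - P.lam⁻¹ * fderiv ℝ P.ωX xk x

/-- `∇ₓΨ(x,y)`, as computed from one primal oracle call. -/
def gradPsiX (xk x : E) (y : F) : E →L[ℝ] ℝ :=
  (P.lam⁻¹ - P.mu) • fderiv ℝ P.ωX x + P.oracleP x y - P.lam⁻¹ • fderiv ℝ P.ωX xk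

/-- `ψᴾ(x,y) = Ψ(x,y) + r(x) + μ ωX(x)`. -/
def psiP (xk x : E) (y : F) : ℝ := P.Psi xk x y + P.r x + P.mu * P.ωX x

/-- `π(y) = min_{x ∈ X} ψᴾ(x,y)`. -/
def dualPi (xk : E) (y : F) : ℝ := sInf ((fun x => P.psiP xk x y) '' P.X)

/-- The dual function `d_ρ(y) = π(y) - g(y) - ρ ωY(y)`. -/
def dualFun (ρ : ℝ) (xk : E) (y : F) : ℝ := P.dualPi xk y - P.g y - ρ * P.ωY y

/-- `x` minimizes `ψᴾ(·,y)` over `X` up to `δ`. -/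
def PrimalAcc (xk : E) (y : F) (δ : ℝ) (x : E) : Prop :=
  ∀ x' ∈ P.X, P.psiP xk x y ≤ P.psiP xk x' y + δ

/-- `y` maximizes `d_ρ` over `Y` up to `δ`. -/
def DualAcc (ρ : ℝ) (xk : E) (δ : ℝ) (y : F) : Prop :=
  ∀ y' ∈ P.Y, P.dualFun ρ xk y' ≤ P.dualFun ρ xk y + δ

/-- Solving the primal subproblem `min_{x ∈ X} ψᴾ(x,y)` to accuracy `δ` by the exact accelerated
proximal gradient method with `h = Ψ(·,y)`, `φ = r`, `L = L'_xx`, from the starting point `x0`: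
the loop is left at the first iteration `n ≥ 1` whose output is `δ`-accurate, and `x` is
this output.  Each iteration makes one primal oracle call, so `n` is the number of calls. -/
def InnerSolve (x0 xk : E) (y : F) (δ : ℝ) (x : E) (n : ℕ) : Prop :=
  ∃ u uh : ℕ → E,
    IsAPG P.X P.ωX P.r P.Lxx' P.mu x0 n u uh (fun t => P.gradPsiX xk (uh t) y) ∧
    1 ≤ n ∧
    x = apgAvg P.Lxx' P.mu u n ∧
    P.PrimalAcc xk y δ x ∧
    ∀ m, 1 ≤ m → m < n → ¬ P.PrimalAcc xk y δ (apgAvg P.Lxx' P.mu u m)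

/-- Smoothness constant used in the dual method; it is `L_π` as soon as `ρ ≤ L_π` (the method
needs a smoothness constant that is at least `ρ`). -/
def Ldual (ρ : ℝ) : ℝ := max P.Lpi ρ

/-- The accuracy `δ₂` of the primal subproblems inside the dual method of target accuracy `δ`. -/
def delta2 (ρ δ : ℝ) : ℝ :=
  δ * P.mu * ρ ^ (3 / 2 : ℝ) /
    ((14 * Real.sqrt 2) ^ 2 * P.Lxy ^ 2 * Real.sqrt (P.Ldual ρ) *
      (1 + Real.sqrt (P.Ldual ρ / ρ)) ^ 2)

/-- Solving the dual problem `max_{y ∈ Y} d_ρ(y)` to accuracy `δ` by the inexact accelerated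
proximal gradient method with `h = -π`, `φ = g`, strong convexity `ρ ωY`, from the starting point
`y0`.  At the query point `vh t`, the primal subproblem is solved to accuracy `δ₂`, giving `xs t`
with `ns t` primal oracle calls, and one dual oracle call at `(xs t, vh t)` gives the inexact
gradient (`∇_yΨ = ∇_yΦ`).  The loop is left at the first iteration `nd ≥ 1` whose output is
`δ`-accurate, and `y` is this output.  In total, there are `nd` dual and `np` primal calls. -/
def DualSolve (x0 : E) (y0 : F) (ρ : ℝ) (xk : E) (δ : ℝ) (y : F) (np nd : ℕ) : Prop :=
  ∃ (w vh : ℕ → F) (xs : ℕ → E) (ns : ℕ → ℕ),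
    IsAPG P.Y P.ωY P.g (P.Ldual ρ) ρ y0 nd w vh (fun t => -P.oracleD (xs t) (vh t)) ∧
    (∀ t, 1 ≤ t → t ≤ nd → P.InnerSolve x0 xk (vh t) (P.delta2 ρ δ) (xs t) (ns t)) ∧
    1 ≤ nd ∧
    y = apgAvg (P.Ldual ρ) ρ w nd ∧
    P.DualAcc ρ xk δ y ∧
    (∀ m, 1 ≤ m → m < nd → ¬ P.DualAcc ρ xk δ (apgAvg (P.Ldual ρ) ρ w m)) ∧
    np = ∑ t ∈ Finset.Icc 1 nd, ns t

/-- The bound `B_ρ` on the gradient of the smoothed primal function at its minimizer,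
computed from a reference point `xr`. -/
def boundF (ρ : ℝ) (xk xr : E) : ℝ :=
  P.Lxy * Metric.diam P.Y + sSup ((fun y => ‖P.gradPsiX xk xr y‖) '' P.Y) +
    P.Lxx' / Real.sqrt P.mu *
      (1 + P.Lxy / Real.sqrt P.mu + 2 * Real.sqrt P.Omega) +
    2 * P.Lrho' ρ * Real.sqrt (ρ * P.Omega / P.mu)

/-- The bound `B_ρ(ωX)` on the gradient of `ωX` at the same minimizer. -/
def boundOmega (ρ : ℝ) (xr : E) : ℝ :=
  ‖fderiv ℝ P.ωX xr‖ + P.β / Real.sqrt P.mu *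
    (1 + P.Lxy / Real.sqrt P.mu + 2 * Real.sqrt P.Omega * (1 + Real.sqrt ρ))

/-- The inner minimum in the choices of `ε₃` and `ε₄`.  The function `ωX` enters the primal
objective with the factor `μ`, hence so do its gradient bound and smoothness constant. -/
def accMin (ρ η : ℝ) (xk xr : E) : ℝ :=
  min (η / (8 * (P.boundF ρ xk xr + P.Mr + P.mu * P.boundOmega ρ xr) ^ 2))
    (1 / (P.Lrho' ρ + P.mu * P.β))

/-- The dual accuracy `ε₃`. -/
def eps3 (ρ η : ℝ) (xk xr : E) : ℝ :=
  min (η * P.mu ^ 2 * ρ / (64 * P.Lxy ^ 2) * P.accMin ρ η xk xr) (η / 4)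

/-- The final primal accuracy `ε₄`. -/
def eps4 (ρ η : ℝ) (xk xr : E) : ℝ := η * P.mu / 64 * P.accMin ρ η xk xr

/-- The dual smoothing parameter `ρ = η / (4 Ω)`. -/
def rho (η : ℝ) : ℝ := η / (4 * P.Omega)

/-- One execution of the primal-dual method on the saddle-point subproblem centred at `xk`, with
target accuracy `η`, starting points `x0`, `y0`, output `xnext`, and `np` primal and `nd` dual
oracle calls in total.
* A reference point `xr` is computed with dual regularization `1` and accuracies `1/2`.
* The dual problem is solved to accuracy `ε₃`, with output `y`.
* The primal subproblem at `y` is solved to accuracy `ε₄`. -/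
def CaseIIStep (x0 : E) (y0 : F) (η : ℝ) (xk xnext : E) (np nd : ℕ) : Prop :=
  ∃ (yr : F) (xr : E) (y : F) (np₁ nd₁ n₁ np₂ nd₂ n₂ : ℕ),
    P.DualSolve x0 y0 1 xk (1 / 2) yr np₁ nd₁ ∧
    P.InnerSolve x0 xk yr (1 / 2) xr n₁ ∧
    P.DualSolve x0 y0 (P.rho η) xk (P.eps3 (P.rho η) η xk xr) y np₂ nd₂ ∧
    P.InnerSolve x0 xk y (P.eps4 (P.rho η) η xk xr) xnext n₂ ∧
    np = np₁ + n₁ + np₂ + n₂ ∧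
    nd = nd₁ + nd₂

/-- A terminating run of the primal dual smoothing framework with accuracy parameter `η`, from
`x1`, whose proximal steps are performed by the primal-dual method above (with starting
points `x0`, `y0`).  It stops in iteration `K`, the first with `‖x_{k+1} - x_k‖ ≤ 4 √(λ η)`, and its
output is `x K`; iteration `k` makes `np k` primal and `nd k` dual oracle calls. -/
structure IsRun (x0 : E) (y0 : F) (η : ℝ) (x1 : E) (x : ℕ → E) (np nd : ℕ → ℕ) (K : ℕ) :
    Prop where
  init : x 1 = x1
  one_le : 1 ≤ K
  step : ∀ k, 1 ≤ k → k ≤ K → P.CaseIIStep x0 y0 η (x k) (x (k + 1)) (np k) (nd k)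
  continues : ∀ k, 1 ≤ k → k < K → 4 * Real.sqrt (P.lam * η) < ‖x (k + 1) - x k‖
  stops : ‖x (K + 1) - x K‖ ≤ 4 * Real.sqrt (P.lam * η)

/-- The requirement on the iterate `x_{k+1}` in the framework:
`x_{k+1} ∈ X^o` and `Q_ρ^λ(x_{k+1}; x_k) ≤ q_ρ^λ(x_k) + η`. -/
def StepOK (η : ℝ) (xk xnext : E) : Prop :=
  xnext ∈ core P.X P.domX ∧
    P.QRho (P.rho η) xnext xk ≤ P.qRhoEnv (P.rho η) xk + η

end Problem

end PDSmooth

end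

namespace PDSmooth

/-! ### Convexity and first-order inequalities -/

section General

variable {E : Type*} [NormedAddCommGroup E] [NormedSpace ℝ E]

/-! Three layers are stacked: an inexact accelerated method, a regularized saddle-point problem, and
an outer proximal loop.

Convexification. Of the weight `λ⁻¹ = 2γ` on the Bregman term, one `γ` repairs the weak convexity of
`Φ(·,y)` (`Psi_subgradient`) and the other makes `ψᴾ(·,y)` strongly convex with modulus `μ = γ`. Its
minimizer `xStar y` is then `L_xy/μ`-Lipschitz in `y`, so `∇_yΦ(xStar y, y)` is an `L_π`-Lipschitz
field of supergradients of `π`. Both the primal and the dual subproblem thus have the composite form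
`h + φ + μω`, with subgradients Lipschitz on the feasible set.

Accelerated method. A potential (objective gap at a running mean plus a Bregman distance) contracts
by `α` per iteration up to a gradient error. Against the minimizer, the Bregman term absorbs that
error at the price of half the contraction (`IsAPG.potential_le`). The actual output omits the
starting point from the mean; this changes the objective by a geometrically small amount
(`IsAPG.accuracy`). Accuracy `δ` costs `O(√(L/μ) log(A/δ))` iterations, `A` being a constant of the
starting data.

One proximal step. The first-order condition for `y*` as maximizer of `d_ρ` also says that `y*`
maximizes the regularized `Φ(x*,·)`, where `x* = xStar y*`. Hence `x*` minimizes `Q_ρ^λ(·;x_k)` with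
quadratic growth, and no minimax theorem is needed (`QRho_growth`). The accuracies `ε₃, ε₄` put the
output close to `x*`; a quadratic upper bound at `x*` (`QRho_upper`), whose slope is controlled
through the reference point, turns closeness into accuracy `η`.

Outer loop. Smoothing shifts the objective by at most `ρΩ = η/4`, so a step is `3η/2`-optimal for
the unsmoothed proximal problem. A long step lowers `q` by at least `13η/2`, which bounds the number
of steps by a multiple of `γ/ε²`; after a short step, the proximal point is near the centre
(`nearStationary`).

Complexity. The condition numbers give `√(L'_xx/μ)` for the primal solver and `√(L_π/ρ)`, of order
`(√(L_yy γ) + L_xy)/ε`, for the dual one. Everything else, including `‖∇ωX(x_k)‖`, occurs only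
inside logarithms. It is polynomial in `1/ε`, because the centres stay within `O(ε⁻²)` of `x1`. The
degrees are absolute numbers, so for small `ε` each logarithm is at most an absolute multiple of
`log(1/ε)`; the instance-dependent coefficients only affect `ε0`. This is why `C` depends on `β`,
`Ω` and the initial gap alone. -/

lemma nonneg_of_forall_small {a k : ℝ}
    (h : ∀ s : ℝ, 0 < s → s < 1 → 0 ≤ s * a + s ^ 2 * k) : 0 ≤ a := by
  by_contra! ha
  have hk : 0 < 2 * (|k| + 1) + -a := by linarith [abs_nonneg k]
  -- This `s` lies in `(0,1)` and satisfies `s(|k|+1) < -a/2`, so `a + s k` would be negative.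
  set s := -a / (2 * (|k| + 1) + -a) with hs
  have hs0 : 0 < s := div_pos (by linarith) hk
  have hs1 : s < 1 := by
    rw [hs, div_lt_one hk]; linarith [abs_nonneg k]
  have h1 := h s hs0 hs1
  have h2 : 0 ≤ a + s * k := by
    have : 0 ≤ s * (a + s * k) := by linarith
    exact nonneg_of_mul_nonneg_right this hs0
  have h3 : s * k ≤ s * (|k| + 1) :=
    mul_le_mul_of_nonneg_left (by linarith [le_abs_self k]) hs0.le
  have h4 : s * (2 * (|k| + 1) + -a) = -a := by rw [hs]; field_simp
  nlinarith [abs_nonneg k]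

/-- One-sided difference quotients suffice, so `f` need only be controlled along a feasible
direction. The `s²` slack accommodates strong convexity. -/
lemma fderiv_le_of_forall_segment {f : E → ℝ} {f' : E →L[ℝ] ℝ} {u d : E} {c k : ℝ}
    (hf : HasFDerivAt f f' u)
    (h : ∀ s : ℝ, 0 < s → s < 1 → f (u + s • d) ≤ f u + s * c + s ^ 2 * k) : f' d ≤ c := by
  have h1 := (hf.hasLineDerivAt d).tendsto_slope_zero_right
  have h2 : Tendsto (fun s : ℝ => c + s * k) (𝓝[>] 0) (𝓝 (c + 0 * k)) :=
    ((continuous_const.add (continuous_id.mul continuous_const)).tendsto 0).mono_left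
      nhdsWithin_le_nhds
  rw [zero_mul, add_zero] at h2
  refine le_of_tendsto_of_tendsto h1 h2 ?_
  have h3 : Ioo (0 : ℝ) 1 ∈ 𝓝[>] (0 : ℝ) := Ioo_mem_nhdsGT one_pos
  filter_upwards [h3] with s hs
  have := h s hs.1 hs.2
  rw [smul_eq_mul, inv_mul_le_iff₀ hs.1]
  nlinarith

lemma Convex.segment_mem {U : Set E} (hU : Convex ℝ U) {u v : E} (hu : u ∈ U) (hv : v ∈ U)
    {s : ℝ} (hs0 : 0 ≤ s) (hs1 : s ≤ 1) : u + s • (v - u) ∈ U := by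
  have := hU hu hv (sub_nonneg.2 hs1) hs0 (by ring)
  convert this using 1
  module

lemma ConvexOn.segment_le {U : Set E} {f : E → ℝ} (hf : ConvexOn ℝ U f) {u v : E} (hu : u ∈ U)
    (hv : v ∈ U) {s : ℝ} (hs0 : 0 ≤ s) (hs1 : s ≤ 1) :
    f (u + s • (v - u)) ≤ (1 - s) * f u + s * f v := by
  have := hf.2 hu hv (sub_nonneg.2 hs1) hs0 (by ring)
  rwa [show u + s • (v - u) = (1 - s) • u + s • v by module]

lemma StrongConvexOn.segment_le {U : Set E} {m : ℝ} {f : E → ℝ} (hf : StrongConvexOn U m f)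
    {u v : E} (hu : u ∈ U) (hv : v ∈ U) {s : ℝ} (hs0 : 0 ≤ s) (hs1 : s ≤ 1) :
    f (u + s • (v - u)) ≤ (1 - s) * f u + s * f v - (1 - s) * s * (m / 2 * ‖v - u‖ ^ 2) := by
  have := hf.2 hu hv (sub_nonneg.2 hs1) hs0 (by ring)
  rw [norm_sub_rev u v] at this
  rwa [show u + s • (v - u) = (1 - s) • u + s • v by module]

lemma strongConvexOn_of_forall_segment {U : Set E} (hU : Convex ℝ U) {m : ℝ} {f : E → ℝ}
    (h : ∀ u ∈ U, ∀ v ∈ U, ∀ s : ℝ, 0 ≤ s → s ≤ 1 → f (u + s • (v - u)) ≤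
      (1 - s) * f u + s * f v - (1 - s) * s * (m / 2 * ‖v - u‖ ^ 2)) : StrongConvexOn U m f := by
  refine ⟨hU, fun u hu v hv a b ha hb hab => ?_⟩
  have := h u hu v hv b hb (by linarith)
  have ha' : 1 - b = a := by linarith
  rw [ha', norm_sub_rev v u, show u + b • (v - u) = a • u + b • v by rw [← ha']; module] at this
  exact this

lemma StrongConvexOn.convexOn_add {U : Set E} {m c : ℝ} {f h : E → ℝ} (hh : ConvexOn ℝ U h)
    (hf : StrongConvexOn U m f) (hc : 0 ≤ c) :
    StrongConvexOn U (c * m) (fun x => h x + c * f x) := by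
  refine strongConvexOn_of_forall_segment hh.1 fun u hu v hv s h0 h1 => ?_
  have h2 := ConvexOn.segment_le hh hu hv h0 h1
  have h3 := mul_le_mul_of_nonneg_left (StrongConvexOn.segment_le hf hu hv h0 h1) hc
  linarith

/-- Compare `p` with points of the segment towards `v` and let them tend to `p`; no
differentiability is involved. All later distance estimates come from this growth. -/
lemma StrongConvexOn.growth {U : Set E} {m : ℝ} {f : E → ℝ} (hf : StrongConvexOn U m f)
    {p : E} (hp : p ∈ U) (hmin : IsMinOn f U p) {v : E} (hv : v ∈ U) :
    f p + m / 2 * ‖v - p‖ ^ 2 ≤ f v := by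
  have : 0 ≤ f v - f p - m / 2 * ‖v - p‖ ^ 2 := by
    apply nonneg_of_forall_small (k := m / 2 * ‖v - p‖ ^ 2)
    intro s h0 h1
    have h2 := StrongConvexOn.segment_le hf hp hv h0.le h1.le
    have h3 : f p ≤ _ := hmin (Convex.segment_mem hf.1 hp hv h0.le h1.le)
    nlinarith
  linarith

lemma StrongConvexOn.eq_of_isMinOn {U : Set E} {m : ℝ} (hm : 0 < m) {f : E → ℝ}
    (hf : StrongConvexOn U m f) {p p' : E} (hp : p ∈ U) (hmin : IsMinOn f U p) (hp' : p' ∈ U)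
    (hmin' : IsMinOn f U p') : p' = p := by
  have h1 := StrongConvexOn.growth hf hp hmin hp'
  have h2 : f p' ≤ f p := hmin' hp
  have h3 : ‖p' - p‖ ^ 2 ≤ 0 := by
    by_contra! h
    nlinarith [mul_pos hm h]
  have h4 : ‖p' - p‖ = 0 := by nlinarith [norm_nonneg (p' - p)]
  exact sub_eq_zero.1 (norm_eq_zero.1 h4)

lemma StrongConvexOn.exists_isMinOn [FiniteDimensional ℝ E] {U : Set E} (hUc : IsClosed U)
    (hne : U.Nonempty) {m : ℝ} (hm : 0 < m) {f : E → ℝ} (hf : StrongConvexOn U m f)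
    (hlsc : LowerSemicontinuousOn f U) : ∃ p ∈ U, IsMinOn f U p := by
  obtain ⟨u0, hu0⟩ := hne
  have hcpt : ∀ R : ℝ, IsCompact (U ∩ Metric.closedBall u0 R) := fun R =>
    (isCompact_closedBall u0 R).inter_left hUc
  have hex : ∀ R : ℝ, 0 ≤ R → ∃ p ∈ U ∩ Metric.closedBall u0 R,
      IsMinOn f (U ∩ Metric.closedBall u0 R) p := fun R hR =>
    LowerSemicontinuousOn.exists_isMinOn ⟨u0, hu0, Metric.mem_closedBall_self hR⟩ (hcpt R)
      (hlsc.mono inter_subset_left)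
  obtain ⟨b, hb, hbmin⟩ := hex 1 zero_le_one
  have hb0 : f b ≤ f u0 := hbmin ⟨hu0, Metric.mem_closedBall_self zero_le_one⟩
  -- Beyond this radius `f` exceeds `f u0`: the point of the segment at distance `1` from `u0` has
  -- value at least `f b`, and strong convexity extrapolates this to the far end.
  set R : ℝ := 1 + 2 * (f u0 - f b) / m with hR
  have hR1 : 1 ≤ R := by
    have : 0 ≤ 2 * (f u0 - f b) / m := div_nonneg (by linarith) hm.le
    linarith
  obtain ⟨p, hp, hpmin⟩ := hex R (by linarith)
  refine ⟨p, hp.1, fun v hv => ?_⟩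
  by_cases hvR : ‖v - u0‖ ≤ R
  · exact hpmin ⟨hv, by rwa [Metric.mem_closedBall, dist_eq_norm]⟩
  push Not at hvR
  have h0 : f p ≤ f u0 := hpmin ⟨hu0, Metric.mem_closedBall_self (by linarith)⟩
  refine h0.trans ?_
  set N := ‖v - u0‖ with hN
  have hN1 : 1 < N := by linarith
  have hN0 : 0 < N := by linarith
  have hs1 : N⁻¹ ≤ 1 := inv_le_one_of_one_le₀ hN1.le
  have hs0 : 0 ≤ N⁻¹ := inv_nonneg.2 hN0.le
  have hw := StrongConvexOn.segment_le hf hu0 hv hs0 hs1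
  have hwm : f b ≤ f (u0 + N⁻¹ • (v - u0)) := by
    apply hbmin
    refine ⟨Convex.segment_mem hf.1 hu0 hv hs0 hs1, ?_⟩
    rw [Metric.mem_closedBall, dist_eq_norm, add_sub_cancel_left, norm_smul, norm_inv,
      Real.norm_eq_abs, abs_of_pos hN0, ← hN, inv_mul_cancel₀ hN0.ne']
  have h3 : f b ≤ (1 - N⁻¹) * f u0 + N⁻¹ * f v - (1 - N⁻¹) * N⁻¹ * (m / 2 * N ^ 2) :=
    hwm.trans hw
  have h4 : N * f b ≤ (N - 1) * f u0 + f v - (N - 1) * (m / 2 * N) := by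
    have := mul_le_mul_of_nonneg_left h3 hN0.le
    have e : N * ((1 - N⁻¹) * f u0 + N⁻¹ * f v - (1 - N⁻¹) * N⁻¹ * (m / 2 * N ^ 2)) =
      (N - 1) * f u0 + f v - (N - 1) * (m / 2 * N) := by field_simp
    linarith
  have h5 : 2 * (f u0 - f b) / m < N - 1 := by linarith
  rw [div_lt_iff₀ hm] at h5
  nlinarith

lemma convexOn_of_subgradient {U : Set E} (hU : Convex ℝ U) {h : E → ℝ} {g : E → E →L[ℝ] ℝ}
    (hsub : ∀ u ∈ U, ∀ v ∈ U, h u + g u (v - u) ≤ h v) : ConvexOn ℝ U h := by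
  refine ⟨hU, fun u hu v hv a b ha hb hab => ?_⟩
  set z := a • u + b • v
  have hz : z ∈ U := hU hu hv ha hb hab
  have h1 := mul_le_mul_of_nonneg_left (hsub z hz u hu) ha
  have h2 := mul_le_mul_of_nonneg_left (hsub z hz v hv) hb
  have h3 : a * g z (u - z) + b * g z (v - z) = 0 := by
    have : a • (u - z) + b • (v - z) = 0 := by
      have hz' : a • (u - z) + b • (v - z) = (a • u + b • v) - (a + b) • z := by module
      rw [hz', hab, one_smul, sub_self]
    have h4 := congrArg (g z) this
    simpa using h4
  simp only [smul_eq_mul]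
  have : h z = a * h z + b * h z := by rw [← add_mul, hab, one_mul]
  rw [this]
  linarith

/-- A convex function with an `L`-Lipschitz field of subgradients satisfies the quadratic upper
bound with constant `L`. -/
lemma quadratic_upper_bound {U : Set E} (hU : Convex ℝ U) {h : E → ℝ} {g : E → E →L[ℝ] ℝ}
    {L : ℝ} (hsub : ∀ u ∈ U, ∀ v ∈ U, h u + g u (v - u) ≤ h v)
    (hlip : ∀ u ∈ U, ∀ v ∈ U, ‖g u - g v‖ ≤ L * ‖u - v‖) {u v : E} (hu : u ∈ U) (hv : v ∈ U) :
    h v ≤ h u + g u (v - u) + L / 2 * ‖v - u‖ ^ 2 := by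
  -- `g` is only a field of subgradients, so there is nothing to integrate. The segment is cut into
  -- `n + 1` pieces, the subgradient inequality is applied at the far end of each, and the sum is a
  -- Riemann sum with error factor `1 + 1/(n+1)`.
  have key : ∀ n : ℕ, h v ≤ h u + g u (v - u) +
      L / 2 * ‖v - u‖ ^ 2 * (1 + 1 / ((n : ℝ) + 1)) := by
    intro n
    set N : ℝ := (n : ℝ) + 1 with hN
    have hN0 : 0 < N := by positivity
    have hind : ∀ j : ℕ, (j : ℝ) ≤ N → h (u + ((j : ℝ) / N) • (v - u)) ≤
        h u + (j / N) * g u (v - u) + L * ‖v - u‖ ^ 2 * ((j * (j + 1) / 2) / N ^ 2) := by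
      intro j
      induction j with
      | zero => intro _; simp
      | succ j ih =>
        intro hj
        push_cast at hj ⊢
        have ih' := ih (by linarith)
        set z := u + ((j : ℝ) / N) • (v - u) with hz
        set z' := u + (((j : ℝ) + 1) / N) • (v - u) with hz'
        have hzU : z ∈ U := Convex.segment_mem hU hu hv (by positivity)
          ((div_le_one hN0).2 (by linarith))
        have hzU' : z' ∈ U := Convex.segment_mem hU hu hv (by positivity)
          ((div_le_one hN0).2 hj)
        have h1 := hsub z' hzU' z hzU
        have h2 : z - z' = (-(1 / N)) • (v - u) := by
          rw [hz, hz']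
          have : ((j : ℝ) + 1) / N = j / N + 1 / N := by ring
          rw [this]; module
        have h3 : z' - u = (((j : ℝ) + 1) / N) • (v - u) := by rw [hz']; simp
        have h4 : g z' (v - u) ≤ g u (v - u) + L * (((j : ℝ) + 1) / N) * ‖v - u‖ ^ 2 := by
          have h5 := (le_abs_self _).trans ((g z' - g u).le_opNorm (v - u))
          have h6 := mul_le_mul_of_nonneg_right (hlip z' hzU' u hu) (norm_nonneg (v - u))
          rw [h3, norm_smul, Real.norm_eq_abs, abs_of_nonneg (by positivity)] at h6
          simp only [_root_.sub_apply] at h5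
          nlinarith
        rw [h2, map_smul, smul_eq_mul] at h1
        have h7 := mul_le_mul_of_nonneg_left h4 (by positivity : 0 ≤ 1 / N)
        have e : h u + (((j : ℝ) + 1) / N) * g u (v - u) + L * ‖v - u‖ ^ 2 *
            ((((j : ℝ) + 1) * (j + 1 + 1) / 2) / N ^ 2) =
            (h u + (j / N) * g u (v - u) + L * ‖v - u‖ ^ 2 * ((j * (j + 1) / 2) / N ^ 2)) +
            1 / N * (g u (v - u) + L * (((j : ℝ) + 1) / N) * ‖v - u‖ ^ 2) := by
          field_simp; ring
        rw [e]; linarith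
    have := hind (n + 1) (by push_cast; rfl)
    push_cast at this
    rw [← hN, div_self hN0.ne', one_smul, add_sub_cancel, one_mul] at this
    refine this.trans (le_of_eq ?_)
    field_simp
  have ht : Tendsto (fun n : ℕ => h u + g u (v - u) +
      L / 2 * ‖v - u‖ ^ 2 * (1 + 1 / ((n : ℝ) + 1))) atTop
      (𝓝 (h u + g u (v - u) + L / 2 * ‖v - u‖ ^ 2 * (1 + 0))) :=
    ((tendsto_one_div_add_atTop_nhds_zero_nat.const_add 1).const_mul _).const_add _
  simpa using ge_of_tendsto' ht key

lemma ConcaveOn.le_fderiv {U : Set E} {f : E → ℝ} (hf : ConcaveOn ℝ U f) {u v : E} (hu : u ∈ U)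
    (hv : v ∈ U) (hd : DifferentiableAt ℝ f u) : f v ≤ f u + fderiv ℝ f u (v - u) := by
  have h := fderiv_le_of_forall_segment (f := fun x => -f x) (u := u) (d := v - u)
    (c := f u - f v) (k := 0) hd.hasFDerivAt.neg fun s h0 h1 => by
      have := ConvexOn.segment_le hf.neg hu hv h0.le h1.le
      simp only [Pi.neg_apply] at this
      linarith
  simp only [_root_.neg_apply] at h
  linarith

end General

/-! ### Bregman divergences. -/

section Bregman

variable {E : Type*} [NormedAddCommGroup E] [NormedSpace ℝ E] {U W : Set E} {ω : E → ℝ}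

lemma IsDGF.hasFDerivAt (hω : IsDGF U W ω) {u : E} (hu : u ∈ core U W) :
    HasFDerivAt ω (fderiv ℝ ω u) u :=
  ((hω.contDiffOn.differentiableOn one_ne_zero).differentiableAt
    (isOpen_interior.mem_nhds hu.2)).hasFDerivAt

lemma IsDGF.le_bregman (hω : IsDGF U W ω) {u' u : E} (hu' : u' ∈ U) (hu : u ∈ core U W) :
    1 / 2 * ‖u' - u‖ ^ 2 ≤ bregman ω u' u := by
  have h := fderiv_le_of_forall_segment (f := ω) (u := u) (d := u' - u)
    (c := ω u' - ω u - 1 / 2 * ‖u' - u‖ ^ 2) (k := 1 / 2 * ‖u' - u‖ ^ 2)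
    (hω.hasFDerivAt hu) fun s h0 h1 => by
      have := StrongConvexOn.segment_le hω.strongConvexOn hu.1 hu' h0.le h1.le
      nlinarith
  unfold bregman
  linarith

lemma IsDGF.bregman_nonneg (hω : IsDGF U W ω) {u' u : E} (hu' : u' ∈ U) (hu : u ∈ core U W) :
    0 ≤ bregman ω u' u :=
  le_trans (by positivity) (hω.le_bregman hu' hu)

/-- First-order optimality of `p` for `min_U J + c ω`. -/
lemma IsDGF.optimality (hω : IsDGF U W ω) {J : E → ℝ} (hJ : ConvexOn ℝ U J) {c : ℝ} {p u : E}
    (hp : p ∈ core U W) (hmin : ∀ v ∈ U, J p + c * ω p ≤ J v + c * ω v) (hu : u ∈ U) :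
    J p + c * ω p + c * bregman ω u p ≤ J u + c * ω u := by
  -- Only `ω` is differentiated at `p`; the convex part `J` enters through its values on the
  -- segment.
  have h := fderiv_le_of_forall_segment (f := fun x => -(c * ω x)) (u := p) (d := u - p)
    (c := J u - J p) (k := 0) ((hω.hasFDerivAt hp).const_mul c).neg fun s h0 h1 => by
      have h2 := ConvexOn.segment_le hJ hp.1 hu h0.le h1.le
      have h3 := hmin _ (Convex.segment_mem hJ.1 hp.1 hu h0.le h1.le)
      linarith
  simp only [_root_.neg_apply, _root_.smul_apply, smul_eq_mul] at h
  unfold bregman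
  linarith

end Bregman


/-! ### The accelerated proximal gradient method -/

section Parameters

variable {L μ : ℝ}

lemma one_le_apgTau (hμ : 0 < μ) (hL : μ ≤ L) : 1 ≤ apgTau L μ := by
  rw [apgTau, Real.one_le_sqrt, one_le_div hμ]; exact hL

lemma apgEta_eq (hμ : 0 < μ) : apgEta L μ = μ * apgTau L μ := by
  have : L * μ = μ ^ 2 * (L / μ) := by field_simp
  rw [apgEta, apgTau, this, Real.sqrt_mul (by positivity), Real.sqrt_sq hμ.le]

lemma mul_apgTau_sq (hμ : 0 < μ) (hL : μ ≤ L) : μ * apgTau L μ ^ 2 = L := by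
  rw [apgTau, Real.sq_sqrt (div_nonneg (by linarith) hμ.le)]; field_simp

lemma one_sub_apgAlpha (hμ : 0 < μ) (hL : μ ≤ L) : 1 - apgAlpha L μ = (1 + apgTau L μ)⁻¹ := by
  have := one_le_apgTau hμ hL
  have h : 1 + apgTau L μ ≠ 0 := by linarith
  rw [apgAlpha]; field_simp; ring

lemma apgAlpha_pos (hμ : 0 < μ) (hL : μ ≤ L) : 0 < apgAlpha L μ := by
  have := one_le_apgTau hμ hL
  exact div_pos (by linarith) (by linarith)

lemma apgAlpha_lt_one (hμ : 0 < μ) (hL : μ ≤ L) : apgAlpha L μ < 1 := by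
  have := one_le_apgTau hμ hL
  rw [apgAlpha, div_lt_one (by linarith)]; linarith

/-- The contraction factor per iteration that is guaranteed for the inexact method. -/
noncomputable def apgRate (L μ : ℝ) : ℝ := 1 - (1 + apgTau L μ)⁻¹ / 2

lemma apgRate_nonneg (hμ : 0 < μ) (hL : μ ≤ L) : 0 ≤ apgRate L μ := by
  have := one_le_apgTau hμ hL
  have : (1 + apgTau L μ)⁻¹ ≤ 1 := inv_le_one_of_one_le₀ (by linarith)
  rw [apgRate]; linarith

lemma apgAlpha_le_apgRate (hμ : 0 < μ) (hL : μ ≤ L) : apgAlpha L μ ≤ apgRate L μ := by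
  have h := one_sub_apgAlpha hμ hL
  have := one_le_apgTau hμ hL
  have : 0 ≤ (1 + apgTau L μ)⁻¹ := inv_nonneg.2 (by linarith)
  rw [apgRate]; linarith

lemma apgRate_pow_le (hμ : 0 < μ) (hL : μ ≤ L) {k : ℕ} {Z : ℝ} (hZ : 0 < Z)
    (hk : 2 * (1 + apgTau L μ) * Real.log Z ≤ k) : apgRate L μ ^ k ≤ Z⁻¹ := by
  have h1 := one_le_apgTau hμ hL
  have h2 : apgRate L μ ≤ Real.exp (-((1 + apgTau L μ)⁻¹ / 2)) := by
    have := Real.add_one_le_exp (-((1 + apgTau L μ)⁻¹ / 2))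
    rw [apgRate]; linarith
  refine (pow_le_pow_left₀ (apgRate_nonneg hμ hL) h2 k).trans ?_
  rw [← Real.exp_nat_mul, ← Real.exp_log (inv_pos.2 hZ), Real.exp_le_exp, Real.log_inv]
  have h3 : 0 < 1 + apgTau L μ := by linarith
  have : (k : ℝ) * ((1 + apgTau L μ)⁻¹ / 2) = k / (2 * (1 + apgTau L μ)) := by field_simp
  have h4 : Real.log Z ≤ k / (2 * (1 + apgTau L μ)) := by
    rw [le_div_iff₀ (by linarith)]; linarith
  linarith

end Parameters

/-! ### Running means of the iterates and the averaged output. -/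

section Mean

variable {E : Type*} [NormedAddCommGroup E] [NormedSpace ℝ E]

/-- The running mean `(1 - α) ∑_{t ≤ k} α^{k-t} u t`, in which `u 0` has weight `α ^ k`. -/
noncomputable def apgMean (L μ : ℝ) (u : ℕ → E) : ℕ → E
  | 0 => u 0
  | k + 1 => apgAlpha L μ • apgMean L μ u k + (1 - apgAlpha L μ) • u (k + 1)

variable {L μ : ℝ}

lemma sum_apgWeights (hμ : 0 < μ) (hL : μ ≤ L) (k : ℕ) :
    (1 - apgAlpha L μ) * apgAlpha L μ ^ k * ∑ t ∈ Finset.Icc 1 k, (apgAlpha L μ ^ t)⁻¹ =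
      1 - apgAlpha L μ ^ k := by
  have h := apgAlpha_pos hμ hL
  induction k with
  | zero => simp
  | succ k ih =>
    rw [Finset.sum_Icc_succ_top (by omega), mul_add, pow_succ]
    have e : (1 - apgAlpha L μ) * (apgAlpha L μ ^ k * apgAlpha L μ) *
        (apgAlpha L μ ^ k * apgAlpha L μ)⁻¹ = 1 - apgAlpha L μ := by field_simp
    rw [e]
    linear_combination apgAlpha L μ * ih

lemma apgMean_eq_sum (hμ : 0 < μ) (hL : μ ≤ L) (u : ℕ → E) (k : ℕ) :
    apgMean L μ u k = apgAlpha L μ ^ k • u 0 + ((1 - apgAlpha L μ) * apgAlpha L μ ^ k) •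
      ∑ t ∈ Finset.Icc 1 k, (apgAlpha L μ ^ t)⁻¹ • u t := by
  have h := apgAlpha_pos hμ hL
  induction k with
  | zero => simp [apgMean]
  | succ k ih =>
    rw [apgMean, ih, Finset.sum_Icc_succ_top (by omega), smul_add, smul_add, smul_smul, smul_smul,
      smul_smul]
    have e : (1 - apgAlpha L μ) * apgAlpha L μ ^ (k + 1) * (apgAlpha L μ ^ (k + 1))⁻¹ =
      1 - apgAlpha L μ := by field_simp
    rw [e, ← add_assoc, show apgAlpha L μ * ((1 - apgAlpha L μ) * apgAlpha L μ ^ k) =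
      (1 - apgAlpha L μ) * apgAlpha L μ ^ (k + 1) by ring,
      show apgAlpha L μ * apgAlpha L μ ^ k = apgAlpha L μ ^ (k + 1) by ring]

/-- The analysis contracts along `apgMean`, which satisfies a one-step recursion, but the method
outputs `apgAvg`. They differ only by the weight `α ^ k` on the starting point. -/
lemma apgMean_eq_avg (hμ : 0 < μ) (hL : μ ≤ L) (u : ℕ → E) {k : ℕ} (hk : 1 ≤ k) :
    apgMean L μ u k = apgAlpha L μ ^ k • u 0 + (1 - apgAlpha L μ ^ k) • apgAvg L μ u k := by
  have h := apgAlpha_pos hμ hL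
  have hS := sum_apgWeights hμ hL k
  rw [apgMean_eq_sum hμ hL, apgAvg, smul_smul, ← hS]
  have hpos : 0 < ∑ t ∈ Finset.Icc 1 k, (apgAlpha L μ ^ t)⁻¹ :=
    Finset.sum_pos (fun t _ => by positivity) ⟨1, by simpa using hk⟩
  rw [mul_assoc, mul_inv_cancel₀ hpos.ne', mul_one]

lemma apgMean_mem (hμ : 0 < μ) (hL : μ ≤ L) {U : Set E} (hU : Convex ℝ U) {u : ℕ → E} {k : ℕ}
    (hu : ∀ t ≤ k, u t ∈ U) : apgMean L μ u k ∈ U := by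
  induction k with
  | zero => exact hu 0 le_rfl
  | succ k ih =>
    exact hU (ih fun t ht => hu t (by omega)) (hu _ le_rfl) (apgAlpha_pos hμ hL).le
      (sub_nonneg.2 (apgAlpha_lt_one hμ hL).le) (by ring)

lemma sum_apgWeights_pos (hμ : 0 < μ) (hL : μ ≤ L) {k : ℕ} (hk : 1 ≤ k) :
    0 < ∑ t ∈ Finset.Icc 1 k, (apgAlpha L μ ^ t)⁻¹ :=
  Finset.sum_pos (fun t _ => inv_pos.2 (pow_pos (apgAlpha_pos hμ hL) t)) ⟨1, by simpa using hk⟩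

lemma apgAvg_mem (hμ : 0 < μ) (hL : μ ≤ L) {U : Set E} (hU : Convex ℝ U) {u : ℕ → E} {k : ℕ}
    (hk : 1 ≤ k) (hu : ∀ t, 1 ≤ t → t ≤ k → u t ∈ U) : apgAvg L μ u k ∈ U :=
  hU.centerMass_mem (fun t _ => inv_nonneg.2 (pow_pos (apgAlpha_pos hμ hL) t).le)
    (sum_apgWeights_pos hμ hL hk) fun t ht => hu t (Finset.mem_Icc.1 ht).1 (Finset.mem_Icc.1 ht).2

lemma ConvexOn.map_apgAvg_le (hμ : 0 < μ) (hL : μ ≤ L) {U : Set E} {J : E → ℝ}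
    (hJ : ConvexOn ℝ U J) {u : ℕ → E} {k : ℕ} (hk : 1 ≤ k)
    (hu : ∀ t, 1 ≤ t → t ≤ k → u t ∈ U) :
    J (apgAvg L μ u k) ≤ apgAvg L μ (fun t => J (u t)) k :=
  hJ.map_centerMass_le (fun t _ => inv_nonneg.2 (pow_pos (apgAlpha_pos hμ hL) t).le)
    (sum_apgWeights_pos hμ hL hk) fun t ht => hu t (Finset.mem_Icc.1 ht).1 (Finset.mem_Icc.1 ht).2

lemma ConvexOn.map_apgMean_le (hμ : 0 < μ) (hL : μ ≤ L) {U : Set E} {J : E → ℝ}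
    (hJ : ConvexOn ℝ U J) {u : ℕ → E} {k : ℕ} (hu : ∀ t ≤ k, u t ∈ U) :
    J (apgMean L μ u k) ≤ apgMean L μ (fun t => J (u t)) k := by
  induction k with
  | zero => exact le_rfl
  | succ k ih =>
    have h1 := hJ.2 (apgMean_mem hμ hL hJ.1 fun t ht => hu t (Nat.le_succ_of_le ht))
      (hu _ le_rfl) (apgAlpha_pos hμ hL).le (sub_nonneg.2 (apgAlpha_lt_one hμ hL).le) (by ring)
    refine h1.trans ?_
    rw [apgMean]
    gcongr
    · exact (apgAlpha_pos hμ hL).le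
    · exact ih fun t ht => hu t (Nat.le_succ_of_le ht)

end Mean

/-! ### Existence and one-step analysis of the accelerated method. -/

section Method

variable {E : Type*} [NormedAddCommGroup E] [NormedSpace ℝ E] {U W : Set E} {ω φ : E → ℝ}
  {L μ : ℝ} {u0 : E} {k : ℕ} {u uh : ℕ → E} {G : ℕ → (E →L[ℝ] ℝ)}

/-- Up to an affine function, `μω` is `μ` times the divergence from `u`. The step of the method is
therefore a Bregman projection with `s⁻¹ = μ + η`, to which tractability applies. -/
lemma prox_objective_eq (G : E →L[ℝ] ℝ) (η : ℝ) (u w : E) :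
    φ w + (G + μ • fderiv ℝ ω u) w + (μ + η) * bregman ω w u =
      (φ w + μ * ω w + G w + η * bregman ω w u) + μ * (fderiv ℝ ω u u - ω u) := by
  simp only [bregman, _root_.add_apply, _root_.smul_apply, smul_eq_mul, map_sub]
  ring

lemma TractableBPP.exists_isMinOn (hT : TractableBPP U W ω φ) {η : ℝ} (hμη : 0 < μ + η)
    {u : E} (hu : u ∈ core U W) (G : E →L[ℝ] ℝ) :
    ∃ p ∈ core U W, IsMinOn (fun w => φ w + μ * ω w + G w + η * bregman ω w u) U p ∧
      ∀ p' ∈ U, IsMinOn (fun w => φ w + μ * ω w + G w + η * bregman ω w u) U p' → p' = p := by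
  obtain ⟨p, hp, hmin, huniq⟩ := hT u hu (G + μ • fderiv ℝ ω u) (μ + η)⁻¹ (inv_pos.2 hμη)
  simp only [inv_inv, prox_objective_eq] at hmin huniq
  refine ⟨p, hp, fun v hv => ?_, fun p' hp' hmin' => huniq p' hp' fun v hv => ?_⟩
  · have := hmin hv
    simp only [mem_ofPred_eq] at this ⊢
    linarith
  · have := hmin' hv
    simp only [mem_ofPred_eq] at this ⊢
    linarith

lemma IsAPG.mono (h : IsAPG U ω φ L μ u0 k u uh G) {m : ℕ} (hm : m ≤ k) :
    IsAPG U ω φ L μ u0 m u uh G :=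
  ⟨h.init, h.init_hat, fun t ht => h.hat t (ht.trans_le hm), fun t ht => h.mem t (ht.trans_le hm),
    fun t ht => h.isMin t (ht.trans_le hm)⟩

/-- A run only records that iterates lie in `U`; uniqueness of the tractable projection moves them
into the core, where `ω` is differentiable. -/
lemma IsAPG.mem_core (hμ : 0 < μ) (hT : TractableBPP U W ω φ) (hu0 : u0 ∈ core U W)
    (h : IsAPG U ω φ L μ u0 k u uh G) : ∀ t ≤ k, u t ∈ core U W := by
  intro t
  induction t with
  | zero => intro _; rw [h.init]; exact hu0
  | succ t ih =>
    intro ht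
    have hη : 0 < μ + apgEta L μ := add_pos_of_pos_of_nonneg hμ (Real.sqrt_nonneg _)
    obtain ⟨p, hp, -, huniq⟩ := hT.exists_isMinOn hη (ih (by omega)) (G (t + 1))
    rw [huniq _ (h.mem t ht) (h.isMin t ht)]
    exact hp

/-- In the recursion the contributions of the previous iterate cancel because `τ(1-α) = α`. The
extrapolated query point is thus a convex combination of feasible points, so it stays in `U`. -/
lemma IsAPG.hat_eq (hμ : 0 < μ) (hL : μ ≤ L) (h : IsAPG U ω φ L μ u0 k u uh G) :
    ∀ t < k, uh (t + 1) = apgAlpha L μ • apgMean L μ u t + (1 - apgAlpha L μ) • u t := by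
  have hτ := one_le_apgTau hμ hL
  have h1 : (1 + apgTau L μ) ≠ 0 := by linarith
  intro t
  induction t with
  | zero =>
    intro ht
    rw [h.hat 0 ht, h.init_hat, apgMean, h.init]
    match_scalars
    field_simp
    ring
  | succ t ih =>
    intro ht
    rw [h.hat _ ht, ih (by omega), apgMean, Nat.add_sub_cancel]
    simp only [apgAlpha]
    match_scalars <;> field_simp <;> ring

lemma IsAPG.hat_mem (hμ : 0 < μ) (hL : μ ≤ L) (hU : Convex ℝ U) (hu0 : u0 ∈ U)
    (h : IsAPG U ω φ L μ u0 k u uh G) {t : ℕ} (ht : t < k) : uh (t + 1) ∈ U := by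
  have hu : ∀ s ≤ k, u s ∈ U := by
    rintro (_ | s) hs
    · rw [h.init]; exact hu0
    · exact h.mem s hs
  rw [h.hat_eq hμ hL t ht]
  exact hU (apgMean_mem hμ hL hU fun s hs => hu s (by omega)) (hu t ht.le) (apgAlpha_pos hμ hL).le
    (sub_nonneg.2 (apgAlpha_lt_one hμ hL).le) (by ring)

lemma exists_isAPG (hμ : 0 < μ) (hT : TractableBPP U W ω φ) (hu0 : u0 ∈ core U W)
    (Γ : E → (E →L[ℝ] ℝ)) : ∃ u uh : ℕ → E,
      ∀ k, IsAPG U ω φ L μ u0 k u uh (fun t => Γ (uh t)) := by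
  have hη : 0 < μ + apgEta L μ := add_pos_of_pos_of_nonneg hμ (Real.sqrt_nonneg _)
  have hex : ∀ (w : E) (G : E →L[ℝ] ℝ), ∃ p, w ∈ core U W → p ∈ core U W ∧
      IsMinOn (fun v => φ v + μ * ω v + G v + apgEta L μ * bregman ω v w) U p := by
    intro w G
    by_cases hw : w ∈ core U W
    · obtain ⟨p, hp, hmin, -⟩ := hT.exists_isMinOn hη hw G
      exact ⟨p, fun _ => ⟨hp, hmin⟩⟩
    · exact ⟨w, fun h => absurd h hw⟩
  choose prox hprox using hex
  let hat : E × E × E → E := fun s => (1 + apgTau L μ)⁻¹ •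
    ((apgAlpha L μ • (s.2.1 - s.1) + s.2.1) + apgTau L μ • s.2.2)
  -- The state is the triple of previous iterate, current iterate and query point; starting it at
  -- `(u0, u0, u0)` encodes `u^{-1} = u^0`.
  let next : E × E × E → E × E × E := fun s => (s.2.1, prox s.2.1 (Γ (hat s)), hat s)
  let S : ℕ → E × E × E := fun t => next^[t] (u0, u0, u0)
  have hS : ∀ t, S (t + 1) = next (S t) := fun t => Function.iterate_succ_apply' _ _ _
  have hprev : ∀ t, (S t).1 = (S (t - 1)).2.1 := by
    rintro (_ | t)
    · rfl
    · rw [hS]; rfl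
  have hcore : ∀ t, (S t).2.1 ∈ core U W := by
    intro t
    induction t with
    | zero => exact hu0
    | succ t ih => rw [hS]; exact (hprox _ _ ih).1
  refine ⟨fun t => (S t).2.1, fun t => (S t).2.2, fun k => ⟨rfl, rfl, fun t _ => ?_,
    fun t _ => (hcore (t + 1)).1, fun t _ => ?_⟩⟩
  · rw [← hprev, hS]
  · have := (hprox _ (Γ (hat (S t))) (hcore t)).2
    simp only [hS]
    exact this

/-- The three-point inequality of one proximal step. -/
lemma IsAPG.prox_le (hω : IsDGF U W ω) (hφ : ConvexOn ℝ U φ) (hμ : 0 < μ)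
    (hT : TractableBPP U W ω φ) (hu0 : u0 ∈ core U W) (h : IsAPG U ω φ L μ u0 k u uh G)
    {t : ℕ} (ht : t < k) {v : E} (hv : v ∈ U) :
    φ (u (t + 1)) + μ * ω (u (t + 1)) + G (t + 1) (u (t + 1)) +
        apgEta L μ * bregman ω (u (t + 1)) (u t) +
        (μ + apgEta L μ) * bregman ω v (u (t + 1)) ≤
      φ v + μ * ω v + G (t + 1) v + apgEta L μ * bregman ω v (u t) := by
  set A : E →L[ℝ] ℝ := G (t + 1) - apgEta L μ • fderiv ℝ ω (u t) with hA
  have hJ : ConvexOn ℝ U (fun w => φ w + A w) :=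
    hφ.add ⟨hφ.1, fun x _ y _ a b _ _ _ => by simp⟩
  have e : ∀ w, φ w + μ * ω w + G (t + 1) w + apgEta L μ * bregman ω w (u t) =
      (φ w + A w) + (μ + apgEta L μ) * ω w +
        apgEta L μ * (fderiv ℝ ω (u t) (u t) - ω (u t)) := by
    intro w
    simp only [hA, bregman, _root_.sub_apply, _root_.smul_apply, smul_eq_mul, map_sub]
    ring
  have hmin := h.isMin t ht
  have hopt := hω.optimality hJ (c := μ + apgEta L μ) (h.mem_core hμ hT hu0 (t + 1) ht)
    (fun w hw => by
      have := hmin hw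
      simp only [mem_ofPred_eq, e] at this
      linarith) hv
  rw [e, e]
  linarith

variable {h : E → ℝ} {g : E → (E →L[ℝ] ℝ)}

/-- The potential function of the method, relative to the comparison point `v`. -/
noncomputable def apgPotential (ω φ h : E → ℝ) (L μ : ℝ) (u : ℕ → E) (v : E) (t : ℕ) : ℝ :=
  h (apgMean L μ u t) + apgMean L μ (fun s => φ (u s) + μ * ω (u s)) t -
    (h v + (φ v + μ * ω v)) + μ * bregman ω v (u t)

/-- At the query point, combine the upper bound at the new mean, the subgradient inequalities at the
old mean and at `v` (weights `α` and `1-α`), and `1-α` times the three-point inequality. The weights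
satisfy `(1-α)√(Lμ) = αμ` and `(1-α)(μ+√(Lμ)) = μ`, so the Bregman terms telescope. -/
lemma IsAPG.potential_succ_le (hω : IsDGF U W ω) (hφ : ConvexOn ℝ U φ) (hμ : 0 < μ) (hL : μ ≤ L)
    (hT : TractableBPP U W ω φ) (hu0 : u0 ∈ core U W)
    (hsub : ∀ a ∈ U, ∀ b ∈ U, h a + g a (b - a) ≤ h b)
    (hupp : ∀ a ∈ U, ∀ b ∈ U, h b ≤ h a + g a (b - a) + L / 2 * ‖b - a‖ ^ 2)
    (hrun : IsAPG U ω φ L μ u0 k u uh G) {t : ℕ} (ht : t < k) {v : E} (hv : v ∈ U) :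
    apgPotential ω φ h L μ u v (t + 1) ≤ apgAlpha L μ * apgPotential ω φ h L μ u v t +
      (1 - apgAlpha L μ) * ((G (t + 1) - g (uh (t + 1))) (v - u (t + 1))) := by
  have hcore := hrun.mem_core hμ hT hu0
  have hz := hrun.hat_mem hμ hL hφ.1 hu0.1 ht
  have hze := hrun.hat_eq hμ hL t ht
  have hx : apgMean L μ u t ∈ U :=
    apgMean_mem hμ hL hφ.1 fun s hs => (hcore s (by omega)).1
  have hx' : apgMean L μ u (t + 1) ∈ U :=
    apgMean_mem hμ hL hφ.1 fun s hs => (hcore s (by omega)).1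
  have hα0 := apgAlpha_pos hμ hL
  have hα1 := apgAlpha_lt_one hμ hL
  have h1 := hupp _ hz _ hx'
  have h2 := hsub _ hz _ hx
  have h3 := hsub _ hz _ hv
  have h4 := hrun.prox_le hω hφ hμ hT hu0 ht hv
  have h5 := hω.le_bregman (hcore (t + 1) ht).1 (hcore t ht.le)
  simp only [apgPotential]
  rw [show apgMean L μ (fun s => φ (u s) + μ * ω (u s)) (t + 1) =
    apgAlpha L μ * apgMean L μ (fun s => φ (u s) + μ * ω (u s)) t +
      (1 - apgAlpha L μ) * (φ (u (t + 1)) + μ * ω (u (t + 1))) from rfl]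
  generalize apgMean L μ (fun s => φ (u s) + μ * ω (u s)) t = R
  have hm : apgMean L μ u (t + 1) =
    apgAlpha L μ • apgMean L μ u t + (1 - apgAlpha L μ) • u (t + 1) := rfl
  set x := apgMean L μ u t
  set x' := apgMean L μ u (t + 1)
  set z := uh (t + 1)
  set p := u (t + 1)
  set D := bregman ω v p
  set D0 := bregman ω v (u t)
  set D1 := bregman ω p (u t)
  have hd : x' - z = (1 - apgAlpha L μ) • (p - u t) := by rw [hm, hze]; module
  have hg : g z (x' - z) = apgAlpha L μ * g z (x - z) + (1 - apgAlpha L μ) * g z (p - z) := by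
    have : x' - z = apgAlpha L μ • (x - z) + (1 - apgAlpha L μ) • (p - z) := by rw [hm]; module
    rw [this]; simp
  rw [hd, norm_smul, Real.norm_eq_abs, abs_of_pos (by linarith), ← hd] at h1
  simp only [map_sub, _root_.sub_apply] at *
  have hη := apgEta_eq (L := L) hμ
  have hτ := one_le_apgTau hμ hL
  have hθ := one_sub_apgAlpha hμ hL
  have hLτ := mul_apgTau_sq hμ hL
  set τ := apgTau L μ
  set α := apgAlpha L μ
  have hα : α = τ * (1 - α) := by rw [hθ]; simp only [α, apgAlpha, τ]; field_simp
  have hθτ : (1 - α) * (1 + τ) = 1 := by rw [hθ]; field_simp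
  rw [hη] at h4
  have e1 : (1 - α) * (μ * τ) = α * μ := by rw [hα]; nlinarith
  have e2 : (1 - α) * (μ + μ * τ) = μ := by nlinarith
  -- The new mean differs from the query point by `(1-α)(p - u t)`. Since `L(1-α)² = μα²`, the
  -- smoothness error is paid for by the proximal term `D1`.
  have e3 : L / 2 * ((1 - α) * ‖p - u t‖) ^ 2 ≤ α * μ * D1 := by
    have : L / 2 * ((1 - α) * ‖p - u t‖) ^ 2 = (μ * α ^ 2) * (1 / 2 * ‖p - u t‖ ^ 2) := by
      rw [← hLτ]
      have : α ^ 2 = τ ^ 2 * (1 - α) ^ 2 := by rw [← mul_pow, ← hα]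
      rw [this]; ring
    rw [this]
    have hα2 : μ * α ^ 2 ≤ α * μ := by nlinarith [mul_pos hμ hα0]
    exact mul_le_mul hα2 h5 (by positivity) (by positivity)
  have h4' := mul_le_mul_of_nonneg_left h4 (sub_nonneg.2 hα1.le)
  have h2' := mul_le_mul_of_nonneg_left h2 hα0.le
  have h3' := mul_le_mul_of_nonneg_left h3 (sub_nonneg.2 hα1.le)
  have e4 : (1 - α) * (μ * τ * D1) = α * μ * D1 := by rw [← e1]; ring
  have e5 : (1 - α) * (μ * τ * D0) = α * μ * D0 := by rw [← e1]; ring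
  have e6 : (1 - α) * ((μ + μ * τ) * D) = μ * D := by rw [← mul_assoc, e2]
  linarith

end Method

/-! ### Accuracy of the inexact method. -/

section Accuracy

variable {E : Type*} [NormedAddCommGroup E] [NormedSpace ℝ E] {U W : Set E} {ω φ : E → ℝ}
  {L μ : ℝ} {u0 : E} {k : ℕ} {u uh : ℕ → E} {G : ℕ → (E →L[ℝ] ℝ)}
  {h : E → ℝ} {g : E → (E →L[ℝ] ℝ)}

lemma IsDGF.convexOn (hω : IsDGF U W ω) : ConvexOn ℝ U ω :=
  UniformConvexOn.convexOn hω.strongConvexOn fun r => by simp only [Pi.zero_apply]; positivity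

lemma IsDGF.convexOn_add (hω : IsDGF U W ω) (hφ : ConvexOn ℝ U φ) (hμ : 0 ≤ μ) :
    ConvexOn ℝ U (fun x => φ x + μ * ω x) :=
  hφ.add (hω.convexOn.smul hμ)

/-- The composite objective dominated by the potential. -/
lemma IsAPG.objective_add_le_potential (hω : IsDGF U W ω) (hφ : ConvexOn ℝ U φ) (hμ : 0 < μ)
    (hL : μ ≤ L) (hT : TractableBPP U W ω φ) (hu0 : u0 ∈ core U W)
    (hrun : IsAPG U ω φ L μ u0 k u uh G) {t : ℕ} (ht : t ≤ k) (v : E) :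
    (h (apgMean L μ u t) + (φ (apgMean L μ u t) + μ * ω (apgMean L μ u t))) -
      (h v + (φ v + μ * ω v)) + μ * bregman ω v (u t) ≤ apgPotential ω φ h L μ u v t := by
  have := ConvexOn.map_apgMean_le hμ hL (hω.convexOn_add hφ hμ.le) (u := u) (k := t) fun s hs =>
    (hrun.mem_core hμ hT hu0 s (hs.trans ht)).1
  unfold apgPotential
  linarith

/-- When `v` is a minimizer the potential dominates `μ/2 ‖v - u t‖²`, so it controls the distance
that multiplies the gradient error. The rate drops from `1 - θ` to `1 - θ/2`, and the errors do not
accumulate with `t`. -/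
lemma IsAPG.potential_le (hω : IsDGF U W ω) (hφ : ConvexOn ℝ U φ) (hμ : 0 < μ) (hL : μ ≤ L)
    (hT : TractableBPP U W ω φ) (hu0 : u0 ∈ core U W)
    (hsub : ∀ a ∈ U, ∀ b ∈ U, h a + g a (b - a) ≤ h b)
    (hupp : ∀ a ∈ U, ∀ b ∈ U, h b ≤ h a + g a (b - a) + L / 2 * ‖b - a‖ ^ 2)
    (hrun : IsAPG U ω φ L μ u0 k u uh G) {e : ℝ}
    (hG : ∀ t < k, ‖G (t + 1) - g (uh (t + 1))‖ ≤ e) {v : E} (hv : v ∈ U)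
    (hmin : ∀ a ∈ U, h v + (φ v + μ * ω v) ≤ h a + (φ a + μ * ω a)) {t : ℕ} (ht : t ≤ k) :
    apgPotential ω φ h L μ u v t ≤
      apgRate L μ ^ t * apgPotential ω φ h L μ u v 0 + 4 * e ^ 2 / μ := by
  have hcore := hrun.mem_core hμ hT hu0
  induction t with
  | zero => have : 0 ≤ 4 * e ^ 2 / μ := by positivity
            simp; linarith
  | succ t ih =>
    have hV := hrun.potential_succ_le hω hφ hμ hL hT hu0 hsub hupp ht hv
    have hdom := hrun.objective_add_le_potential (h := h) hω hφ hμ hL hT hu0 ht v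
    have hm := hmin _ (apgMean_mem hμ hL hφ.1 (u := u) (k := t + 1) fun s hs =>
      (hcore s (hs.trans ht)).1)
    have hD := hω.le_bregman hv (hcore (t + 1) ht)
    have ih' := ih (by omega)
    have herr : (G (t + 1) - g (uh (t + 1))) (v - u (t + 1)) ≤ e * ‖v - u (t + 1)‖ :=
      (le_abs_self _).trans (((G (t + 1) - g (uh (t + 1))).le_opNorm _).trans
        (mul_le_mul_of_nonneg_right (hG t ht) (norm_nonneg _)))
    have hθ := one_sub_apgAlpha hμ hL
    have hα0 := apgAlpha_pos hμ hL
    have hα1 := apgAlpha_lt_one hμ hL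
    have hrate : apgRate L μ = 1 - (1 - apgAlpha L μ) / 2 := by rw [apgRate, hθ]
    have hr0 := apgRate_nonneg hμ hL
    set V := apgPotential ω φ h L μ u v t
    set V' := apgPotential ω φ h L μ u v (t + 1)
    set V0 := apgPotential ω φ h L μ u v 0
    set θ := 1 - apgAlpha L μ
    set n := ‖v - u (t + 1)‖
    have hα : apgAlpha L μ = 1 - θ := by simp [θ]
    have hθ0 : 0 < θ := by linarith
    have hθ1 : θ < 1 := by linarith
    rw [hα] at hV
    have hn : μ / 2 * n ^ 2 ≤ V' := by nlinarith
    -- Young's inequality, weighted so that the quadratic part is at most half the new potential and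
    -- can be moved to the left-hand side.
    have hq : e * n ≤ e ^ 2 / μ + μ / 4 * n ^ 2 := by
      have : 0 ≤ (e - μ / 2 * n) ^ 2 / μ := by positivity
      have e1 : (e - μ / 2 * n) ^ 2 / μ = e ^ 2 / μ - e * n + μ / 4 * n ^ 2 := by
        field_simp; ring
      linarith
    have h1 : V' ≤ (1 - θ) * V + θ * (e ^ 2 / μ + V' / 2) := by
      have := mul_le_mul_of_nonneg_left (herr.trans (hq.trans (by linarith :
        e ^ 2 / μ + μ / 4 * n ^ 2 ≤ e ^ 2 / μ + V' / 2))) hθ0.le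
      linarith
    rw [hrate] at ih' ⊢
    set Q := e ^ 2 / μ with hQ
    have hQ0 : 0 ≤ Q := by positivity
    have hQ4 : 4 * e ^ 2 / μ = 4 * Q := by rw [hQ]; ring
    rw [hQ4] at ih' ⊢
    set P := (1 - θ / 2) ^ t * V0
    have hP : (1 - θ / 2) ^ (t + 1) * V0 = (1 - θ / 2) * P := by simp only [P]; ring
    rw [hP]
    have hV'0 : 0 ≤ V' := le_trans (by positivity) hn
    have hV0 : 0 ≤ P + 4 * Q := by
      have hdom := hrun.objective_add_le_potential (h := h) hω hφ hμ hL hT hu0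
        (t := t) (by omega) v
      have hm := hmin _ (apgMean_mem hμ hL hφ.1 (u := u) (k := t) fun s hs =>
        (hcore s (by omega)).1)
      have hD := mul_nonneg hμ.le (hω.bregman_nonneg hv (hcore t (by omega)))
      linarith
    have h2 : (1 - θ / 2) * V' ≤ (1 - θ) * (P + 4 * Q) + θ * Q := by nlinarith
    have h3 : (1 - θ) * (P + 4 * Q) ≤ (1 - θ / 2) ^ 2 * (P + 4 * Q) :=
      mul_le_mul_of_nonneg_right (by nlinarith) hV0
    have h4 : (1 - θ / 2) * V' ≤ (1 - θ / 2) * ((1 - θ / 2) * P + 4 * Q) := by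
      have := mul_nonneg (mul_nonneg hθ0.le (sub_nonneg.2 hθ1.le)) hQ0
      linarith
    exact le_of_mul_le_mul_left h4 (by linarith)

/-- The initial constant in the accuracy estimate of the method. -/
noncomputable def apgConst (L μ V g0 : ℝ) : ℝ := 2 * g0 ^ 2 / L + 42 * (L / μ) * V

set_option maxHeartbeats 800000 in
-- Passing from the running mean `x` to the output `y` moves the point by a multiple of `α ^ k`
-- times `x - u0`. This costs a fixed multiple of the potential and a term of size `α ^ k`, which
-- joins the geometric remainder.
lemma IsAPG.accuracy (hω : IsDGF U W ω) (hφ : ConvexOn ℝ U φ) (hμ : 0 < μ) (hL : μ ≤ L)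
    (hT : TractableBPP U W ω φ) (hu0 : u0 ∈ core U W)
    (hsub : ∀ a ∈ U, ∀ b ∈ U, h a + g a (b - a) ≤ h b)
    (hlip : ∀ a ∈ U, ∀ b ∈ U, ‖g a - g b‖ ≤ L * ‖a - b‖)
    (hrun : IsAPG U ω φ L μ u0 k u uh G) {e : ℝ}
    (hG : ∀ t < k, ‖G (t + 1) - g (uh (t + 1))‖ ≤ e) {v : E} (hv : v ∈ U)
    (hmin : ∀ a ∈ U, h v + (φ v + μ * ω v) ≤ h a + (φ a + μ * ω a)) (hk : 1 ≤ k)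
    (hrate : apgRate L μ ^ k ≤ 1 / 2) {V : ℝ}
    (hV : (h u0 + (φ u0 + μ * ω u0)) - (h v + (φ v + μ * ω v)) + μ * bregman ω v u0 +
      4 * e ^ 2 / μ ≤ V) :
    h (apgAvg L μ u k) + (φ (apgAvg L μ u k) + μ * ω (apgAvg L μ u k)) ≤
      h v + (φ v + μ * ω v) + 8 * e ^ 2 / μ + apgRate L μ ^ k * apgConst L μ V ‖g u0‖ := by
  have hU := hφ.1
  have hL0 : 0 < L := hμ.trans_le hL
  have hupp : ∀ a ∈ U, ∀ b ∈ U, h b ≤ h a + g a (b - a) + L / 2 * ‖b - a‖ ^ 2 :=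
    fun a ha b hb => quadratic_upper_bound hU hsub hlip ha hb
  have hcore := hrun.mem_core hμ hT hu0
  have hpot := hrun.potential_le hω hφ hμ hL hT hu0 hsub hupp hG hv hmin le_rfl
  have hdom := hrun.objective_add_le_potential (h := h) hω hφ hμ hL hT hu0 le_rfl v
  have hpot0 : apgPotential ω φ h L μ u v 0 =
      (h u0 + (φ u0 + μ * ω u0)) - (h v + (φ v + μ * ω v)) + μ * bregman ω v u0 := by
    simp only [apgPotential, apgMean, hrun.init]
  have hxU : apgMean L μ u k ∈ U := apgMean_mem hμ hL hU fun s hs => (hcore s hs).1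
  have hyU : apgAvg L μ u k ∈ U := apgAvg_mem hμ hL hU hk fun s _ hs => (hcore s hs).1
  have hxy := apgMean_eq_avg hμ hL u hk
  have hRs := apgMean_eq_avg hμ hL (fun s => φ (u s) + μ * ω (u s)) hk
  have hJ := ConvexOn.map_apgAvg_le hμ hL (hω.convexOn_add hφ hμ.le) (u := u) hk fun s _ hs =>
    (hcore s hs).1
  have hα0 := apgAlpha_pos hμ hL
  have hαa : apgAlpha L μ ^ k ≤ apgRate L μ ^ k :=
    pow_le_pow_left₀ hα0.le (apgAlpha_le_apgRate hμ hL) k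
  have hαk0 : 0 < apgAlpha L μ ^ k := pow_pos hα0 k
  have ha1 : apgRate L μ ^ k ≤ 1 := by linarith
  have hgrow : ∀ a ∈ U, μ / 2 * ‖a - v‖ ^ 2 ≤
      (h a + (φ a + μ * ω a)) - (h v + (φ v + μ * ω v)) := by
    intro a ha
    have hsc : StrongConvexOn U (μ * 1) (fun x => (h x + φ x) + μ * ω x) :=
      StrongConvexOn.convexOn_add ((convexOn_of_subgradient hU hsub).add hφ) hω.strongConvexOn
        hμ.le
    have := StrongConvexOn.growth hsc hv (fun b hb => by
      have := hmin b hb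
      simp only [mem_ofPred_eq]
      linarith) ha
    simp only [mul_one] at this
    linarith
  have hbr := mul_nonneg hμ.le (hω.bregman_nonneg hv hu0)
  have hbrk := mul_nonneg hμ.le (hω.bregman_nonneg hv (hcore k le_rfl))
  have hgx := hgrow _ hxU
  have hg0 := hgrow _ hu0.1
  have hsubx := hsub _ hu0.1 _ hxU
  have huppx := hupp _ hxU _ hyU
  have hlipx := hlip _ hxU _ hu0.1
  simp only [smul_eq_mul, hrun.init] at hxy hRs
  unfold apgPotential at hpot hdom
  rw [show apgMean L μ u 0 = u0 from hrun.init,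
    show apgMean L μ (fun s => φ (u s) + μ * ω (u s)) 0 = φ u0 + μ * ω u0 by
      simp [apgMean, hrun.init], hrun.init] at hpot
  set R := apgMean L μ (fun s => φ (u s) + μ * ω (u s)) k
  set A := apgAvg L μ (fun s => φ (u s) + μ * ω (u s)) k
  set x := apgMean L μ u k
  set y := apgAvg L μ u k
  set b := apgAlpha L μ ^ k
  set a := apgRate L μ ^ k
  set Q := e ^ 2 / μ with hQ
  have hQ0 : 0 ≤ Q := by positivity
  rw [show 4 * e ^ 2 / μ = 4 * Q by rw [hQ]; ring] at hpot hV
  rw [show 8 * e ^ 2 / μ = 8 * Q by rw [hQ]; ring]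
  set Fv := h v + (φ v + μ * ω v)
  set J0 := φ u0 + μ * ω u0
  set r := ‖x - u0‖ with hr
  set g0 := ‖g u0‖
  have hb2 : b ≤ 1 / 2 := hαa.trans hrate
  have hyx : (1 - b) • (y - x) = b • (x - u0) := by rw [hxy]; module
  have hnyx : (1 - b) * ‖y - x‖ = b * r := by
    have := congrArg norm hyx
    rwa [norm_smul, norm_smul, Real.norm_eq_abs, Real.norm_eq_abs, abs_of_pos (by linarith),
      abs_of_pos hαk0] at this
  have hr0 : 0 ≤ r := norm_nonneg _
  have hd : ‖y - x‖ ≤ 2 * b * r := by nlinarith [norm_nonneg (y - x)]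
  have hgx' : ‖g x‖ ≤ g0 + L * r := by
    have : g x = g u0 + (g x - g u0) := by abel
    rw [this]
    exact (norm_add_le _ _).trans (by linarith)
  have hlin1 : g x (y - x) ≤ (g0 + L * r) * (2 * b * r) :=
    (le_abs_self _).trans (((g x).le_opNorm _).trans (mul_le_mul hgx' hd (norm_nonneg _)
      (le_trans (norm_nonneg _) hgx')))
  have hlin2 : -(g u0 (x - u0)) ≤ g0 * r :=
    (neg_le_abs _).trans ((g u0).le_opNorm _)
  have hsq : ‖y - x‖ ^ 2 ≤ (2 * b * r) ^ 2 := pow_le_pow_left₀ (norm_nonneg _) hd 2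
  have hFx0 : 0 ≤ (h x + (φ x + μ * ω x)) - Fv := le_trans (by positivity) hgx
  have hF00 : 0 ≤ (h u0 + J0) - Fv := le_trans (by positivity) hg0
  -- the potential at `k`
  set Vk := h x + R - Fv + μ * bregman ω v (u k)
  set V0 := h u0 + J0 - Fv + μ * bregman ω v u0
  have hV0 : 0 ≤ V0 := by simp only [V0]; linarith
  have ha0 : 0 ≤ a := hαk0.le.trans hαa
  have hVk0 : 0 ≤ Vk := by linarith
  have haV0 : a * V0 ≤ V0 := mul_le_of_le_one_left hV0 ha1
  have hVkV : Vk ≤ V := by linarith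
  have hV0V : V0 ≤ V := by linarith
  -- the distance from the starting point
  have hr2 : L * r ^ 2 ≤ 8 * (L / μ) * V := by
    have h1 : r ≤ ‖x - v‖ + ‖u0 - v‖ := by
      rw [hr, show x - u0 = (x - v) - (u0 - v) by abel]; exact norm_sub_le _ _
    have h2 : r ^ 2 ≤ 2 * ‖x - v‖ ^ 2 + 2 * ‖u0 - v‖ ^ 2 := by
      nlinarith [sq_nonneg (‖x - v‖ - ‖u0 - v‖)]
    have h3 : μ * r ^ 2 ≤ 8 * V := by
      have := mul_le_mul_of_nonneg_left h2 hμ.le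
      linarith
    have h4 : L * r ^ 2 = (L / μ) * (μ * r ^ 2) := by field_simp
    rw [h4]
    have := mul_le_mul_of_nonneg_left h3 (by positivity : 0 ≤ L / μ)
    linarith
  have hRb : (1 - b) * A = R - b * J0 := by linarith
  have hJA : (1 - b) * (φ y + μ * ω y) ≤ R - b * J0 := by
    rw [← hRb]; exact mul_le_mul_of_nonneg_left hJ (by linarith)
  have hRJ : R - J0 ≤ Vk + g0 * r := by
    simp only [Vk]
    linarith
  have hJy : φ y + μ * ω y ≤ R + 2 * b * (Vk + g0 * r) := by
    have h0 : 0 ≤ Vk + g0 * r := by positivity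
    have hb1 := mul_nonneg (mul_nonneg hαk0.le (by linarith : 0 ≤ 1 - 2 * b)) h0
    have hb3 := mul_le_mul_of_nonneg_left hRJ hαk0.le
    have : (1 - b) * (φ y + μ * ω y) ≤ (1 - b) * (R + 2 * b * (Vk + g0 * r)) := by linarith
    exact le_of_mul_le_mul_left this (by linarith)
  have hhy : h y ≤ h x + (g0 + L * r) * (2 * b * r) + L / 2 * (2 * b * r) ^ 2 := by
    have := mul_le_mul_of_nonneg_left hsq (by linarith : 0 ≤ L / 2)
    linarith
  have hsum : h y + (φ y + μ * ω y) ≤ Fv + 2 * Vk + b * (4 * (g0 * r) + 3 * (L * r ^ 2)) := by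
    have e1 : 2 * b * Vk ≤ Vk := mul_le_of_le_one_left hVk0 (by linarith)
    have hLr : 0 ≤ L * r ^ 2 := by positivity
    have e2 : L / 2 * (2 * b * r) ^ 2 ≤ b * (L * r ^ 2) := by
      have : L / 2 * (2 * b * r) ^ 2 = (2 * b) * (b * (L * r ^ 2)) := by ring
      rw [this]
      exact mul_le_of_le_one_left (by positivity) (by linarith)
    have e3 : h x + R ≤ Fv + Vk := by simp only [Vk]; linarith
    linarith
  have hgr : 4 * (g0 * r) ≤ 2 * g0 ^ 2 / L + 2 * (L * r ^ 2) := by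
    have : 0 ≤ 2 * (g0 - L * r) ^ 2 / L := by positivity
    have e1 : 2 * (g0 - L * r) ^ 2 / L = 2 * g0 ^ 2 / L - 4 * (g0 * r) + 2 * (L * r ^ 2) := by
      field_simp; ring
    linarith
  have hLμ : 1 ≤ L / μ := (one_le_div hμ).2 hL
  -- After `hgr` there are five copies of `L r²`, each at most `8 (L/μ) V`; this is the `40`. The
  -- `2` missing from the `42` of `apgConst` comes from `2 Vk`.
  have hba : b * (4 * (g0 * r) + 3 * (L * r ^ 2)) ≤
      a * (2 * g0 ^ 2 / L + 40 * (L / μ) * V) :=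
    mul_le_mul hαa (by linarith) (by positivity) ha0
  have hVka : 2 * Vk ≤ 8 * Q + a * (2 * (L / μ) * V) := by
    have : V0 ≤ L / μ * V := hV0V.trans (le_mul_of_one_le_left (hV0.trans hV0V) hLμ)
    have := mul_le_mul_of_nonneg_left this ha0
    linarith
  have : a * apgConst L μ V g0 =
      a * (2 * (L / μ) * V) + a * (2 * g0 ^ 2 / L + 40 * (L / μ) * V) := by
    simp only [apgConst]; ring
  linarith

end Accuracy

/-! ### The saddle-point subproblem -/

lemma lowerSemicontinuousOn_of_subgradient {E : Type*} [NormedAddCommGroup E] [NormedSpace ℝ E]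
    {U : Set E} {h : E → ℝ} {g : E → E →L[ℝ] ℝ}
    (hsub : ∀ u ∈ U, ∀ v ∈ U, h u + g u (v - u) ≤ h v) : LowerSemicontinuousOn h U := by
  intro u hu c hc
  have h1 : Tendsto (fun v => h u + g u (v - u)) (𝓝[U] u) (𝓝 (h u + g u (u - u))) := by
    have : Continuous fun v => h u + g u (v - u) := by fun_prop
    exact (this.tendsto u).mono_left nhdsWithin_le_nhds
  rw [sub_self, map_zero, add_zero] at h1
  filter_upwards [h1.eventually_const_lt hc, self_mem_nhdsWithin] with v hv hvU
  exact hv.trans_le (hsub u hu v hvU)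

lemma lipschitz_continuousOn {E : Type*} [NormedAddCommGroup E] {U : Set E} {h : E → ℝ} {M : ℝ}
    (hM : 0 ≤ M) (hl : ∀ x ∈ U, ∀ x' ∈ U, |h x - h x'| ≤ M * ‖x - x'‖) : ContinuousOn h U :=
  (LipschitzOnWith.of_dist_le_mul (K := ⟨M, hM⟩) fun x hx y hy => by
    rw [Real.dist_eq, dist_eq_norm]; exact hl x hx y hy).continuousOn

namespace Problem

variable {E : Type u} {F : Type v} [NormedAddCommGroup E] [NormedSpace ℝ E]
  [NormedAddCommGroup F] [NormedSpace ℝ F] {P : Problem E F}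

lemma lam_inv : P.lam⁻¹ = 2 * P.γ := by simp [lam]

lemma mu_eq : P.mu = P.γ := by rw [mu, lam_inv]; ring

lemma lam_inv_sub_mu : P.lam⁻¹ - P.mu = P.γ := by rw [mu_eq, lam_inv]; ring

namespace Standing

variable (hS : P.Standing)
include hS

lemma mu_pos : 0 < P.mu := by rw [mu_eq]; exact hS.γ_pos

lemma lam_pos : 0 < P.lam := by have := hS.γ_pos; rw [lam]; positivity

lemma β_pos : 0 < P.β := one_pos.trans_le hS.one_le_β

/-- The open set `Xn` lies between `X` and the domain of `ωX`, so the primal core is all of `X`. -/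
lemma mem_core {x : E} (hx : x ∈ P.X) : x ∈ core P.X P.domX :=
  ⟨hx, interior_maximal hS.Xn_subset_domX hS.Xn_open (hS.X_subset hx)⟩

lemma isCompact_Y [FiniteDimensional ℝ F] : IsCompact P.Y :=
  Metric.isCompact_of_isClosed_isBounded hS.Y_closed hS.Y_bounded

lemma norm_sub_le_diam {y y' : F} (hy : y ∈ P.Y) (hy' : y' ∈ P.Y) :
    ‖y - y'‖ ≤ Metric.diam P.Y := by
  rw [← dist_eq_norm]; exact Metric.dist_le_diam_of_mem hS.Y_bounded hy hy'

lemma bregman_nonneg {x x' : E} (hx' : x' ∈ P.X) (hx : x ∈ P.X) : 0 ≤ bregman P.ωX x' x :=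
  hS.dgfX.bregman_nonneg hx' (hS.mem_core hx)

lemma le_bregman {x x' : E} (hx' : x' ∈ P.X) (hx : x ∈ P.X) :
    1 / 2 * ‖x' - x‖ ^ 2 ≤ bregman P.ωX x' x :=
  hS.dgfX.le_bregman hx' (hS.mem_core hx)

lemma ωX_upper {x x' : E} (hx' : x' ∈ P.X) (hx : x ∈ P.X) :
    P.ωX x' ≤ P.ωX x + fderiv ℝ P.ωX x (x' - x) + P.β / 2 * ‖x' - x‖ ^ 2 :=
  quadratic_upper_bound hS.X_convex (fun a ha b hb => by
    have := hS.bregman_nonneg hb ha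
    unfold bregman at this
    linarith) hS.ωX_lip hx hx'

lemma bregman_le {x x' : E} (hx' : x' ∈ P.X) (hx : x ∈ P.X) :
    bregman P.ωX x' x ≤ P.β / 2 * ‖x' - x‖ ^ 2 := by
  have := hS.ωX_upper hx' hx
  unfold bregman
  linarith

lemma mu_le_Lxx' : P.mu ≤ P.Lxx' := by
  have := hS.γ_pos
  have := hS.γ_le
  have := hS.one_le_β
  rw [mu_eq, Lxx', lam_inv]
  nlinarith

lemma Lxx'_pos : 0 < P.Lxx' := hS.mu_pos.trans_le hS.mu_le_Lxx'

/-- The coefficient `λ⁻¹ - μ` equals `γ`, so the strong convexity of `γ ωX` exactly cancels the weak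
convexity defect of `Φ(·,y)`. -/
lemma Psi_subgradient (xk : E) {y : F} (hy : y ∈ P.Y) : ∀ x ∈ P.X, ∀ x' ∈ P.X,
    P.Psi xk x y + P.gradPsiX xk x y (x' - x) ≤ P.Psi xk x' y := by
  intro x hx x' hx'
  have h1 := hS.weak_convex y hy x hx x' hx'
  have h2 := mul_le_mul_of_nonneg_left (hS.le_bregman hx' hx) hS.γ_pos.le
  simp only [Psi, gradPsiX, lam_inv_sub_mu, _root_.add_apply, _root_.sub_apply,
    _root_.smul_apply, smul_eq_mul]
  unfold bregman at h2
  simp only [map_sub] at *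
  linarith

lemma gradPsiX_lip (xk : E) {y : F} (hy : y ∈ P.Y) : ∀ x ∈ P.X, ∀ x' ∈ P.X,
    ‖P.gradPsiX xk x y - P.gradPsiX xk x' y‖ ≤ P.Lxx' * ‖x - x'‖ := by
  intro x hx x' hx'
  have h1 := hS.lip_xx x hx x' hx' y hy
  have h2 := hS.ωX_lip x hx x' hx'
  have e : P.gradPsiX xk x y - P.gradPsiX xk x' y =
      P.γ • (fderiv ℝ P.ωX x - fderiv ℝ P.ωX x') + (P.oracleP x y - P.oracleP x' y) := by
    simp only [gradPsiX, lam_inv_sub_mu]; module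
  rw [e, Lxx', lam_inv]
  refine (norm_add_le _ _).trans ?_
  rw [norm_smul, Real.norm_eq_abs, abs_of_pos hS.γ_pos]
  have := mul_le_mul_of_nonneg_left h2 hS.γ_pos.le
  have h3 : 0 ≤ P.γ * P.β * ‖x - x'‖ :=
    mul_nonneg (mul_nonneg hS.γ_pos.le hS.β_pos.le) (norm_nonneg _)
  linarith

lemma gradPsiX_lip_y (xk : E) {x : E} (hx : x ∈ P.X) {y y' : F} (hy : y ∈ P.Y) (hy' : y' ∈ P.Y) :
    ‖P.gradPsiX xk x y - P.gradPsiX xk x y'‖ ≤ P.Lxy * ‖y - y'‖ := by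
  have e : P.gradPsiX xk x y - P.gradPsiX xk x y' = P.oracleP x y - P.oracleP x y' := by
    simp only [gradPsiX]; abel
  rw [e]
  exact (hS.lip_xy x hx y hy y' hy').trans
    (mul_le_mul_of_nonneg_right (le_max_left _ _) (norm_nonneg _))

lemma Psi_convexOn (xk : E) {y : F} (hy : y ∈ P.Y) : ConvexOn ℝ P.X fun x => P.Psi xk x y :=
  convexOn_of_subgradient hS.X_convex (hS.Psi_subgradient xk hy)

lemma psiP_strongConvexOn (xk : E) {y : F} (hy : y ∈ P.Y) :
    StrongConvexOn P.X P.mu fun x => P.psiP xk x y := by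
  have := StrongConvexOn.convexOn_add ((hS.Psi_convexOn xk hy).add hS.r_convex)
    hS.dgfX.strongConvexOn hS.mu_pos.le
  rwa [mul_one] at this

lemma psiP_lowerSemicontinuousOn (xk : E) {y : F} (hy : y ∈ P.Y) :
    LowerSemicontinuousOn (fun x => P.psiP xk x y) P.X := by
  have h1 := lowerSemicontinuousOn_of_subgradient (hS.Psi_subgradient xk hy)
  have h2 : LowerSemicontinuousOn P.r P.X :=
    (lipschitz_continuousOn hS.Mr_nonneg hS.r_lip).lowerSemicontinuousOn
  have h3 : LowerSemicontinuousOn (fun x => P.mu * P.ωX x) P.X :=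
    (hS.dgfX.continuousOn.const_mul _).lowerSemicontinuousOn
  exact (h1.add h2).add h3

lemma g_add_strongConvexOn {ρ : ℝ} (hρ : 0 ≤ ρ) (hd : IsDGF P.Y P.domY P.ωY) :
    StrongConvexOn P.Y ρ fun y => P.g y + ρ * P.ωY y := by
  have := StrongConvexOn.convexOn_add hS.g_convex hd.strongConvexOn hρ
  rwa [mul_one] at this

end Standing

/-- The minimizer of `ψᴾ(·, y)` over `X`. -/
noncomputable def xStar (P : Problem E F) (xk : E) (y : F) : E :=
  Classical.epsilon fun x => x ∈ P.X ∧ IsMinOn (fun x => P.psiP xk x y) P.X x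

namespace Standing

variable [FiniteDimensional ℝ E] (hS : P.Standing)
include hS

lemma xStar_spec (xk : E) {y : F} (hy : y ∈ P.Y) :
    P.xStar xk y ∈ P.X ∧ IsMinOn (fun x => P.psiP xk x y) P.X (P.xStar xk y) := by
  obtain ⟨p, hp, hmin⟩ := StrongConvexOn.exists_isMinOn hS.X_closed hS.X_nonempty hS.mu_pos
    (hS.psiP_strongConvexOn xk hy) (hS.psiP_lowerSemicontinuousOn xk hy)
  exact Classical.epsilon_spec
    (p := fun x => x ∈ P.X ∧ IsMinOn (fun x => P.psiP xk x y) P.X x) ⟨p, hp, hmin⟩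

lemma xStar_mem (xk : E) {y : F} (hy : y ∈ P.Y) : P.xStar xk y ∈ P.X := (hS.xStar_spec xk hy).1

lemma psiP_growth (xk : E) {y : F} (hy : y ∈ P.Y) {x : E} (hx : x ∈ P.X) :
    P.psiP xk (P.xStar xk y) y + P.mu / 2 * ‖x - P.xStar xk y‖ ^ 2 ≤ P.psiP xk x y :=
  StrongConvexOn.growth (hS.psiP_strongConvexOn xk hy) (hS.xStar_mem xk hy)
    (hS.xStar_spec xk hy).2 hx

lemma psiP_xStar_le (xk : E) {y : F} (hy : y ∈ P.Y) {x : E} (hx : x ∈ P.X) :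
    P.psiP xk (P.xStar xk y) y ≤ P.psiP xk x y :=
  (hS.xStar_spec xk hy).2 hx

lemma dualPi_eq (xk : E) {y : F} (hy : y ∈ P.Y) :
    P.dualPi xk y = P.psiP xk (P.xStar xk y) y := by
  refine IsLeast.csInf_eq ⟨mem_image_of_mem _ (hS.xStar_mem xk hy), ?_⟩
  rintro _ ⟨x, hx, rfl⟩
  exact hS.psiP_xStar_le xk hy hx

lemma dist_xStar_of_primalAcc {xk : E} {y : F} (hy : y ∈ P.Y) {δ : ℝ} {x : E} (hx : x ∈ P.X)
    (h : P.PrimalAcc xk y δ x) : ‖x - P.xStar xk y‖ ^ 2 ≤ 2 * δ / P.mu := by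
  have h1 := hS.psiP_growth xk hy hx
  have h2 := h _ (hS.xStar_mem xk hy)
  rw [le_div_iff₀ hS.mu_pos]
  linarith

/-- Adding the growth inequalities at `y` and `y'` cancels everything except the mixed second
difference of `Φ`. The mean value inequality bounds it by `L_xy ‖y - y'‖` times the distance of the
minimizers. -/
lemma xStar_lip (xk : E) {y y' : F} (hy : y ∈ P.Y) (hy' : y' ∈ P.Y) :
    P.mu * ‖P.xStar xk y - P.xStar xk y'‖ ≤ P.Lxy * ‖y - y'‖ := by
  have ha := hS.xStar_mem xk hy
  have hb := hS.xStar_mem xk hy'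
  have h1 := hS.psiP_growth xk hy hb
  have h2 := hS.psiP_growth xk hy' ha
  set a := P.xStar xk y
  set b := P.xStar xk y'
  have h3 : ‖(P.Φ b y - P.Φ b y') - (P.Φ a y - P.Φ a y')‖ ≤ (P.Lxy * ‖y - y'‖) * ‖b - a‖ := by
    refine Convex.norm_image_sub_le_of_norm_hasFDerivWithin_le (𝕜 := ℝ)
      (f := fun x => P.Φ x y - P.Φ x y') (f' := fun x => P.oracleP x y - P.oracleP x y')
      (s := P.X) (fun x hx => ?_) (fun x hx => ?_) hS.X_convex ha hb
    · exact ((hS.diff_x y hy x (hS.X_subset hx)).hasFDerivAt.sub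
        (hS.diff_x y' hy' x (hS.X_subset hx)).hasFDerivAt).hasFDerivWithinAt
    · exact (hS.lip_xy x hx y hy y' hy').trans
        (mul_le_mul_of_nonneg_right (le_max_left _ _) (norm_nonneg _))
  have h4 := (le_abs_self _).trans h3
  simp only [psiP, Psi] at h1 h2
  rw [norm_sub_rev b a] at h1 h4
  rcases eq_or_lt_of_le (norm_nonneg (a - b)) with h0 | h0
  · rw [← h0, mul_zero]
    exact mul_nonneg (hS.Lxyb_nonneg.trans (le_max_left _ _)) (norm_nonneg _)
  · have h5 : (P.mu * ‖a - b‖) * ‖a - b‖ ≤ (P.Lxy * ‖y - y'‖) * ‖a - b‖ := by linarith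
    exact le_of_mul_le_mul_right h5 h0

/-! #### The dual function -/

/-- Danskin's argument: test the minimum defining `π(y')` at `xStar y` and use concavity of `Φ(xStar
y, ·)`. -/
lemma dualPi_supergradient (hD : P.DualSmooth) (xk : E) : ∀ y ∈ P.Y, ∀ y' ∈ P.Y,
    P.dualPi xk y' ≤ P.dualPi xk y + P.oracleD (P.xStar xk y) y (y' - y) := by
  intro y hy y' hy'
  have hx := hS.xStar_mem xk hy
  have h1 := hS.psiP_xStar_le xk hy' hx
  have h2 := ConcaveOn.le_fderiv (hS.concave _ hx) hy hy' (hD.diff_y _ hx y (hD.Y_subset hy))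
  rw [hS.dualPi_eq xk hy, hS.dualPi_eq xk hy']
  refine h1.trans ?_
  simp only [psiP, Psi, oracleD] at *
  linarith

lemma gradPi_lip (hD : P.DualSmooth) (xk : E) : ∀ y ∈ P.Y, ∀ y' ∈ P.Y,
    ‖P.oracleD (P.xStar xk y) y - P.oracleD (P.xStar xk y') y'‖ ≤ P.Lpi * ‖y - y'‖ := by
  intro y hy y' hy'
  have hx := hS.xStar_mem xk hy
  have hx' := hS.xStar_mem xk hy'
  have h1 := hD.lip_yy _ hx y hy y' hy'
  have h2 := hD.lip_yx _ hx _ hx' y' hy'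
  have h3 := hS.xStar_lip xk hy hy'
  have hμ := hS.mu_pos
  have hL : P.Lyx ≤ P.Lxy := le_max_right _ _
  have hL0 : 0 ≤ P.Lxy := hD.Lyx_nonneg.trans hL
  have h4 : ‖P.xStar xk y - P.xStar xk y'‖ ≤ P.Lxy * ‖y - y'‖ / P.mu := by
    rw [le_div_iff₀ hμ]; linarith
  have h5 := mul_le_mul hL h4 (norm_nonneg _) hL0
  have e : P.Lpi * ‖y - y'‖ = P.Lyy * ‖y - y'‖ + P.Lxy * (P.Lxy * ‖y - y'‖ / P.mu) := by
    rw [Lpi]; ring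
  rw [e, show P.oracleD (P.xStar xk y) y - P.oracleD (P.xStar xk y') y' =
    (P.oracleD (P.xStar xk y) y - P.oracleD (P.xStar xk y) y') +
    (P.oracleD (P.xStar xk y) y' - P.oracleD (P.xStar xk y') y') by abel]
  exact (norm_add_le _ _).trans (by linarith)

lemma neg_dualPi_subgradient (hD : P.DualSmooth) (xk : E) : ∀ y ∈ P.Y, ∀ y' ∈ P.Y,
    -P.dualPi xk y + (-P.oracleD (P.xStar xk y) y) (y' - y) ≤ -P.dualPi xk y' := by
  intro y hy y' hy'
  have := hS.dualPi_supergradient hD xk y hy y' hy'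
  rw [_root_.neg_apply]
  linarith

lemma neg_gradPi_lip (hD : P.DualSmooth) (xk : E) : ∀ y ∈ P.Y, ∀ y' ∈ P.Y,
    ‖-P.oracleD (P.xStar xk y) y - -P.oracleD (P.xStar xk y') y'‖ ≤ P.Lpi * ‖y - y'‖ := by
  intro y hy y' hy'
  have := hS.gradPi_lip hD xk y hy y' hy'
  rwa [neg_sub_neg, norm_sub_rev]

lemma dualPi_lower (hD : P.DualSmooth) (xk : E) {y y' : F} (hy : y ∈ P.Y) (hy' : y' ∈ P.Y) :
    P.dualPi xk y + P.oracleD (P.xStar xk y) y (y' - y) - P.Lpi / 2 * ‖y' - y‖ ^ 2 ≤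
      P.dualPi xk y' := by
  have := quadratic_upper_bound hS.Y_convex (hS.neg_dualPi_subgradient hD xk)
    (hS.neg_gradPi_lip hD xk) hy hy'
  rw [_root_.neg_apply] at this
  linarith

end Standing

/-- The maximizer of the dual function `d_ρ` over `Y`. -/
noncomputable def yStar (P : Problem E F) (ρ : ℝ) (xk : E) : F :=
  Classical.epsilon fun y => y ∈ P.Y ∧ ∀ y' ∈ P.Y, P.dualFun ρ xk y' ≤ P.dualFun ρ xk y

namespace Standing

variable [FiniteDimensional ℝ E] [FiniteDimensional ℝ F] (hS : P.Standing) (hD : P.DualSmooth)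
include hS hD

lemma yStar_spec (ρ : ℝ) (xk : E) : P.yStar ρ xk ∈ P.Y ∧
    ∀ y' ∈ P.Y, P.dualFun ρ xk y' ≤ P.dualFun ρ xk (P.yStar ρ xk) := by
  have h1 := lowerSemicontinuousOn_of_subgradient (hS.neg_dualPi_subgradient hD xk)
  have h2 : LowerSemicontinuousOn P.g P.Y :=
    (lipschitz_continuousOn hS.Mg_nonneg hS.g_lip).lowerSemicontinuousOn
  have h3 : LowerSemicontinuousOn (fun y => ρ * P.ωY y) P.Y :=
    (hS.dgfY.continuousOn.const_mul _).lowerSemicontinuousOn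
  obtain ⟨p, hp, hmin⟩ := LowerSemicontinuousOn.exists_isMinOn hS.Y_nonempty hS.isCompact_Y
    ((h1.add h2).add h3)
  refine Classical.epsilon_spec (p := fun y => y ∈ P.Y ∧
    ∀ y' ∈ P.Y, P.dualFun ρ xk y' ≤ P.dualFun ρ xk y) ⟨p, hp, fun y' hy' => ?_⟩
  have := hmin hy'
  simp only [mem_ofPred_eq] at this
  simp only [dualFun]
  linarith

lemma yStar_mem (ρ : ℝ) (xk : E) : P.yStar ρ xk ∈ P.Y := (hS.yStar_spec hD ρ xk).1

/-- `π` is never differentiated. Its quadratic lower bound plays the role of a linearization, and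
its error is of second order along the segment from `y*`. -/
lemma dual_first_order {ρ : ℝ} (hρ : 0 < ρ) (xk : E) {y : F} (hy : y ∈ P.Y) :
    P.oracleD (P.xStar xk (P.yStar ρ xk)) (P.yStar ρ xk) (y - P.yStar ρ xk) -
        (P.g y + ρ * P.ωY y) + ρ / 2 * ‖y - P.yStar ρ xk‖ ^ 2 ≤
      -(P.g (P.yStar ρ xk) + ρ * P.ωY (P.yStar ρ xk)) := by
  obtain ⟨hm, hmax⟩ := hS.yStar_spec hD ρ xk
  set ys := P.yStar ρ xk
  have : 0 ≤ -(P.g ys + ρ * P.ωY ys) - (P.oracleD (P.xStar xk ys) ys (y - ys) -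
        (P.g y + ρ * P.ωY y) + ρ / 2 * ‖y - ys‖ ^ 2) := by
    apply nonneg_of_forall_small (k := P.Lpi / 2 * ‖y - ys‖ ^ 2 + ρ / 2 * ‖y - ys‖ ^ 2)
    intro s h0 h1
    have hz := Convex.segment_mem hS.Y_convex hm hy h0.le h1.le
    have h2 := hS.dualPi_lower hD xk hm hz
    have h3 := StrongConvexOn.segment_le (hS.g_add_strongConvexOn hρ.le hS.dgfY) hm hy h0.le h1.le
    have h4 := hmax _ hz
    rw [add_sub_cancel_left, norm_smul, Real.norm_eq_abs, abs_of_pos h0, map_smul,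
      smul_eq_mul] at h2
    simp only [dualFun] at h4
    linarith
  linarith

lemma dualFun_growth {ρ : ℝ} (hρ : 0 < ρ) (xk : E) {y : F} (hy : y ∈ P.Y) :
    P.dualFun ρ xk y + ρ / 2 * ‖y - P.yStar ρ xk‖ ^ 2 ≤ P.dualFun ρ xk (P.yStar ρ xk) := by
  have h1 := hS.dual_first_order hD hρ xk hy
  have h2 := hS.dualPi_supergradient hD xk _ (hS.yStar_mem hD ρ xk) y hy
  simp only [dualFun]
  linarith

/-- The pair `(xStar (yStar ρ), yStar ρ)` is a saddle point. -/
lemma saddle_growth {ρ : ℝ} (hρ : 0 < ρ) (xk : E) {y : F} (hy : y ∈ P.Y) :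
    P.Φ (P.xStar xk (P.yStar ρ xk)) y - P.g y - ρ * P.ωY y + ρ / 2 * ‖y - P.yStar ρ xk‖ ^ 2 ≤
      P.Φ (P.xStar xk (P.yStar ρ xk)) (P.yStar ρ xk) - P.g (P.yStar ρ xk) -
        ρ * P.ωY (P.yStar ρ xk) := by
  have hm := hS.yStar_mem hD ρ xk
  have hx := hS.xStar_mem xk hm
  -- The supergradient of `π` at `y*` is also the gradient of `Φ(x*,·)` at `y*`, so the optimality
  -- condition for `d_ρ` serves for the inner maximization as well.
  have h1 := hS.dual_first_order hD hρ xk hy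
  have h2 := ConcaveOn.le_fderiv (hS.concave _ hx) hm hy (hD.diff_y _ hx _ (hD.Y_subset hm))
  simp only [oracleD] at h1
  linarith

lemma dist_yStar_of_dualAcc {ρ : ℝ} (hρ : 0 < ρ) {xk : E} {δ : ℝ} {y : F} (hy : y ∈ P.Y)
    (h : P.DualAcc ρ xk δ y) : ‖y - P.yStar ρ xk‖ ^ 2 ≤ 2 * δ / ρ := by
  have h1 := hS.dualFun_growth hD hρ xk hy
  have h2 := h _ (hS.yStar_mem hD ρ xk)
  rw [le_div_iff₀ hρ]
  linarith

end Standing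

/-! #### The smoothed primal function -/

namespace Standing

variable [FiniteDimensional ℝ F] (hS : P.Standing)
include hS

omit [FiniteDimensional ℝ F] in
lemma continuousOn_coupling (ρ : ℝ) {x : E} (hx : x ∈ P.X) :
    ContinuousOn (fun y => P.Φ x y - P.g y - ρ * P.ωY y) P.Y := by
  have h1 : ContinuousOn (fun y => P.Φ x y) P.Y :=
    hS.continuousOn.comp (f := fun y => (x, y)) (by fun_prop) fun y hy => ⟨hx, hy⟩
  exact (h1.sub (lipschitz_continuousOn hS.Mg_nonneg hS.g_lip)).sub
    (hS.dgfY.continuousOn.const_mul _)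

lemma le_fRho (ρ : ℝ) {x : E} (hx : x ∈ P.X) {y : F} (hy : y ∈ P.Y) :
    P.Φ x y - P.g y - ρ * P.ωY y ≤ P.fRho ρ x :=
  le_csSup (hS.isCompact_Y.bddAbove_image (hS.continuousOn_coupling ρ hx)) (mem_image_of_mem _ hy)

omit [FiniteDimensional ℝ F] in
lemma fRho_le {ρ : ℝ} {x : E} {c : ℝ} (h : ∀ y ∈ P.Y, P.Φ x y - P.g y - ρ * P.ωY y ≤ c) :
    P.fRho ρ x ≤ c :=
  csSup_le (hS.Y_nonempty.image _) (by rintro _ ⟨y, hy, rfl⟩; exact h y hy)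

lemma abs_ωY_le {y : F} (hy : y ∈ P.Y) : |P.ωY y| ≤ P.Omega :=
  le_csSup (hS.isCompact_Y.bddAbove_image hS.dgfY.continuousOn.abs) (mem_image_of_mem _ hy)

lemma fRho_le_fRho_add (ρ ρ' : ℝ) {x : E} (hx : x ∈ P.X) :
    P.fRho ρ x ≤ P.fRho ρ' x + |ρ - ρ'| * P.Omega := by
  refine hS.fRho_le fun y hy => ?_
  have h1 := hS.le_fRho ρ' hx hy
  have h2 : |(ρ' - ρ) * P.ωY y| ≤ |ρ - ρ'| * P.Omega := by
    rw [abs_mul, abs_sub_comm]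
    exact mul_le_mul_of_nonneg_left (hS.abs_ωY_le hy) (abs_nonneg _)
  have h3 := (le_abs_self _).trans h2
  linarith

end Standing

lemma f_eq_fRho_zero (P : Problem E F) (x : E) : P.f x = P.fRho 0 x := by simp [f, fRho]

lemma Q_eq_QRho_zero (P : Problem E F) (x x' : E) : P.Q x x' = P.QRho 0 x x' := by
  simp [Q, QRho, q, f_eq_fRho_zero]

/-- The linear term in `Ψ` completes `λ⁻¹ ωX` to a Bregman divergence from the centre, so `ψᴾ` is
the proximal objective at fixed `y` up to a constant. -/
lemma psiP_eq (P : Problem E F) (xk x : E) (y : F) : P.psiP xk x y =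
    P.Φ x y + P.r x + P.lam⁻¹ * bregman P.ωX x xk +
      P.lam⁻¹ * (P.ωX xk - fderiv ℝ P.ωX xk xk) := by
  simp only [psiP, Psi, bregman, map_sub]
  ring

namespace Standing

variable [FiniteDimensional ℝ E] [FiniteDimensional ℝ F] (hS : P.Standing) (hD : P.DualSmooth)
include hS hD

/-- Fixing `y = y*` minorizes `f_ρ`, with equality at `x*` by the saddle property; the growth of
`ψᴾ(·,y*)` is therefore inherited. -/
lemma QRho_growth {ρ : ℝ} (hρ : 0 < ρ) (xk : E) {x : E} (hx : x ∈ P.X) :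
    P.QRho ρ (P.xStar xk (P.yStar ρ xk)) xk +
      P.mu / 2 * ‖x - P.xStar xk (P.yStar ρ xk)‖ ^ 2 ≤ P.QRho ρ x xk := by
  have hm := hS.yStar_mem hD ρ xk
  have h1 := hS.psiP_growth xk hm hx
  rw [psiP_eq, psiP_eq] at h1
  have h2 := hS.le_fRho ρ hx hm
  have h3 : P.fRho ρ (P.xStar xk (P.yStar ρ xk)) ≤
      P.Φ (P.xStar xk (P.yStar ρ xk)) (P.yStar ρ xk) - P.g (P.yStar ρ xk) -
        ρ * P.ωY (P.yStar ρ xk) := hS.fRho_le fun y hy => by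
    have := hS.saddle_growth hD hρ xk hy
    have : 0 ≤ ρ / 2 * ‖y - P.yStar ρ xk‖ ^ 2 := by positivity
    linarith
  simp only [QRho]
  linarith

/-- The two smoothed objectives differ by at most `|ρ - ρ'| Ω`, and each grows quadratically away
from its minimizer. This links the reference problem with `ρ = 1` to the actual one. -/
lemma dist_xStar_smoothing {ρ ρ' : ℝ} (hρ : 0 < ρ) (hρ' : 0 < ρ') (xk : E) :
    P.mu * ‖P.xStar xk (P.yStar ρ xk) - P.xStar xk (P.yStar ρ' xk)‖ ^ 2 ≤
      2 * |ρ - ρ'| * P.Omega := by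
  have hx := hS.xStar_mem xk (hS.yStar_mem hD ρ xk)
  have hx' := hS.xStar_mem xk (hS.yStar_mem hD ρ' xk)
  have h1 := hS.QRho_growth hD hρ xk hx'
  have h2 := hS.QRho_growth hD hρ' xk hx
  have h3 := hS.fRho_le_fRho_add ρ ρ' hx'
  have h4 := hS.fRho_le_fRho_add ρ' ρ hx
  rw [norm_sub_rev] at h1
  rw [abs_sub_comm] at h4
  simp only [QRho] at h1 h2
  linarith

/-- The growth of the smoothed objective away from its minimizer is controlled by the gradient
bounds there. -/
lemma QRho_upper {ρ : ℝ} (hρ : 0 < ρ) (xk : E) {x : E} (hx : x ∈ P.X) {B B' R : ℝ}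
    (hB : ‖P.gradPsiX xk (P.xStar xk (P.yStar ρ xk)) (P.yStar ρ xk)‖ ≤ B)
    (hB' : ‖fderiv ℝ P.ωX (P.xStar xk (P.yStar ρ xk))‖ ≤ B')
    (hR : ‖x - P.xStar xk (P.yStar ρ xk)‖ ≤ R) :
    P.QRho ρ x xk ≤ P.QRho ρ (P.xStar xk (P.yStar ρ xk)) xk +
      (B + P.Mr + P.mu * B') * R + (P.Lrho' ρ + P.mu * P.β) / 2 * R ^ 2 := by
  have hm := hS.yStar_mem hD ρ xk
  have hxs := hS.xStar_mem xk hm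
  have hμ := hS.mu_pos
  have hMr := hS.Mr_nonneg
  have hβ := hS.β_pos
  have hLx := hS.Lxx'_pos
  have hB0 := (norm_nonneg _).trans hB
  have hB'0 := (norm_nonneg _).trans hB'
  set ys := P.yStar ρ xk with hys
  set xs := P.xStar xk ys with hxs'
  have hN := norm_nonneg (x - xs)
  have hN2 : ‖x - xs‖ ^ 2 ≤ R ^ 2 := pow_le_pow_left₀ hN hR 2
  have hω : P.ωX x ≤ P.ωX xs + B' * R + P.β / 2 * R ^ 2 := by
    have h1 := hS.ωX_upper hx hxs
    have h2 : fderiv ℝ P.ωX xs (x - xs) ≤ B' * R :=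
      (le_abs_self _).trans (((fderiv ℝ P.ωX xs).le_opNorm _).trans
        (mul_le_mul hB' hR hN hB'0))
    have h3 := mul_le_mul_of_nonneg_left hN2 (by positivity : 0 ≤ P.β / 2)
    linarith
  have hr : P.r x ≤ P.r xs + P.Mr * R := by
    have h1 := (le_abs_self _).trans (hS.r_lip x hx xs hxs)
    have h2 := mul_le_mul_of_nonneg_left hR hMr
    linarith
  have hΨ : ∀ y ∈ P.Y, P.Psi xk x y - P.g y - ρ * P.ωY y ≤
      P.Psi xk xs ys - P.g ys - ρ * P.ωY ys + B * R + P.Lrho' ρ / 2 * R ^ 2 := by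
    intro y hy
    have h1 := quadratic_upper_bound hS.X_convex (hS.Psi_subgradient xk hy)
      (hS.gradPsiX_lip xk hy) hxs hx
    have h2 := hS.saddle_growth hD hρ xk hy
    rw [← hys, ← hxs'] at h2
    have h3 := hS.gradPsiX_lip_y xk hxs hy hm
    have h4 : P.gradPsiX xk xs y (x - xs) ≤ (B + P.Lxy * ‖y - ys‖) * R := by
      have h5 : ‖P.gradPsiX xk xs y‖ ≤ B + P.Lxy * ‖y - ys‖ := by
        rw [show P.gradPsiX xk xs y = P.gradPsiX xk xs ys +
          (P.gradPsiX xk xs y - P.gradPsiX xk xs ys) by abel]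
        exact (norm_add_le _ _).trans (add_le_add hB h3)
      exact (le_abs_self _).trans (((P.gradPsiX xk xs y).le_opNorm _).trans
        (mul_le_mul h5 hR hN ((norm_nonneg _).trans h5)))
    -- Moving `x` may move the maximizing `y`. The growth in `y` at the saddle point limits the
    -- gain, which is the `L_xy²/ρ` part of `L'_ρ`.
    have h6 : P.Lxy * ‖y - ys‖ * R - ρ / 2 * ‖y - ys‖ ^ 2 ≤ P.Lxy ^ 2 / ρ / 2 * R ^ 2 := by
      have h7 : 0 ≤ (P.Lxy * R - ρ * ‖y - ys‖) ^ 2 / (2 * ρ) := by positivity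
      have h8 : (P.Lxy * R - ρ * ‖y - ys‖) ^ 2 / (2 * ρ) =
        P.Lxy ^ 2 / ρ / 2 * R ^ 2 - P.Lxy * ‖y - ys‖ * R + ρ / 2 * ‖y - ys‖ ^ 2 := by
        field_simp; ring
      linarith
    have h9 := mul_le_mul_of_nonneg_left hN2 (by positivity : 0 ≤ P.Lxx' / 2)
    have h10 : P.Psi xk xs y = P.Psi xk xs ys + (P.Φ xs y - P.Φ xs ys) := by
      simp only [Psi]; ring
    rw [Lrho']
    linarith
  have hf : P.fRho ρ x ≤ P.fRho ρ xs + (P.Psi xk xs ys - P.Φ xs ys) -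
      (P.Psi xk x ys - P.Φ x ys) + B * R + P.Lrho' ρ / 2 * R ^ 2 := by
    have h0 := hS.le_fRho ρ hxs hm
    refine hS.fRho_le fun y hy => ?_
    have h1 := hΨ y hy
    simp only [Psi] at h1 ⊢
    linarith
  have hμω := mul_le_mul_of_nonneg_left hω hμ.le
  have e1 : P.lam⁻¹ = P.γ + P.mu := by rw [mu_eq, lam_inv]; ring
  have e2 := lam_inv_sub_mu (P := P)
  simp only [QRho, bregman, Psi, e2] at hf ⊢
  rw [map_sub, map_sub]
  rw [e1] at hf ⊢
  linarith

end Standing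

end Problem

/-! ### Iteration counts of the primal and dual solvers -/

lemma apgConst_mono {L μ V V' g0 g0' : ℝ} (hμ : 0 < μ) (hL : 0 < L) (hV : V ≤ V') (h0 : 0 ≤ g0)
    (hg : g0 ≤ g0') : apgConst L μ V g0 ≤ apgConst L μ V' g0' := by
  unfold apgConst
  gcongr

/-- The number of iterations after which the method is guaranteed to have accuracy `δ`. -/
noncomputable def apgCount (L μ A δ : ℝ) : ℝ := 2 * (1 + apgTau L μ) * Real.log (2 + 2 * A / δ)

lemma apgCount_pos {L μ A δ : ℝ} (hμ : 0 < μ) (hL : μ ≤ L) (hA : 0 ≤ A) (hδ : 0 < δ) :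
    0 < apgCount L μ A δ := by
  have h1 := one_le_apgTau hμ hL
  have h2 : 0 < Real.log (2 + 2 * A / δ) := Real.log_pos (by
    have : 0 ≤ 2 * A / δ := by positivity
    linarith)
  exact mul_pos (by linarith) h2

/-- In the argument `2 + 2A/δ` of the logarithm, the first summand yields the bound `1/2` and the
second the bound `δ/2`. -/
lemma apgRate_pow_of_count {L μ A δ : ℝ} (hμ : 0 < μ) (hL : μ ≤ L) (hA : 0 ≤ A) (hδ : 0 < δ)
    {k : ℕ} (hk : apgCount L μ A δ ≤ k) :
    apgRate L μ ^ k ≤ 1 / 2 ∧ apgRate L μ ^ k * A ≤ δ / 2 := by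
  have h0 : 0 ≤ 2 * A / δ := by positivity
  have h1 := apgRate_pow_le hμ hL (by linarith : 0 < 2 + 2 * A / δ) hk
  constructor
  · refine h1.trans ?_
    rw [one_div]
    exact inv_anti₀ two_pos (by linarith)
  · refine (mul_le_mul_of_nonneg_right h1 hA).trans ?_
    rw [inv_mul_le_iff₀ (by linarith)]
    have : (2 + 2 * A / δ) * (δ / 2) = δ + A := by field_simp
    linarith

lemma le_of_first_index {p : ℕ → Prop} {n : ℕ} {c : ℝ} (hc : 0 < c)
    (hp : ∀ m, 1 ≤ m → m < n → c ≤ m → p m) (hfirst : ∀ m, 1 ≤ m → m < n → ¬ p m) :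
    (n : ℝ) ≤ c + 1 := by
  by_contra! h
  have h1 := Nat.ceil_lt_add_one hc.le
  have h2 : 1 ≤ ⌈c⌉₊ := Nat.ceil_pos.2 hc
  have h3 : ⌈c⌉₊ < n := by exact_mod_cast h1.trans h
  exact hfirst _ h2 h3 (hp _ h2 h3 (Nat.le_ceil c))

lemma exists_first_index {p : ℕ → Prop} {c : ℝ} (hp : ∀ m : ℕ, 1 ≤ m → c ≤ m → p m) :
    ∃ n, 1 ≤ n ∧ p n ∧ ∀ m, 1 ≤ m → m < n → ¬ p m := by
  classical
  have hex : ∃ n, 1 ≤ n ∧ p n :=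
    ⟨max 1 ⌈c⌉₊, le_max_left _ _, hp _ (le_max_left _ _)
      ((Nat.le_ceil c).trans (by exact_mod_cast le_max_right _ _))⟩
  exact ⟨Nat.find hex, (Nat.find_spec hex).1, (Nat.find_spec hex).2,
    fun m h1 hm hpm => Nat.find_min hex hm ⟨h1, hpm⟩⟩

namespace Problem

variable {E : Type u} {F : Type v} [NormedAddCommGroup E] [NormedSpace ℝ E]
  [NormedAddCommGroup F] [NormedSpace ℝ F] {P : Problem E F}

/-- A bound on the slope of `ψᴾ(·, y)` at `x0`. -/
noncomputable def slope (P : Problem E F) (x0 xk : E) (y : F) : ℝ :=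
  ‖P.gradPsiX xk x0 y‖ + P.Mr + P.mu * ‖fderiv ℝ P.ωX x0‖

/-- The initial constant of the primal solver. -/
noncomputable def innerConst (P : Problem E F) (S : ℝ) : ℝ :=
  apgConst P.Lxx' P.mu (3 * P.β * S ^ 2 / P.mu) S

/-- The initial constant of the dual solver, when `‖∇π(y0)‖ ≤ S`. -/
noncomputable def dualConst (P : Problem E F) (y0 : F) (ρ δ S : ℝ) : ℝ :=
  apgConst (P.Ldual ρ) ρ (S * Metric.diam P.Y + P.Mg * Metric.diam P.Y +
    ρ * (4 * P.Omega + ‖fderiv ℝ P.ωY y0‖ * Metric.diam P.Y) + δ) S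

lemma InnerSolve.mem (hS : P.Standing) {x0 xk : E} {y : F} {δ : ℝ} {x : E} {n : ℕ}
    (h : P.InnerSolve x0 xk y δ x n) : x ∈ P.X := by
  obtain ⟨u, uh, hrun, hn, rfl, -, -⟩ := h
  refine apgAvg_mem hS.mu_pos hS.mu_le_Lxx' hS.X_convex hn fun t ht htn => ?_
  obtain ⟨s, rfl⟩ : ∃ s, t = s + 1 := ⟨t - 1, by omega⟩
  exact hrun.mem s htn

lemma InnerSolve.primalAcc {x0 xk : E} {y : F} {δ : ℝ} {x : E} {n : ℕ}
    (h : P.InnerSolve x0 xk y δ x n) : P.PrimalAcc xk y δ x := by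
  obtain ⟨u, uh, -, -, -, h, -⟩ := h
  exact h

lemma DualSolve.dualAcc {x0 : E} {y0 : F} {ρ : ℝ} {xk : E} {δ : ℝ}
    {y : F} {np nd : ℕ} (h : P.DualSolve x0 y0 ρ xk δ y np nd) : P.DualAcc ρ xk δ y := by
  obtain ⟨w, vh, xs, ns, -, -, -, -, h, -⟩ := h
  exact h

namespace Standing

variable [FiniteDimensional ℝ E] (hS : P.Standing)
include hS

omit [FiniteDimensional ℝ E] in
lemma slope_nonneg (x0 xk : E) (y : F) : 0 ≤ P.slope x0 xk y := by
  have := hS.Mr_nonneg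
  have := hS.mu_pos
  unfold slope
  positivity

/-- All three summands are linearized at the known point `x0`. With quadratic growth, this bounds
the initial gap and distance by data at `x0`, although `X` may be unbounded. -/
lemma psiP_sub_le_slope {x0 : E} (hx0 : x0 ∈ P.X) (xk : E) {y : F} (hy : y ∈ P.Y) :
    P.psiP xk x0 y - P.psiP xk (P.xStar xk y) y ≤
      P.slope x0 xk y * ‖x0 - P.xStar xk y‖ - P.mu / 2 * ‖x0 - P.xStar xk y‖ ^ 2 := by
  have hx := hS.xStar_mem xk hy
  have h1 := hS.Psi_subgradient xk hy x0 hx0 _ hx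
  have h2 := (le_abs_self _).trans (hS.r_lip x0 hx0 _ hx)
  have h3 := mul_le_mul_of_nonneg_left (hS.le_bregman hx hx0) hS.mu_pos.le
  set xs := P.xStar xk y
  have h4 : -(P.gradPsiX xk x0 y (xs - x0)) ≤ ‖P.gradPsiX xk x0 y‖ * ‖xs - x0‖ :=
    (neg_le_abs _).trans ((P.gradPsiX xk x0 y).le_opNorm _)
  have h5 : -(fderiv ℝ P.ωX x0 (xs - x0)) ≤ ‖fderiv ℝ P.ωX x0‖ * ‖xs - x0‖ :=
    (neg_le_abs _).trans ((fderiv ℝ P.ωX x0).le_opNorm _)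
  have h6 := mul_le_mul_of_nonneg_left h5 hS.mu_pos.le
  rw [norm_sub_rev xs x0] at *
  simp only [psiP, slope, bregman] at *
  linarith

lemma dist_xStar_le {x0 : E} (hx0 : x0 ∈ P.X) (xk : E) {y : F} (hy : y ∈ P.Y) :
    ‖x0 - P.xStar xk y‖ ≤ P.slope x0 xk y / P.mu := by
  have h1 := hS.psiP_sub_le_slope hx0 xk hy
  have h2 := hS.psiP_growth xk hy hx0
  have hμ := hS.mu_pos
  have hs := hS.slope_nonneg x0 xk y
  rcases eq_or_lt_of_le (norm_nonneg (x0 - P.xStar xk y)) with h0 | h0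
  · rw [← h0]; positivity
  · rw [le_div_iff₀ hμ]
    have : (‖x0 - P.xStar xk y‖ * P.mu) * ‖x0 - P.xStar xk y‖ ≤
      P.slope x0 xk y * ‖x0 - P.xStar xk y‖ := by linarith
    exact le_of_mul_le_mul_right this h0

lemma initial_potential_le {x0 : E} (hx0 : x0 ∈ P.X) (xk : E) {y : F} (hy : y ∈ P.Y) :
    P.psiP xk x0 y - P.psiP xk (P.xStar xk y) y +
      P.mu * bregman P.ωX (P.xStar xk y) x0 ≤ 3 * P.β * P.slope x0 xk y ^ 2 / P.mu := by
  have h1 := hS.psiP_sub_le_slope hx0 xk hy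
  have h2 := hS.dist_xStar_le hx0 xk hy
  have h3 := hS.bregman_le (hS.xStar_mem xk hy) hx0
  have hμ := hS.mu_pos
  have hβ := hS.one_le_β
  have hs := hS.slope_nonneg x0 xk y
  rw [norm_sub_rev] at h3
  set d := ‖x0 - P.xStar xk y‖
  set S := P.slope x0 xk y
  have hd : 0 ≤ d := norm_nonneg _
  have e : S * (S / P.mu) = S ^ 2 / P.mu := by ring
  have h4 : S * d ≤ S ^ 2 / P.mu := by rw [← e]; exact mul_le_mul_of_nonneg_left h2 hs
  have h5 : P.mu * d ^ 2 ≤ S ^ 2 / P.mu := by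
    have h6 := pow_le_pow_left₀ hd h2 2
    have h7 := mul_le_mul_of_nonneg_left h6 hμ.le
    have : P.mu * (S / P.mu) ^ 2 = S ^ 2 / P.mu := by field_simp
    linarith
  have h8 : 0 ≤ S ^ 2 / P.mu := by positivity
  have h9 := mul_le_mul_of_nonneg_left h3 hμ.le
  have h10 : P.mu * (P.β / 2 * d ^ 2) ≤ P.β / 2 * (S ^ 2 / P.mu) := by
    have := mul_le_mul_of_nonneg_left h5 (by linarith : 0 ≤ P.β / 2)
    linarith
  have h11 : 3 * P.β * S ^ 2 / P.mu = 3 * P.β * (S ^ 2 / P.mu) := by ring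
  have h12 : S ^ 2 / P.mu ≤ P.β * (S ^ 2 / P.mu) := le_mul_of_one_le_left h8 hβ
  have h13 : 0 ≤ P.mu / 2 * d ^ 2 := by positivity
  rw [h11]
  linarith

omit [FiniteDimensional ℝ E] in
lemma innerConst_nonneg {S : ℝ} : 0 ≤ P.innerConst S := by
  have := hS.mu_pos
  have := hS.Lxx'_pos
  have := hS.β_pos
  unfold innerConst apgConst
  positivity

lemma primalAcc_of_count {x0 : E} (hx0 : x0 ∈ P.X) (xk : E) {y : F} (hy : y ∈ P.Y) {δ : ℝ}
    (hδ : 0 < δ) {n : ℕ} {u uh : ℕ → E} (hrun : IsAPG P.X P.ωX P.r P.Lxx' P.mu x0 n u uh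
      (fun t => P.gradPsiX xk (uh t) y)) (hn : 1 ≤ n)
    (hcount : apgCount P.Lxx' P.mu (P.innerConst (P.slope x0 xk y)) δ ≤ n) :
    P.PrimalAcc xk y δ (apgAvg P.Lxx' P.mu u n) := by
  have hμ := hS.mu_pos
  obtain ⟨hr1, hr2⟩ := apgRate_pow_of_count hμ hS.mu_le_Lxx' hS.innerConst_nonneg hδ hcount
  have hpot := hS.initial_potential_le hx0 xk hy
  have h := hrun.accuracy (h := fun x => P.Psi xk x y) (g := fun x => P.gradPsiX xk x y)
    (e := 0) (v := P.xStar xk y) (V := 3 * P.β * P.slope x0 xk y ^ 2 / P.mu)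
    hS.dgfX hS.r_convex hμ hS.mu_le_Lxx' hS.r_tractable
    (hS.mem_core hx0) (hS.Psi_subgradient xk hy) (hS.gradPsiX_lip xk hy) (by simp)
    (hS.xStar_mem xk hy) (fun a ha => by
      have := hS.psiP_xStar_le xk hy ha
      simp only [psiP] at this
      linarith) hn hr1 (by
      simp only [psiP] at hpot
      simp only [ne_eq, OfNat.ofNat_ne_zero, not_false_eq_true, zero_pow, mul_zero, zero_div,
        add_zero]
      linarith)
  have hC : apgConst P.Lxx' P.mu (3 * P.β * P.slope x0 xk y ^ 2 / P.mu) ‖P.gradPsiX xk x0 y‖ ≤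
      P.innerConst (P.slope x0 xk y) := by
    refine apgConst_mono hμ hS.Lxx'_pos le_rfl (norm_nonneg _) ?_
    have := hS.Mr_nonneg
    have : 0 ≤ P.mu * ‖fderiv ℝ P.ωX x0‖ := by positivity
    unfold slope
    linarith
  have hrn : 0 ≤ apgRate P.Lxx' P.mu ^ n := pow_nonneg (apgRate_nonneg hμ hS.mu_le_Lxx') n
  have h4 := mul_le_mul_of_nonneg_left hC hrn
  intro x' hx'
  have h5 := hS.psiP_xStar_le xk hy hx'
  simp only [ne_eq, OfNat.ofNat_ne_zero, not_false_eq_true, zero_pow, mul_zero, zero_div,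
        add_zero] at h
  simp only [psiP] at *
  linarith

lemma exists_innerSolve {x0 : E} (hx0 : x0 ∈ P.X) (xk : E) {y : F} (hy : y ∈ P.Y) {δ : ℝ}
    (hδ : 0 < δ) : ∃ x n, P.InnerSolve x0 xk y δ x n := by
  obtain ⟨u, uh, hrun⟩ := exists_isAPG (L := P.Lxx') hS.mu_pos hS.r_tractable (hS.mem_core hx0)
    (fun x => P.gradPsiX xk x y)
  obtain ⟨n, hn, hacc, hfirst⟩ := exists_first_index
    (p := fun n => P.PrimalAcc xk y δ (apgAvg P.Lxx' P.mu u n))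
    (fun m hm hc => hS.primalAcc_of_count hx0 xk hy hδ (hrun m) hm hc)
  exact ⟨_, n, u, uh, hrun n, hn, rfl, hacc, hfirst⟩

lemma innerSolve_count {x0 : E} (hx0 : x0 ∈ P.X) {xk : E} {y : F} (hy : y ∈ P.Y) {δ : ℝ}
    (hδ : 0 < δ) {x : E} {n : ℕ} (h : P.InnerSolve x0 xk y δ x n) :
    (n : ℝ) ≤ apgCount P.Lxx' P.mu (P.innerConst (P.slope x0 xk y)) δ + 1 := by
  obtain ⟨u, uh, hrun, hn, rfl, hacc, hfirst⟩ := h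
  exact le_of_first_index (apgCount_pos hS.mu_pos hS.mu_le_Lxx' hS.innerConst_nonneg hδ)
    (fun m hm hmn hc => hS.primalAcc_of_count hx0 xk hy hδ (hrun.mono hmn.le) hm hc) hfirst

end Standing

lemma le_Ldual (P : Problem E F) (ρ : ℝ) : ρ ≤ P.Ldual ρ := le_max_right _ _

lemma delta2_pos (hS : P.Standing) (hxy : 0 < P.Lxy) {ρ δ : ℝ} (hρ : 0 < ρ) (hδ : 0 < δ) :
    0 < P.delta2 ρ δ := by
  have := hS.mu_pos
  have hL : 0 < P.Ldual ρ := hρ.trans_le (P.le_Ldual ρ)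
  unfold delta2
  positivity

/-- A `δ₂`-accurate primal point perturbs the dual gradient by at most `L_xy √(2δ₂/μ)`, so the left
side is the error floor of the inexact method. The choice of `δ₂` leaves ample room: `16/392`
instead of `1/2`. -/
lemma delta2_error_le (hS : P.Standing) (hxy : 0 < P.Lxy) {ρ δ : ℝ} (hρ : 0 < ρ) (hδ : 0 < δ) :
    8 * (P.Lxy ^ 2 * (2 * P.delta2 ρ δ / P.mu)) / ρ ≤ δ / 2 := by
  have hμ := hS.mu_pos
  have hL : 0 < P.Ldual ρ := hρ.trans_le (P.le_Ldual ρ)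
  have hsL : 0 < √(P.Ldual ρ) := Real.sqrt_pos.2 hL
  have hsρ : 0 < √ρ := Real.sqrt_pos.2 hρ
  have h1 : ρ ^ (3 / 2 : ℝ) = ρ * √ρ := by
    rw [show (3 / 2 : ℝ) = 1 + 1 / 2 by norm_num, Real.rpow_add hρ, Real.rpow_one,
      ← Real.sqrt_eq_rpow]
  have h2 : (14 * √2) ^ 2 = (392 : ℝ) := by
    rw [mul_pow, Real.sq_sqrt (by norm_num)]; norm_num
  have h3 : √ρ ≤ √(P.Ldual ρ) := Real.sqrt_le_sqrt (P.le_Ldual ρ)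
  have h4 : (1 : ℝ) ≤ (1 + √(P.Ldual ρ / ρ)) ^ 2 :=
    one_le_pow₀ (by linarith [Real.sqrt_nonneg (P.Ldual ρ / ρ)])
  rw [delta2, h1, h2]
  set D := (1 + √(P.Ldual ρ / ρ)) ^ 2
  have hD : 0 < D := by linarith
  have e : 8 * (P.Lxy ^ 2 * (2 * (δ * P.mu * (ρ * √ρ) /
      (392 * P.Lxy ^ 2 * √(P.Ldual ρ) * D)) / P.mu)) / ρ =
      16 / 392 * δ * (√ρ / (√(P.Ldual ρ) * D)) := by
    field_simp
    norm_num
  rw [e]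
  have h5 : √ρ / (√(P.Ldual ρ) * D) ≤ 1 := by
    rw [div_le_one (by positivity)]
    nlinarith
  have := mul_le_mul_of_nonneg_left h5 (by positivity : 0 ≤ 16 / 392 * δ)
  linarith

namespace Standing

variable [FiniteDimensional ℝ E] [FiniteDimensional ℝ F] (hS : P.Standing) (hD : P.DualSmooth)
  (hT : P.DualTractable)
include hS hD

omit [FiniteDimensional ℝ E] [FiniteDimensional ℝ F] hD in
lemma Lxy_nonneg : 0 ≤ P.Lxy := hS.Lxyb_nonneg.trans (le_max_left _ _)

omit [FiniteDimensional ℝ E] hD in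
lemma Omega_nonneg : 0 ≤ P.Omega := by
  obtain ⟨y, hy⟩ := hS.Y_nonempty
  exact (abs_nonneg _).trans (hS.abs_ωY_le hy)

lemma dual_initial_potential_le {y0 : F} (hy0 : y0 ∈ P.Y) {ρ : ℝ} (hρ : 0 < ρ) (xk : E) :
    P.dualFun ρ xk (P.yStar ρ xk) - P.dualFun ρ xk y0 +
      ρ * bregman P.ωY (P.yStar ρ xk) y0 ≤
    ‖P.oracleD (P.xStar xk y0) y0‖ * Metric.diam P.Y + P.Mg * Metric.diam P.Y +
      ρ * (4 * P.Omega + ‖fderiv ℝ P.ωY y0‖ * Metric.diam P.Y) := by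
  have hm := hS.yStar_mem hD ρ xk
  have h1 := hS.dualPi_supergradient hD xk y0 hy0 _ hm
  have h2 := (le_abs_self _).trans (hS.g_lip y0 hy0 _ hm)
  have h3 := abs_le.1 (hS.abs_ωY_le hy0)
  have h4 := abs_le.1 (hS.abs_ωY_le hm)
  have h5 := hS.norm_sub_le_diam hm hy0
  set ys := P.yStar ρ xk
  have h6 : P.oracleD (P.xStar xk y0) y0 (ys - y0) ≤
      ‖P.oracleD (P.xStar xk y0) y0‖ * Metric.diam P.Y :=
    (le_abs_self _).trans (((P.oracleD (P.xStar xk y0) y0).le_opNorm _).trans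
      (mul_le_mul_of_nonneg_left h5 (norm_nonneg _)))
  have h7 : -(fderiv ℝ P.ωY y0 (ys - y0)) ≤ ‖fderiv ℝ P.ωY y0‖ * Metric.diam P.Y :=
    (neg_le_abs _).trans (((fderiv ℝ P.ωY y0).le_opNorm _).trans
      (mul_le_mul_of_nonneg_left h5 (norm_nonneg _)))
  rw [norm_sub_rev] at h2
  have h8 := mul_le_mul_of_nonneg_left h5 hS.Mg_nonneg
  have h9 : P.ωY y0 - P.ωY ys + bregman P.ωY ys y0 ≤
      4 * P.Omega + ‖fderiv ℝ P.ωY y0‖ * Metric.diam P.Y := by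
    unfold bregman
    linarith
  have h10 := mul_le_mul_of_nonneg_left h9 hρ.le
  simp only [dualFun]
  linarith

omit [FiniteDimensional ℝ E] hD in
lemma dualConst_nonneg {y0 : F} {ρ δ S : ℝ} (hρ : 0 < ρ) (hδ : 0 < δ) (hs : 0 ≤ S) :
    0 ≤ P.dualConst y0 ρ δ S := by
  have hL : 0 < P.Ldual ρ := hρ.trans_le (P.le_Ldual ρ)
  have := hS.Omega_nonneg
  have := hS.Mg_nonneg
  have := Metric.diam_nonneg (s := P.Y)
  unfold dualConst apgConst
  positivity

include hT

lemma dualAcc_of_count (hxy : 0 < P.Lxy) {y0 : F} (hy0 : y0 ∈ core P.Y P.domY)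
    {ρ : ℝ} (hρ : 0 < ρ) (xk : E) {δ : ℝ} (hδ : 0 < δ) {n : ℕ} {w vh : ℕ → F} {xs : ℕ → E}
    (hrun : IsAPG P.Y P.ωY P.g (P.Ldual ρ) ρ y0 n w vh (fun t => -P.oracleD (xs t) (vh t)))
    (hxs : ∀ t, 1 ≤ t → t ≤ n → xs t ∈ P.X ∧ P.PrimalAcc xk (vh t) (P.delta2 ρ δ) (xs t))
    (hn : 1 ≤ n) {S : ℝ} (hGS : ‖P.oracleD (P.xStar xk y0) y0‖ ≤ S)
    (hcount : apgCount (P.Ldual ρ) ρ (P.dualConst y0 ρ δ S) δ ≤ n) :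
    P.DualAcc ρ xk δ (apgAvg (P.Ldual ρ) ρ w n) := by
  have hL := P.le_Ldual ρ
  have hL0 := hρ.trans_le hL
  have hs0 := (norm_nonneg _).trans hGS
  obtain ⟨hr1, hr2⟩ := apgRate_pow_of_count hρ hL (hS.dualConst_nonneg hρ hδ hs0) hδ hcount
  have hm := hS.yStar_mem hD ρ xk
  have hpot := hS.dual_initial_potential_le hD hy0.1 hρ xk
  have hδ2 := delta2_pos hS hxy hρ hδ
  have hμ := hS.mu_pos
  have herr := delta2_error_le hS hxy hρ hδ
  set e : ℝ := P.Lxy * √(2 * P.delta2 ρ δ / P.mu) with he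
  have he2 : e ^ 2 = P.Lxy ^ 2 * (2 * P.delta2 ρ δ / P.mu) := by
    rw [he, mul_pow, Real.sq_sqrt (by positivity)]
  rw [← he2] at herr
  set Δ := e ^ 2 / ρ with hΔ
  rw [show 8 * e ^ 2 / ρ = 8 * Δ by rw [hΔ]; ring] at herr
  have hdiam := Metric.diam_nonneg (s := P.Y)
  have h := hrun.accuracy (h := fun y => -P.dualPi xk y)
    (g := fun y => -P.oracleD (P.xStar xk y) y) (e := e) (v := P.yStar ρ xk)
    (V := S * Metric.diam P.Y + P.Mg * Metric.diam P.Y +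
    ρ * (4 * P.Omega + ‖fderiv ℝ P.ωY y0‖ * Metric.diam P.Y) + δ)
    hS.dgfY hS.g_convex hρ hL hT hy0 (hS.neg_dualPi_subgradient hD xk)
    (fun a ha b hb => (hS.neg_gradPi_lip hD xk a ha b hb).trans
      (mul_le_mul_of_nonneg_right (le_max_left _ _) (norm_nonneg _)))
    (fun t ht => by
      have hv := hrun.hat_mem hρ hL hS.Y_convex hy0.1 ht
      obtain ⟨hx, hacc⟩ := hxs (t + 1) (by omega) ht
      have h1 := hS.dist_xStar_of_primalAcc hv hx hacc
      have h2 := hD.lip_yx _ hx _ (hS.xStar_mem xk hv) _ hv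
      rw [neg_sub_neg, norm_sub_rev]
      refine h2.trans ?_
      exact mul_le_mul (le_max_right _ _) (Real.le_sqrt_of_sq_le h1) (norm_nonneg _) hxy.le)
    hm (fun a ha => by
      have := (hS.yStar_spec hD ρ xk).2 a ha
      simp only [dualFun] at this
      linarith) hn hr1 (by
      -- The summand `δ` in `V` makes room for `4e²/ρ`, which `herr` bounds by `δ/4`.
      have := mul_le_mul_of_nonneg_right hGS hdiam
      simp only [dualFun] at hpot
      rw [show 4 * e ^ 2 / ρ = 4 * Δ by rw [hΔ]; ring]
      linarith)
  have hC : apgConst (P.Ldual ρ) ρ (S * Metric.diam P.Y + P.Mg * Metric.diam P.Y +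
      ρ * (4 * P.Omega + ‖fderiv ℝ P.ωY y0‖ * Metric.diam P.Y) + δ)
      ‖-P.oracleD (P.xStar xk y0) y0‖ ≤ P.dualConst y0 ρ δ S := by
    rw [norm_neg]
    exact apgConst_mono hρ hL0 le_rfl (norm_nonneg _) hGS
  have h4 := mul_le_mul_of_nonneg_left hC (pow_nonneg (apgRate_nonneg hρ hL) n)
  rw [show 8 * e ^ 2 / ρ = 8 * Δ by rw [hΔ]; ring] at h
  intro y' hy'
  have h5 := (hS.yStar_spec hD ρ xk).2 y' hy'
  simp only [dualFun] at *
  linarith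

lemma exists_dualSolve (hxy : 0 < P.Lxy) {x0 : E} (hx0 : x0 ∈ P.X) {y0 : F}
    (hy0 : y0 ∈ core P.Y P.domY) {ρ : ℝ} (hρ : 0 < ρ) (xk : E) {δ : ℝ} (hδ : 0 < δ) :
    ∃ y np nd, P.DualSolve x0 y0 ρ xk δ y np nd := by
  -- A total choice of inner solutions makes the inexact gradient a function of the query point; the
  -- dummy value off `Y` is never reached.
  have hex : ∀ v, ∃ x n, v ∈ P.Y → P.InnerSolve x0 xk v (P.delta2 ρ δ) x n := by
    intro v
    by_cases hv : v ∈ P.Y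
    · obtain ⟨x, n, h⟩ := hS.exists_innerSolve hx0 xk hv (delta2_pos hS hxy hρ hδ)
      exact ⟨x, n, fun _ => h⟩
    · exact ⟨x0, 0, fun h => absurd h hv⟩
  choose X N hXN using hex
  obtain ⟨w, vh, hrun⟩ := exists_isAPG (L := P.Ldual ρ) hρ hT hy0
    (fun v => -P.oracleD (X v) v)
  have hv : ∀ t, 1 ≤ t → vh t ∈ P.Y := by
    intro t ht
    obtain ⟨s, rfl⟩ : ∃ s, t = s + 1 := ⟨t - 1, by omega⟩
    exact (hrun (s + 1)).hat_mem hρ (P.le_Ldual ρ) hS.Y_convex hy0.1 (Nat.lt_succ_self s)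
  obtain ⟨n, hn, hacc, hfirst⟩ := exists_first_index
    (p := fun n => P.DualAcc ρ xk δ (apgAvg (P.Ldual ρ) ρ w n))
    (fun m hm hc => hS.dualAcc_of_count hD hT hxy hy0 hρ xk hδ (xs := fun t => X (vh t))
      (hrun m) (fun t ht _ => ⟨(hXN _ (hv t ht)).mem hS, (hXN _ (hv t ht)).primalAcc⟩) hm
      le_rfl hc)
  exact ⟨_, _, n, w, vh, fun t => X (vh t), fun t => N (vh t), hrun n,
    fun t ht _ => hXN _ (hv t ht), hn, rfl, hacc, hfirst, rfl⟩

omit [FiniteDimensional ℝ E] [FiniteDimensional ℝ F] hT hD in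
lemma dualSolve_mem {x0 : E} {y0 : F} {ρ : ℝ} (hρ : 0 < ρ) {xk : E} {δ : ℝ} {y : F}
    {np nd : ℕ} (h : P.DualSolve x0 y0 ρ xk δ y np nd) : y ∈ P.Y := by
  obtain ⟨w, vh, xs, ns, hrun, -, hn, rfl, -⟩ := h
  refine apgAvg_mem hρ (P.le_Ldual ρ) hS.Y_convex hn fun t ht htn => ?_
  obtain ⟨s, rfl⟩ : ∃ s, t = s + 1 := ⟨t - 1, by omega⟩
  exact hrun.mem s htn

lemma dualSolve_count (hxy : 0 < P.Lxy) {x0 : E} {y0 : F}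
    (hy0 : y0 ∈ core P.Y P.domY) {ρ : ℝ} (hρ : 0 < ρ) {xk : E} {δ : ℝ} (hδ : 0 < δ) {y : F}
    {np nd : ℕ} {S : ℝ} (hGS : ‖P.oracleD (P.xStar xk y0) y0‖ ≤ S)
    (h : P.DualSolve x0 y0 ρ xk δ y np nd) :
    (nd : ℝ) ≤ apgCount (P.Ldual ρ) ρ (P.dualConst y0 ρ δ S) δ + 1 := by
  obtain ⟨w, vh, xs, ns, hrun, hin, hn, rfl, hacc, hfirst, -⟩ := h
  have hs0 := (norm_nonneg _).trans hGS
  refine le_of_first_index (apgCount_pos hρ (P.le_Ldual ρ)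
    (hS.dualConst_nonneg hρ hδ hs0) hδ) (fun m hm hmn hc => ?_) hfirst
  exact hS.dualAcc_of_count hD hT hxy hy0 hρ xk hδ (hrun.mono hmn.le)
    (fun t ht htm => ⟨(hin t ht (by omega)).mem hS, (hin t ht (by omega)).primalAcc⟩) hm hGS hc

omit [FiniteDimensional ℝ F] hD hT in
lemma dualSolve_primal_count (hxy : 0 < P.Lxy) {x0 : E} (hx0 : x0 ∈ P.X) {y0 : F}
    (hy0 : y0 ∈ core P.Y P.domY) {ρ : ℝ} (hρ : 0 < ρ) {xk : E} {δ : ℝ} (hδ : 0 < δ) {y : F}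
    {np nd : ℕ} {c : ℝ} (hc : ∀ y ∈ P.Y,
      apgCount P.Lxx' P.mu (P.innerConst (P.slope x0 xk y)) (P.delta2 ρ δ) + 1 ≤ c)
    (h : P.DualSolve x0 y0 ρ xk δ y np nd) : (np : ℝ) ≤ nd * c := by
  obtain ⟨w, vh, xs, ns, hrun, hin, hn, rfl, hacc, hfirst, rfl⟩ := h
  push_cast
  have h1 : ∀ t ∈ Finset.Icc 1 nd, (ns t : ℝ) ≤ c := by
    intro t ht
    rw [Finset.mem_Icc] at ht
    obtain ⟨s, rfl⟩ : ∃ s, t = s + 1 := ⟨t - 1, by omega⟩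
    have hv := hrun.hat_mem hρ (P.le_Ldual ρ) hS.Y_convex hy0.1 (t := s) (by omega)
    exact (hS.innerSolve_count hx0 hv (delta2_pos hS hxy hρ hδ) (hin _ ht.1 ht.2)).trans (hc _ hv)
  refine (Finset.sum_le_card_nsmul _ _ _ h1).trans ?_
  simp

end Standing
end Problem

/-! ### Correctness of the proximal steps and of the outer loop -/

lemma le_of_sq_le_sq₀ {a b : ℝ} (h : a ^ 2 ≤ b ^ 2) (hb : 0 ≤ b) : a ≤ b :=
  (le_abs_self a).trans (abs_le_of_sq_le_sq h hb)

namespace Problem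

variable {E : Type u} {F : Type v} [NormedAddCommGroup E] [NormedSpace ℝ E]
  [NormedAddCommGroup F] [NormedSpace ℝ F] {P : Problem E F}

/-- A bound on the distance between the reference point and the solution of a proximal step. -/
noncomputable def refDist (P : Problem E F) (ρ : ℝ) : ℝ :=
  1 / √P.mu * (1 + P.Lxy / √P.mu + 2 * √P.Omega * (1 + √ρ))

lemma Lrho'_ge {ρ : ℝ} (hρ : 0 < ρ) : P.Lxx' ≤ P.Lrho' ρ := by
  have : 0 ≤ P.Lxy ^ 2 / ρ := by positivity
  rw [Lrho']; linarith

lemma boundOmega_eq (ρ : ℝ) (xr : E) :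
    P.boundOmega ρ xr = ‖fderiv ℝ P.ωX xr‖ + P.β * P.refDist ρ := by
  rw [boundOmega, refDist]; ring

lemma rho_pos (hΩ : 0 < P.Omega) {η : ℝ} (hη : 0 < η) : 0 < P.rho η := by
  unfold rho; positivity

namespace Standing

section

variable [FiniteDimensional ℝ E] [FiniteDimensional ℝ F] (hS : P.Standing) (hD : P.DualSmooth)
include hS

/-- With both accuracies `1/2` and dual modulus `1`, the primal error is at most `1/√μ` and the dual
error at most `1`; `xStar` transports the latter with factor `L_xy/μ`. -/
lemma dist_reference_one {x0 : E} (hD : P.DualSmooth) {y0 : F} {xk xr : E} {yr : F}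
    {np nd n : ℕ} (h1 : P.DualSolve x0 y0 1 xk (1 / 2) yr np nd)
    (h2 : P.InnerSolve x0 xk yr (1 / 2) xr n) :
    ‖xr - P.xStar xk (P.yStar 1 xk)‖ ≤ 1 / √P.mu * (1 + P.Lxy / √P.mu) := by
  have hμ := hS.mu_pos
  have hs : 0 < √P.mu := Real.sqrt_pos.2 hμ
  have hss : √P.mu ^ 2 = P.mu := Real.sq_sqrt hμ.le
  have hyr := hS.dualSolve_mem one_pos h1
  have hm := hS.yStar_mem hD 1 xk
  have h3 := hS.dist_xStar_of_primalAcc hyr (h2.mem hS) h2.primalAcc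
  have h4 := hS.dist_yStar_of_dualAcc hD one_pos hyr h1.dualAcc
  have h5 := hS.xStar_lip xk hyr hm
  have h6 : ‖xr - P.xStar xk yr‖ ≤ 1 / √P.mu := by
    apply le_of_sq_le_sq₀ _ (by positivity)
    rw [div_pow, hss]
    refine h3.trans (le_of_eq ?_)
    norm_num
  have h7 : ‖yr - P.yStar 1 xk‖ ≤ 1 := by
    apply le_of_sq_le_sq₀ _ (by positivity)
    refine h4.trans (le_of_eq ?_)
    norm_num
  have h8 : ‖P.xStar xk yr - P.xStar xk (P.yStar 1 xk)‖ ≤ P.Lxy / P.mu := by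
    rw [le_div_iff₀ hμ, mul_comm]
    exact h5.trans (mul_le_of_le_one_right hS.Lxy_nonneg h7)
  have e : 1 / √P.mu * (1 + P.Lxy / √P.mu) = 1 / √P.mu + P.Lxy / P.mu := by
    rw [← hss, Real.sqrt_sq hs.le]; field_simp
  rw [e, ← sub_add_sub_cancel xr (P.xStar xk yr) (P.xStar xk (P.yStar 1 xk))]
  exact (norm_add_le _ _).trans (add_le_add h6 h8)

include hD

lemma dist_reference {x0 : E} {y0 : F} {xk xr : E} {yr : F} {np nd n : ℕ} {ρ : ℝ} (hρ : 0 < ρ)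
    (h1 : P.DualSolve x0 y0 1 xk (1 / 2) yr np nd)
    (h2 : P.InnerSolve x0 xk yr (1 / 2) xr n) :
    ‖xr - P.xStar xk (P.yStar ρ xk)‖ ≤ P.refDist ρ := by
  have hμ := hS.mu_pos
  have hs : 0 < √P.mu := Real.sqrt_pos.2 hμ
  have hss : √P.mu ^ 2 = P.mu := Real.sq_sqrt hμ.le
  have hO : √P.Omega ^ 2 = P.Omega := Real.sq_sqrt hS.Omega_nonneg
  have hr : √ρ ^ 2 = ρ := Real.sq_sqrt hρ.le
  have hO0 := Real.sqrt_nonneg P.Omega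
  have hr0 := Real.sqrt_nonneg ρ
  have h3 := hS.dist_reference_one hD h1 h2
  have h4 := hS.dist_xStar_smoothing hD one_pos hρ xk
  have h5 : ‖P.xStar xk (P.yStar 1 xk) - P.xStar xk (P.yStar ρ xk)‖ ≤
      1 / √P.mu * (2 * √P.Omega * (1 + √ρ)) := by
    apply le_of_sq_le_sq₀ _ (by positivity)
    have e : (1 / √P.mu * (2 * √P.Omega * (1 + √ρ))) ^ 2 =
        (4 * P.Omega * (1 + √ρ) ^ 2) / P.mu := by
      rw [mul_pow, div_pow, mul_pow, mul_pow, hO, hss]; ring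
    rw [e, le_div_iff₀ hμ, mul_comm]
    refine h4.trans ?_
    have h6 : |1 - ρ| ≤ 1 + ρ := by rw [abs_le]; constructor <;> linarith
    have h7 := mul_le_mul_of_nonneg_right h6 hS.Omega_nonneg
    have h8 : (1 + ρ) * P.Omega ≤ (1 + √ρ) ^ 2 * P.Omega := by
      apply mul_le_mul_of_nonneg_right _ hS.Omega_nonneg
      nlinarith
    have h9 : 0 ≤ (1 + √ρ) ^ 2 * P.Omega := mul_nonneg (sq_nonneg _) hS.Omega_nonneg
    linarith
  rw [← sub_add_sub_cancel xr (P.xStar xk (P.yStar 1 xk)) (P.xStar xk (P.yStar ρ xk)), refDist]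
  refine (norm_add_le _ _).trans ?_
  rw [mul_add (1 / √P.mu)]
  exact add_le_add h3 h5

omit [FiniteDimensional ℝ E] [FiniteDimensional ℝ F] hD in
lemma gradPsiX_le_sup (xk : E) {x : E} (hx : x ∈ P.X) {y : F} (hy : y ∈ P.Y) :
    ‖P.gradPsiX xk x y‖ ≤ sSup ((fun y => ‖P.gradPsiX xk x y‖) '' P.Y) := by
  refine le_csSup ⟨‖P.gradPsiX xk x y‖ + P.Lxy * Metric.diam P.Y, ?_⟩ (mem_image_of_mem _ hy)
  rintro _ ⟨z, hz, rfl⟩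
  have h1 := hS.gradPsiX_lip_y xk hx hz hy
  have h2 := mul_le_mul_of_nonneg_left (hS.norm_sub_le_diam hz hy) hS.Lxy_nonneg
  simp only
  rw [← add_sub_cancel (P.gradPsiX xk x y) (P.gradPsiX xk x z)]
  exact (norm_add_le _ _).trans (by linarith)

omit [FiniteDimensional ℝ E] [FiniteDimensional ℝ F] hD in
-- Splits `refDist` into its `ρ`-free part and a part with `√ρ`; for the latter `boundF` carries
-- `L'_ρ`, which exceeds `L'_xx`.
lemma le_boundF {ρ : ℝ} (hρ : 0 < ρ) (xk xr : E) :
    sSup ((fun y => ‖P.gradPsiX xk xr y‖) '' P.Y) + P.Lxx' * P.refDist ρ ≤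
      P.boundF ρ xk xr := by
  have hs : 0 < √P.mu := Real.sqrt_pos.2 hS.mu_pos
  have h1 : √(ρ * P.Omega / P.mu) = √ρ * √P.Omega / √P.mu := by
    rw [Real.sqrt_div' _ hS.mu_pos.le, Real.sqrt_mul hρ.le]
  have h2 : 0 ≤ P.Lxy * Metric.diam P.Y := mul_nonneg hS.Lxy_nonneg Metric.diam_nonneg
  have h3 : P.Lxx' * (√ρ * √P.Omega / √P.mu) ≤ P.Lrho' ρ * (√ρ * √P.Omega / √P.mu) :=
    mul_le_mul_of_nonneg_right (Lrho'_ge hρ) (by positivity)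
  have e : P.Lxx' * P.refDist ρ = P.Lxx' / √P.mu *
      (1 + P.Lxy / √P.mu + 2 * √P.Omega) + 2 * (P.Lxx' * (√ρ * √P.Omega / √P.mu)) := by
    rw [refDist]; ring
  rw [boundF, h1, e]
  linarith

omit [FiniteDimensional ℝ E] [FiniteDimensional ℝ F] hD in
lemma refDist_pos (ρ : ℝ) : 0 < P.refDist ρ := by
  have hs : 0 < √P.mu := Real.sqrt_pos.2 hS.mu_pos
  have := hS.Lxy_nonneg
  unfold refDist
  positivity

omit [FiniteDimensional ℝ E] [FiniteDimensional ℝ F] hD in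
lemma boundF_nonneg {ρ : ℝ} (hρ : 0 < ρ) (xk xr : E) : 0 ≤ P.boundF ρ xk xr := by
  refine le_trans ?_ (hS.le_boundF hρ xk xr)
  refine add_nonneg (Real.sSup_nonneg ?_) (mul_nonneg hS.Lxx'_pos.le (hS.refDist_pos ρ).le)
  rintro _ ⟨y, -, rfl⟩
  exact norm_nonneg _

omit [FiniteDimensional ℝ E] [FiniteDimensional ℝ F] hD in
lemma slopeBound_pos {ρ : ℝ} (hρ : 0 < ρ) (xk xr : E) :
    0 < P.boundF ρ xk xr + P.Mr + P.mu * P.boundOmega ρ xr := by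
  have h1 := hS.boundF_nonneg hρ xk xr
  have h2 := hS.Mr_nonneg
  have h3 : 0 < P.boundOmega ρ xr := by
    rw [boundOmega_eq]
    exact add_pos_of_nonneg_of_pos (norm_nonneg _) (mul_pos hS.β_pos (hS.refDist_pos ρ))
  have := mul_pos hS.mu_pos h3
  linarith

omit [FiniteDimensional ℝ E] [FiniteDimensional ℝ F] hD in
lemma curvature_pos {ρ : ℝ} (hρ : 0 < ρ) : 0 < P.Lrho' ρ + P.mu * P.β :=
  add_pos (hS.Lxx'_pos.trans_le (Lrho'_ge hρ)) (mul_pos hS.mu_pos hS.β_pos)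

omit [FiniteDimensional ℝ E] [FiniteDimensional ℝ F] hD in
lemma accMin_pos {ρ η : ℝ} (hρ : 0 < ρ) (hη : 0 < η) (xk xr : E) : 0 < P.accMin ρ η xk xr := by
  have := hS.slopeBound_pos hρ xk xr
  have := hS.curvature_pos hρ
  exact lt_min (by positivity) (by positivity)

omit [FiniteDimensional ℝ E] [FiniteDimensional ℝ F] hD in
lemma eps3_pos (hxy : 0 < P.Lxy) {ρ η : ℝ} (hρ : 0 < ρ) (hη : 0 < η) (xk xr : E) :
    0 < P.eps3 ρ η xk xr := by
  have := hS.accMin_pos hρ hη xk xr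
  have := hS.mu_pos
  exact lt_min (by positivity) (by positivity)

omit [FiniteDimensional ℝ E] [FiniteDimensional ℝ F] hD in
lemma eps4_pos {ρ η : ℝ} (hρ : 0 < ρ) (hη : 0 < η) (xk xr : E) : 0 < P.eps4 ρ η xk xr := by
  have := hS.accMin_pos hρ hη xk xr
  have := hS.mu_pos
  unfold eps4
  positivity

lemma bddBelow_QRho {ρ : ℝ} (hρ : 0 < ρ) (xk : E) :
    BddBelow ((fun x => P.QRho ρ x xk) '' P.X) := by
  refine ⟨P.QRho ρ (P.xStar xk (P.yStar ρ xk)) xk, ?_⟩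
  rintro _ ⟨x, hx, rfl⟩
  have h1 := hS.QRho_growth hD hρ xk hx
  have := hS.mu_pos
  have : 0 ≤ P.mu / 2 * ‖x - P.xStar xk (P.yStar ρ xk)‖ ^ 2 := by positivity
  simp only
  linarith

/-- `ε₃` and `ε₄` are calibrated so that the dual error, carried through `xStar`, and the primal
error each contribute `η m/32` to the squared distance; `(a+b)² ≤ 2a² + 2b²` gives `η m/8`. -/
lemma step_dist (hxy : 0 < P.Lxy) {ρ η : ℝ} (hρ : 0 < ρ) {xk x xr : E} {y : F} (hy : y ∈ P.Y)
    (hx : x ∈ P.X) (hya : P.DualAcc ρ xk (P.eps3 ρ η xk xr) y)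
    (hxa : P.PrimalAcc xk y (P.eps4 ρ η xk xr) x) :
    ‖x - P.xStar xk (P.yStar ρ xk)‖ ^ 2 ≤ η * P.accMin ρ η xk xr / 8 := by
  have hμ := hS.mu_pos
  have hm := hS.yStar_mem hD ρ xk
  have h1 := hS.dist_xStar_of_primalAcc hy hx hxa
  have h2 := hS.dist_yStar_of_dualAcc hD hρ hy hya
  have h3 := hS.xStar_lip xk hy hm
  have h4 : P.eps3 ρ η xk xr ≤ η * P.mu ^ 2 * ρ / (64 * P.Lxy ^ 2) * P.accMin ρ η xk xr :=
    min_le_left _ _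
  have e4 : P.eps4 ρ η xk xr = η * P.mu / 64 * P.accMin ρ η xk xr := rfl
  set m := P.accMin ρ η xk xr
  set a := ‖x - P.xStar xk y‖
  set b := ‖P.xStar xk y - P.xStar xk (P.yStar ρ xk)‖
  set d := ‖y - P.yStar ρ xk‖
  have ha : a ^ 2 ≤ η * m / 32 := by
    refine h1.trans (le_of_eq ?_)
    rw [e4]; field_simp; ring
  have hb : b ^ 2 ≤ η * m / 32 := by
    have h5 : (P.mu * b) ^ 2 ≤ (P.Lxy * d) ^ 2 := by
      have : 0 ≤ P.mu * b := mul_nonneg hμ.le (norm_nonneg _)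
      exact pow_le_pow_left₀ this h3 2
    rw [mul_pow, mul_pow] at h5
    have h6 : P.Lxy ^ 2 * d ^ 2 ≤ P.Lxy ^ 2 * (2 * (η * P.mu ^ 2 * ρ / (64 * P.Lxy ^ 2) * m) / ρ) :=
      mul_le_mul_of_nonneg_left (h2.trans (by gcongr)) (by positivity)
    have h7 : P.Lxy ^ 2 * (2 * (η * P.mu ^ 2 * ρ / (64 * P.Lxy ^ 2) * m) / ρ) =
        P.mu ^ 2 * (η * m / 32) := by
      field_simp; ring
    have h8 : P.mu ^ 2 * b ^ 2 ≤ P.mu ^ 2 * (η * m / 32) := by linarith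
    exact le_of_mul_le_mul_left h8 (by positivity)
  have h9 : ‖x - P.xStar xk (P.yStar ρ xk)‖ ≤ a + b := by
    rw [← sub_add_sub_cancel x (P.xStar xk y) (P.xStar xk (P.yStar ρ xk))]
    exact norm_add_le _ _
  have h10 := pow_le_pow_left₀ (norm_nonneg _) h9 2
  nlinarith [sq_nonneg (a - b)]

lemma stepOK_of_caseIIStep (hxy : 0 < P.Lxy) (hΩ : 0 < P.Omega) {x0 : E} {y0 : F}
    {η : ℝ} (hη : 0 < η) {xk xnext : E} {np nd : ℕ}
    (h : P.CaseIIStep x0 y0 η xk xnext np nd) : P.StepOK η xk xnext := by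
  obtain ⟨yr, xr, y, np₁, nd₁, n₁, np₂, nd₂, n₂, h1, h2, h3, h4, -, -⟩ := h
  have hρ := rho_pos hΩ hη
  set ρ := P.rho η
  have hy := hS.dualSolve_mem hρ h3
  have hx := h4.mem hS
  refine ⟨hS.mem_core hx, ?_⟩
  have hm := hS.yStar_mem hD ρ xk
  have hxs := hS.xStar_mem xk hm
  have hμ := hS.mu_pos
  have hdist := hS.step_dist hD hxy hρ hy hx h3.dualAcc h4.primalAcc
  have href := hS.dist_reference hD hρ h1 h2
  have hB' : ‖fderiv ℝ P.ωX (P.xStar xk (P.yStar ρ xk))‖ ≤ P.boundOmega ρ xr := by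
    have h5 := hS.ωX_lip _ hxs xr (h2.mem hS)
    rw [norm_sub_rev (P.xStar xk (P.yStar ρ xk))] at h5
    have h6 := mul_le_mul_of_nonneg_left href hS.β_pos.le
    rw [boundOmega_eq, ← add_sub_cancel (fderiv ℝ P.ωX xr)
      (fderiv ℝ P.ωX (P.xStar xk (P.yStar ρ xk)))]
    exact (norm_add_le _ _).trans (by linarith)
  have hB : ‖P.gradPsiX xk (P.xStar xk (P.yStar ρ xk)) (P.yStar ρ xk)‖ ≤ P.boundF ρ xk xr := by
    have h5 := hS.gradPsiX_lip xk hm _ hxs xr (h2.mem hS)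
    rw [norm_sub_rev (P.xStar xk (P.yStar ρ xk))] at h5
    have h6 := mul_le_mul_of_nonneg_left href hS.Lxx'_pos.le
    have h7 := hS.gradPsiX_le_sup xk (h2.mem hS) hm
    refine le_trans ?_ (hS.le_boundF hρ xk xr)
    rw [← add_sub_cancel (P.gradPsiX xk xr (P.yStar ρ xk))
      (P.gradPsiX xk (P.xStar xk (P.yStar ρ xk)) (P.yStar ρ xk))]
    exact (norm_add_le _ _).trans (by linarith)
  have hup := hS.QRho_upper hD hρ xk hx hB hB' le_rfl
  have hT := hS.slopeBound_pos hρ xk xr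
  have hC := hS.curvature_pos hρ
  have hm1 : P.accMin ρ η xk xr ≤
    η / (8 * (P.boundF ρ xk xr + P.Mr + P.mu * P.boundOmega ρ xr) ^ 2) := min_le_left _ _
  have hm2 : P.accMin ρ η xk xr ≤ 1 / (P.Lrho' ρ + P.mu * P.β) := min_le_right _ _
  set T := P.boundF ρ xk xr + P.Mr + P.mu * P.boundOmega ρ xr
  set R := ‖xnext - P.xStar xk (P.yStar ρ xk)‖
  have hR0 : 0 ≤ R := norm_nonneg _
  -- The two entries of the minimum `m` serve the two terms of `QRho_upper`: the first handles the
  -- linear term, the second the quadratic one.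
  have hTR : T * R ≤ η / 8 := by
    apply le_of_sq_le_sq₀ _ (by positivity)
    rw [mul_pow]
    have h5 : T ^ 2 * R ^ 2 ≤ T ^ 2 * (η * (η / (8 * T ^ 2)) / 8) :=
      mul_le_mul_of_nonneg_left (hdist.trans (by gcongr)) (by positivity)
    refine h5.trans (le_of_eq ?_)
    field_simp
  have hCR : (P.Lrho' ρ + P.mu * P.β) / 2 * R ^ 2 ≤ η / 16 := by
    have h5 : (P.Lrho' ρ + P.mu * P.β) / 2 * R ^ 2 ≤ (P.Lrho' ρ + P.mu * P.β) / 2 *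
        (η * (1 / (P.Lrho' ρ + P.mu * P.β)) / 8) :=
      mul_le_mul_of_nonneg_left (hdist.trans (by gcongr)) (by positivity)
    refine h5.trans (le_of_eq ?_)
    field_simp
    norm_num
  have henv : P.QRho ρ (P.xStar xk (P.yStar ρ xk)) xk ≤ P.qRhoEnv ρ xk := by
    refine le_csInf (hS.X_nonempty.image _) ?_
    rintro _ ⟨x, hx, rfl⟩
    have h5 := hS.QRho_growth hD hρ xk hx
    have : 0 ≤ P.mu / 2 * ‖x - P.xStar xk (P.yStar ρ xk)‖ ^ 2 := by positivity
    simp only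
    linarith
  linarith

lemma exists_caseIIStep (hT : P.DualTractable) (hxy : 0 < P.Lxy) (hΩ : 0 < P.Omega) {x0 : E}
    (hx0 : x0 ∈ P.X) {y0 : F} (hy0 : y0 ∈ core P.Y P.domY) {η : ℝ} (hη : 0 < η) (xk : E) :
    ∃ xnext np nd, P.CaseIIStep x0 y0 η xk xnext np nd := by
  have hρ := rho_pos hΩ hη
  obtain ⟨yr, np₁, nd₁, h1⟩ := hS.exists_dualSolve hD hT hxy hx0 hy0 one_pos xk one_half_pos
  obtain ⟨xr, n₁, h2⟩ := hS.exists_innerSolve hx0 xk (hS.dualSolve_mem one_pos h1) one_half_pos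
  obtain ⟨y, np₂, nd₂, h3⟩ := hS.exists_dualSolve hD hT hxy hx0 hy0 hρ xk
    (hS.eps3_pos hxy hρ hη xk xr)
  obtain ⟨xn, n₂, h4⟩ := hS.exists_innerSolve hx0 xk (hS.dualSolve_mem hρ h3)
    (hS.eps4_pos hρ hη xk xr)
  exact ⟨xn, _, _, yr, xr, y, np₁, nd₁, n₁, np₂, nd₂, n₂, h1, h2, h3, h4, rfl, rfl⟩

/-! #### The outer loop -/

/-- Removing the smoothing costs `ρΩ = η/4` at `xnext` and again at `x`, in addition to the step
accuracy `η`. -/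
lemma Q_le_of_stepOK (hΩ : 0 < P.Omega) {η : ℝ} (hη : 0 < η) {xk xnext : E}
    (h : P.StepOK η xk xnext) {x : E} (hx : x ∈ P.X) :
    P.Q xnext xk ≤ P.Q x xk + 3 / 2 * η := by
  have hρ := rho_pos hΩ hη
  have e : P.rho η * P.Omega = η / 4 := by unfold rho; field_simp
  have h1 := hS.fRho_le_fRho_add 0 (P.rho η) h.1.1
  have h2 := hS.fRho_le_fRho_add (P.rho η) 0 hx
  have h3 : P.qRhoEnv (P.rho η) xk ≤ P.QRho (P.rho η) x xk :=
    csInf_le (hS.bddBelow_QRho hD hρ xk) (mem_image_of_mem _ hx)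
  have h4 := h.2
  rw [zero_sub, abs_neg, abs_of_pos hρ, e] at h1
  rw [sub_zero, abs_of_pos hρ, e] at h2
  rw [Q_eq_QRho_zero, Q_eq_QRho_zero]
  simp only [QRho] at *
  linarith

lemma descent (hΩ : 0 < P.Omega) {η : ℝ} (hη : 0 < η) {xk xnext : E} (hxk : xk ∈ P.X)
    (h : P.StepOK η xk xnext) :
    P.q xnext + P.γ * ‖xnext - xk‖ ^ 2 ≤ P.q xk + 3 / 2 * η := by
  have h1 := hS.Q_le_of_stepOK hD hΩ hη h hxk
  have h2 := hS.le_bregman h.1.1 hxk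
  have h3 := mul_le_mul_of_nonneg_left h2 (mul_nonneg two_pos.le hS.γ_pos.le)
  have h4 : bregman P.ωX xk xk = 0 := by simp [bregman]
  simp only [Q, h4, lam_inv] at h1
  linarith

lemma descent_of_long_step (hΩ : 0 < P.Omega) {η : ℝ} (hη : 0 < η) {xk xnext : E}
    (hxk : xk ∈ P.X) (h : P.StepOK η xk xnext) (hlong : 4 * √(P.lam * η) < ‖xnext - xk‖) :
    P.q xnext + 13 / 2 * η ≤ P.q xk := by
  have h1 := hS.descent hD hΩ hη hxk h
  have hl := hS.lam_pos
  have h2 := pow_le_pow_left₀ (by positivity) hlong.le 2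
  rw [mul_pow, Real.sq_sqrt (by positivity)] at h2
  have h3 := mul_le_mul_of_nonneg_left h2 hS.γ_pos.le
  -- Since `γλ = 1/2`, a long step gains `8η`, of which `3η/2` is lost to inexactness.
  have h4 : P.γ * (4 ^ 2 * (P.lam * η)) = 8 * η := by
    have := hS.γ_pos.ne'
    rw [lam]; field_simp; norm_num
  linarith

end

/-! ### Near-stationarity after a short step. -/

section NearStationarity

variable [FiniteDimensional ℝ E] [FiniteDimensional ℝ F] (hS : P.Standing)
include hS

omit [FiniteDimensional ℝ E] in
lemma f_lowerSemicontinuousOn : LowerSemicontinuousOn P.f P.X := by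
  intro x hx c hc
  obtain ⟨_, ⟨y, hy, rfl⟩, hlt⟩ := exists_lt_of_lt_csSup (hS.Y_nonempty.image _) hc
  have h1 : ContinuousOn (fun x => P.Φ x y - P.g y) P.X :=
    (hS.continuousOn.comp (f := fun x => (x, y)) (by fun_prop) fun x hx => ⟨hx, hy⟩).sub
      continuousOn_const
  filter_upwards [(h1 x hx).eventually_const_lt hlt, self_mem_nhdsWithin] with z hz hzX
  refine hz.trans_le ?_
  have := hS.le_fRho 0 hzX hy
  rw [f_eq_fRho_zero]
  linarith

omit [FiniteDimensional ℝ E] in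
lemma Q_lowerSemicontinuousOn (x : E) : LowerSemicontinuousOn (fun x' => P.Q x' x) P.X := by
  have h1 := hS.f_lowerSemicontinuousOn
  have h2 : LowerSemicontinuousOn P.r P.X :=
    (lipschitz_continuousOn hS.Mr_nonneg hS.r_lip).lowerSemicontinuousOn
  have h3 : ContinuousOn (fun x' => P.lam⁻¹ * bregman P.ωX x' x) P.X := by
    have := hS.dgfX.continuousOn
    unfold bregman
    fun_prop
  exact (h1.add h2).add h3.lowerSemicontinuousOn

omit [FiniteDimensional ℝ E] in
-- Up to terms independent of `x'`, `Q` is a supremum over `y` of the strongly convex functions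
-- `ψᴾ(·,y) - g(y)`.
lemma Q_strongConvexOn (x : E) : StrongConvexOn P.X P.mu (fun x' => P.Q x' x) := by
  refine strongConvexOn_of_forall_segment hS.X_convex fun u hu v hv s h0 h1 => ?_
  have hz := Convex.segment_mem hS.X_convex hu hv h0 h1
  set z := u + s • (v - u)
  have key : P.f z ≤ (1 - s) * P.Q u x + s * P.Q v x -
      (1 - s) * s * (P.mu / 2 * ‖v - u‖ ^ 2) - P.r z - P.lam⁻¹ * bregman P.ωX z x := by
    rw [f_eq_fRho_zero]
    refine hS.fRho_le fun y hy => ?_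
    have h2 := StrongConvexOn.segment_le (hS.psiP_strongConvexOn x hy) hu hv h0 h1
    simp only [psiP_eq] at h2
    have h3 := mul_le_mul_of_nonneg_left (hS.le_fRho 0 hu hy) (sub_nonneg.2 h1)
    have h4 := mul_le_mul_of_nonneg_left (hS.le_fRho 0 hv hy) h0
    rw [Q_eq_QRho_zero, Q_eq_QRho_zero]
    simp only [QRho]
    linarith
  have : P.Q z x = P.f z + P.r z + P.lam⁻¹ * bregman P.ωX z x := rfl
  linarith

lemma nearStationary (hD : P.DualSmooth) (hΩ : 0 < P.Omega) {ε η : ℝ} (hε : 0 < ε)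
    (hη : η = ε ^ 2 * P.lam / (64 * P.β ^ 2)) {xk xnext : E} (hxk : xk ∈ P.X)
    (h : P.StepOK η xk xnext) (hshort : ‖xnext - xk‖ ≤ 4 * √(P.lam * η)) :
    P.NearStationary ε xk := by
  have hl := hS.lam_pos
  have hβ := hS.β_pos
  have hη0 : 0 < η := by rw [hη]; positivity
  obtain ⟨p, hp, hmin⟩ := StrongConvexOn.exists_isMinOn hS.X_closed hS.X_nonempty hS.mu_pos
    (hS.Q_strongConvexOn xk) (hS.Q_lowerSemicontinuousOn xk)
  refine ⟨hxk, p, fun p' => ⟨fun hp' => ?_, fun hp' => hp' ▸ ⟨hp, hmin⟩⟩, ?_⟩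
  · exact StrongConvexOn.eq_of_isMinOn hS.mu_pos (hS.Q_strongConvexOn xk) hp hmin hp'.1 hp'.2
  have h1 := StrongConvexOn.growth (hS.Q_strongConvexOn xk) hp hmin h.1.1
  have h2 := hS.Q_le_of_stepOK hD hΩ hη0 h hp
  have hsq : √(P.lam * η) = ε * P.lam / (8 * P.β) := by
    rw [show P.lam * η = (ε * P.lam / (8 * P.β)) ^ 2 by rw [hη]; field_simp; norm_num]
    exact Real.sqrt_sq (by positivity)
  -- Growth gives `μ‖xnext - p‖² ≤ 3η`, below `16 μλη = 8η`. With `√(λη) = ελ/(8β)`, this and the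
  -- short step each use half of `ελ/β`.
  have h3 : ‖xnext - p‖ ≤ 4 * √(P.lam * η) := by
    apply le_of_sq_le_sq₀ _ (by positivity)
    rw [mul_pow, Real.sq_sqrt (by positivity)]
    have h4 : P.mu * (P.lam * η) = η / 2 := by
      have := hS.γ_pos.ne'
      rw [mu_eq, lam]; field_simp
    have h5 : P.mu * ‖xnext - p‖ ^ 2 ≤ P.mu * (4 ^ 2 * (P.lam * η)) := by linarith
    exact le_of_mul_le_mul_left h5 hS.mu_pos
  rw [hsq] at h3 hshort
  rw [← sub_add_sub_cancel xk xnext p]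
  refine (norm_add_le _ _).trans ?_
  rw [norm_sub_rev xk]
  have e : ε * P.lam / P.β = 4 * (ε * P.lam / (8 * P.β)) + 4 * (ε * P.lam / (8 * P.β)) := by
    field_simp; norm_num
  linarith

end NearStationarity

end Standing

/-! ### Length and existence of runs. -/

section Run

variable [FiniteDimensional ℝ E] [FiniteDimensional ℝ F]

omit [FiniteDimensional ℝ E] [FiniteDimensional ℝ F] in
lemma IsRun.mem (hS : P.Standing) {x0 x1 : E} {y0 : F}
    {η : ℝ} {x : ℕ → E} {np nd : ℕ → ℕ} {K : ℕ} (hx1 : x1 ∈ P.X)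
    (h : P.IsRun x0 y0 η x1 x np nd K) {k : ℕ} (hk : 1 ≤ k) (hkK : k ≤ K) : x k ∈ P.X := by
  rcases Nat.lt_or_ge 1 k with h1 | h1
  · obtain ⟨s, rfl⟩ : ∃ s, k = s + 1 := ⟨k - 1, by omega⟩
    obtain ⟨yr, xr, y, np₁, nd₁, n₁, np₂, nd₂, n₂, -, -, -, h4, -, -⟩ :=
      h.step s (by omega) (by omega)
    exact h4.mem hS
  · obtain rfl : k = 1 := by omega
    rw [h.init]; exact hx1

variable (hS : P.Standing) (hD : P.DualSmooth) (hxy : 0 < P.Lxy) (hΩ : 0 < P.Omega)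
include hS hD hxy hΩ

lemma IsRun.q_le {x0 x1 : E} {y0 : F} {η : ℝ} (hη : 0 < η) {x : ℕ → E} {np nd : ℕ → ℕ} {K : ℕ}
    (hx1 : x1 ∈ P.X) (h : P.IsRun x0 y0 η x1 x np nd K) {k : ℕ} (hk : 1 ≤ k) (hkK : k ≤ K) :
    P.q (x k) + 13 / 2 * η * (k - 1) ≤ P.q x1 := by
  induction k, hk using Nat.le_induction with
  | base => simp [h.init]
  | succ k hk ih =>
    have h1 := ih (by omega)
    have h2 := hS.descent_of_long_step hD hΩ hη (h.mem hS hx1 hk (by omega))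
      (hS.stepOK_of_caseIIStep hD hxy hΩ hη (h.step k hk (by omega)))
      (h.continues k hk (by omega))
    push_cast
    linarith

omit [FiniteDimensional ℝ E] [FiniteDimensional ℝ F] hD hxy hΩ in
lemma qStar_le {x : E} (hx : x ∈ P.X) : P.qStar ≤ P.q x :=
  csInf_le hS.q_bddBelow (mem_image_of_mem _ hx)

lemma IsRun.length_le {x0 x1 : E} {y0 : F} {η : ℝ} (hη : 0 < η) {x : ℕ → E} {np nd : ℕ → ℕ}
    {K : ℕ} (hx1 : x1 ∈ P.X) (h : P.IsRun x0 y0 η x1 x np nd K) :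
    13 / 2 * η * (K - 1) ≤ P.q x1 - P.qStar := by
  have h1 := h.q_le hS hD hxy hΩ hη hx1 h.one_le le_rfl
  have h2 := qStar_le hS (h.mem hS hx1 h.one_le le_rfl)
  linarith

/-- Descent also bounds every step length, hence how far the centres can drift. This is needed
because the solver constants involve `∇ωX` at the centre. -/
lemma IsRun.dist_le {x0 x1 : E} {y0 : F} {η : ℝ} (hη : 0 < η) {x : ℕ → E} {np nd : ℕ → ℕ}
    {K : ℕ} (hx1 : x1 ∈ P.X) (h : P.IsRun x0 y0 η x1 x np nd K) {k : ℕ} (hk : 1 ≤ k)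
    (hkK : k ≤ K) :
    ‖x k - x1‖ ≤ (k - 1) * √((P.q x1 - P.qStar + 3 / 2 * η) / P.γ) := by
  induction k, hk using Nat.le_induction with
  | base => simp [h.init]
  | succ k hk ih =>
    have h1 := ih (by omega)
    have hok := hS.stepOK_of_caseIIStep hD hxy hΩ hη (h.step k hk (by omega))
    have h2 := hS.descent hD hΩ hη (h.mem hS hx1 hk (by omega)) hok
    have h3 := h.q_le hS hD hxy hΩ hη hx1 hk (by omega)
    have h4 := qStar_le hS hok.1.1
    have h5 : (0 : ℝ) ≤ 13 / 2 * η * (k - 1) :=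
      mul_nonneg (by positivity) (by rw [sub_nonneg]; exact_mod_cast hk)
    have h6 : ‖x (k + 1) - x k‖ ≤ √((P.q x1 - P.qStar + 3 / 2 * η) / P.γ) := by
      apply Real.le_sqrt_of_sq_le
      rw [le_div_iff₀ hS.γ_pos]
      linarith
    rw [← sub_add_sub_cancel (x (k + 1)) (x k) x1]
    push_cast
    refine (norm_add_le _ _).trans ?_
    linarith

lemma exists_isRun (hT : P.DualTractable) {x0 x1 : E} (hx0 : x0 ∈ P.X) (hx1 : x1 ∈ P.X) {y0 : F}
    (hy0 : y0 ∈ core P.Y P.domY) {η : ℝ} (hη : 0 < η) :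
    ∃ (x : ℕ → E) (np nd : ℕ → ℕ) (K : ℕ), P.IsRun x0 y0 η x1 x np nd K := by
  choose nxt p d hstep using fun xk => hS.exists_caseIIStep hD hT hxy hΩ hx0 hy0 hη xk
  let z : ℕ → E := fun k => nxt^[k] x1
  have hz : ∀ k, z (k + 1) = nxt (z k) := fun k => Function.iterate_succ_apply' _ _ _
  have hok : ∀ k, P.StepOK η (z k) (z (k + 1)) := fun k => by
    rw [hz]; exact hS.stepOK_of_caseIIStep hD hxy hΩ hη (hstep _)
  have hzX : ∀ k, z k ∈ P.X := by
    rintro (_ | k)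
    · exact hx1
    · exact (hok k).1.1
  have hex : ∃ k, ‖z (k + 1) - z k‖ ≤ 4 * √(P.lam * η) := by
    by_contra! hlong
    have hq : ∀ k : ℕ, P.q (z k) + 13 / 2 * η * k ≤ P.q x1 := by
      intro k
      induction k with
      | zero => simp [z]
      | succ k ih =>
        have := hS.descent_of_long_step hD hΩ hη (hzX k) (hok k) (hlong k)
        push_cast
        linarith
    obtain ⟨n, hn⟩ := exists_nat_gt ((P.q x1 - P.qStar) / (13 / 2 * η))
    rw [div_lt_iff₀ (by positivity)] at hn
    have h1 := hq n
    have h2 := qStar_le hS (hzX n)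
    linarith
  classical
  refine ⟨fun k => z (k - 1), fun k => p (z (k - 1)), fun k => d (z (k - 1)), Nat.find hex + 1,
    rfl, by omega, fun k hk _ => ?_, fun k hk hkK => ?_, ?_⟩
  · obtain ⟨s, rfl⟩ : ∃ s, k = s + 1 := ⟨k - 1, by omega⟩
    simp only [Nat.add_sub_cancel, hz]
    exact hstep _
  · obtain ⟨s, rfl⟩ : ∃ s, k = s + 1 := ⟨k - 1, by omega⟩
    simpa using Nat.find_min hex (m := s) (by omega)
  · simpa using Nat.find_spec hex

end Run

end Problem

/-! ### Polynomial growth and complexity -/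

/-- `f` grows at most like `s ^ p`. -/
def PolyBdd {ι : Type*} (s f : ι → ℝ) (p : ℕ) : Prop := ∃ c, ∀ i, |f i| ≤ c * s i ^ p

namespace PolyBdd

variable {ι : Type*} {s f g : ι → ℝ} {p q : ℕ}

lemma const (s : ι → ℝ) (c : ℝ) : PolyBdd s (fun _ => c) 0 := ⟨|c|, fun i => by simp⟩

lemma pos_const (hs : ∀ i, 1 ≤ s i) (hf : PolyBdd s f p) :
    ∃ c, 0 ≤ c ∧ ∀ i, |f i| ≤ c * s i ^ p := by
  obtain ⟨c, hc⟩ := hf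
  refine ⟨|c|, abs_nonneg c, fun i => (hc i).trans ?_⟩
  have : 0 ≤ s i ^ p := pow_nonneg (zero_le_one.trans (hs i)) p
  exact mul_le_mul_of_nonneg_right (le_abs_self c) this

lemma mono (hs : ∀ i, 1 ≤ s i) (hf : PolyBdd s f p) (hpq : p ≤ q) : PolyBdd s f q := by
  obtain ⟨c, hc, h⟩ := hf.pos_const hs
  exact ⟨c, fun i => (h i).trans (mul_le_mul_of_nonneg_left (pow_le_pow_right₀ (hs i) hpq) hc)⟩

lemma add (hs : ∀ i, 1 ≤ s i) (hf : PolyBdd s f p) (hg : PolyBdd s g q) :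
    PolyBdd s (fun i => f i + g i) (max p q) := by
  obtain ⟨c, hc⟩ := hf.mono hs (le_max_left p q)
  obtain ⟨d, hd⟩ := hg.mono hs (le_max_right p q)
  exact ⟨c + d, fun i => (abs_add_le _ _).trans (by linarith [hc i, hd i])⟩

lemma mul (hs : ∀ i, 1 ≤ s i) (hf : PolyBdd s f p) (hg : PolyBdd s g q) :
    PolyBdd s (fun i => f i * g i) (p + q) := by
  obtain ⟨c, hc0, hc⟩ := hf.pos_const hs
  obtain ⟨d, hd0, hd⟩ := hg.pos_const hs
  refine ⟨c * d, fun i => ?_⟩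
  have : 0 ≤ s i := zero_le_one.trans (hs i)
  rw [abs_mul, pow_add, show c * d * (s i ^ p * s i ^ q) = (c * s i ^ p) * (d * s i ^ q) by ring]
  exact mul_le_mul (hc i) (hd i) (abs_nonneg _) (by positivity)

lemma const_mul (hs : ∀ i, 1 ≤ s i) (c : ℝ) (hf : PolyBdd s f p) :
    PolyBdd s (fun i => c * f i) p := by
  have := (const s c).mul hs hf
  rwa [zero_add] at this

lemma of_le (hf0 : ∀ i, 0 ≤ f i) (hfg : ∀ i, f i ≤ g i) (hg : PolyBdd s g p) :
    PolyBdd s f p := by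
  obtain ⟨c, hc⟩ := hg
  exact ⟨c, fun i => by
    rw [abs_of_nonneg (hf0 i)]
    exact ((hfg i).trans (le_abs_self _)).trans (hc i)⟩

/-- One extra power of `s` swallows the coefficient once `s` is large. The factor of the logarithm
then depends only on the degree and not on the problem. -/
lemma log_le (hs : ∀ i, 1 ≤ s i) (hf : PolyBdd s f p) (hf0 : ∀ i, 0 ≤ f i) :
    ∃ c, ∀ i, c ≤ s i → Real.log (2 + 2 * f i) ≤ (p + 1) * Real.log (s i) := by
  obtain ⟨c, hc0, hc⟩ := hf.pos_const hs
  refine ⟨2 + 2 * c, fun i hi => ?_⟩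
  have hs1 := hs i
  have hs0 : 0 < s i := one_pos.trans_le hs1
  have h1 : f i ≤ c * s i ^ p := (le_abs_self _).trans (hc i)
  have h2 : (1 : ℝ) ≤ s i ^ p := one_le_pow₀ hs1
  have h3 : 2 + 2 * f i ≤ s i ^ (p + 1) := by
    rw [pow_succ']
    have := mul_le_mul_of_nonneg_right hi (zero_le_one.trans h2)
    linarith
  have h4 := Real.log_le_log (by linarith [hf0 i]) h3
  rw [Real.log_pow] at h4
  exact_mod_cast h4

end PolyBdd

lemma apgCount_mono {L μ A A' δ : ℝ} (hμ : 0 < μ) (hL : μ ≤ L) (hA : 0 ≤ A) (hAA' : A ≤ A')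
    (hδ : 0 < δ) : apgCount L μ A δ ≤ apgCount L μ A' δ := by
  have := one_le_apgTau hμ hL
  unfold apgCount
  gcongr

lemma one_add_sqrt_le {a : ℝ} (ha : 0 ≤ a) : √a ≤ 1 + a := by
  have := Real.sq_sqrt ha
  nlinarith [sq_nonneg (√a - 1), Real.sqrt_nonneg a]

namespace Problem

variable {E : Type u} {F : Type v} [NormedAddCommGroup E] [NormedSpace ℝ E]
  [NormedAddCommGroup F] [NormedSpace ℝ F] {P : Problem E F}

/-- The accuracy parameter `η` that corresponds to `ε`. -/
noncomputable def etaOf (P : Problem E F) (ε : ℝ) : ℝ := ε ^ 2 * P.lam / (64 * P.β ^ 2)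

/-- The data entering the constants of one proximal step: the target `ε ≤ 1`, a centre at distance
at most `R ε⁻²` from `x1`, and a reference point near the reference solution. -/
structure StepData (P : Problem E F) (x1 : E) (R : ℝ) where
  ε : ℝ
  xk : E
  xr : E
  ε_pos : 0 < ε
  ε_le : ε ≤ 1
  xk_mem : xk ∈ P.X
  xr_mem : xr ∈ P.X
  dist_xk : ‖xk - x1‖ ≤ R * ε⁻¹ ^ 2
  dist_xr : ‖xr - P.xStar xk (P.yStar 1 xk)‖ ≤ 1 / √P.mu * (1 + P.Lxy / √P.mu)

namespace StepData

variable {x1 : E} {R : ℝ}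

/-- The scale `1/ε`. -/
noncomputable def scale (i : StepData P x1 R) : ℝ := i.ε⁻¹

lemma one_le_scale (i : StepData P x1 R) : 1 ≤ i.scale :=
  (one_le_inv₀ i.ε_pos).2 i.ε_le

/-- The accuracy `η`. -/
noncomputable def η (i : StepData P x1 R) : ℝ := P.etaOf i.ε

/-- The smoothing parameter. -/
noncomputable def ρ (i : StepData P x1 R) : ℝ := P.rho i.η

end StepData

/-- A bound on `slope` that is uniform in `y`. -/
noncomputable def slopeMax (P : Problem E F) (x0 : E) (y0 : F) (xk : E) : ℝ :=
  2 * P.γ * ‖fderiv ℝ P.ωX xk‖ + (2 * P.γ * ‖fderiv ℝ P.ωX x0‖ + ‖P.oracleP x0 y0‖ +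
    P.Lxy * Metric.diam P.Y + P.Mr)

/-- A bound on `‖∇π(y0)‖`. -/
noncomputable def dualSlopeMax (P : Problem E F) (x0 : E) (y0 : F) (xk : E) : ℝ :=
  ‖P.oracleD x0 y0‖ + P.Lxy / P.mu * P.slopeMax x0 y0 xk

lemma gradPsiX_le_slopeMax (hS : P.Standing) {x0 : E} (hx0 : x0 ∈ P.X) {y0 y : F} (hy0 : y0 ∈ P.Y)
    (hy : y ∈ P.Y) (xk : E) :
    ‖P.gradPsiX xk x0 y‖ + P.Mr + P.mu * ‖fderiv ℝ P.ωX x0‖ ≤ P.slopeMax x0 y0 xk := by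
  have h1 := hS.lip_xy x0 hx0 y hy y0 hy0
  have h2 := mul_le_mul (le_max_left P.Lxyb P.Lyx) (hS.norm_sub_le_diam hy hy0) (norm_nonneg _)
    hS.Lxy_nonneg
  have e : P.gradPsiX xk x0 y = P.γ • fderiv ℝ P.ωX x0 +
      (P.oracleP x0 y0 + (P.oracleP x0 y - P.oracleP x0 y0)) -
      (2 * P.γ) • fderiv ℝ P.ωX xk := by
    rw [gradPsiX, lam_inv_sub_mu, lam_inv]; abel
  have h3 : ‖P.gradPsiX xk x0 y‖ ≤ P.γ * ‖fderiv ℝ P.ωX x0‖ +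
      (‖P.oracleP x0 y0‖ + ‖P.oracleP x0 y - P.oracleP x0 y0‖) +
      2 * P.γ * ‖fderiv ℝ P.ωX xk‖ := by
    rw [e]
    refine (norm_sub_le _ _).trans ?_
    rw [norm_smul (2 * P.γ), Real.norm_eq_abs, abs_of_pos (by linarith [hS.γ_pos])]
    gcongr
    refine (norm_add_le _ _).trans ?_
    rw [norm_smul, Real.norm_eq_abs, abs_of_pos hS.γ_pos]
    gcongr
    exact norm_add_le _ _
  rw [slopeMax, mu_eq]
  unfold Lxy at *
  linarith

lemma slopeMax_nonneg (hS : P.Standing) (x0 : E) (y0 : F) (xk : E) :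
    0 ≤ P.slopeMax x0 y0 xk := by
  have := hS.γ_pos
  have := hS.Lxy_nonneg
  have := hS.Mr_nonneg
  have := Metric.diam_nonneg (s := P.Y)
  unfold slopeMax
  positivity

lemma dualSlopeMax_nonneg (hS : P.Standing) (x0 : E) (y0 : F) (xk : E) :
    0 ≤ P.dualSlopeMax x0 y0 xk := by
  have := hS.mu_pos
  have := hS.Lxy_nonneg
  have := slopeMax_nonneg hS x0 y0 xk
  unfold dualSlopeMax
  positivity

lemma innerConst_mono (hS : P.Standing) {S S' : ℝ} (h0 : 0 ≤ S) (h : S ≤ S') :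
    P.innerConst S ≤ P.innerConst S' := by
  have := hS.mu_pos
  have := hS.β_pos
  refine apgConst_mono hS.mu_pos hS.Lxx'_pos ?_ h0 h
  gcongr

/-! ### Growth of the starting slopes and of the reference point. -/

section Bounds

variable [FiniteDimensional ℝ E] (hS : P.Standing) {x0 x1 : E} (hx0 : x0 ∈ P.X)
  (hx1 : x1 ∈ P.X) {y0 : F} (hy0 : y0 ∈ P.Y) {R : ℝ}
include hS hx0 hy0

lemma dist_xStar_le_slopeMax (xk : E) {y : F} (hy : y ∈ P.Y) :
    ‖x0 - P.xStar xk y‖ ≤ P.slopeMax x0 y0 xk / P.mu :=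
  (hS.dist_xStar_le hx0 xk hy).trans
    (div_le_div_of_nonneg_right (gradPsiX_le_slopeMax hS hx0 hy0 hy xk) hS.mu_pos.le)

lemma norm_gradPi_le (hD : P.DualSmooth) (xk : E) :
    ‖P.oracleD (P.xStar xk y0) y0‖ ≤ P.dualSlopeMax x0 y0 xk := by
  have h1 := hD.lip_yx _ (hS.xStar_mem xk hy0) x0 hx0 y0 hy0
  have h2 := dist_xStar_le_slopeMax hS hx0 hy0 xk hy0
  have h3 := mul_le_mul (le_max_right P.Lxyb P.Lyx) h2 (norm_nonneg _) hS.Lxy_nonneg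
  rw [norm_sub_rev x0] at h3
  rw [← add_sub_cancel (P.oracleD x0 y0) (P.oracleD (P.xStar xk y0) y0)]
  refine (norm_add_le _ _).trans ?_
  rw [dualSlopeMax]
  have e : P.Lxy / P.mu * P.slopeMax x0 y0 xk = max P.Lxyb P.Lyx * (P.slopeMax x0 y0 xk / P.mu) := by
    rw [Lxy]; ring
  rw [e]
  linarith

include hx1

omit [FiniteDimensional ℝ E] hx0 hy0 in
-- The centre enters only through `∇ωX(x_k)`, which is Lipschitz, and its distance from `x1` is
-- `O(ε⁻²)`; hence degree `2`.
lemma polyBdd_slopeMax (x0 : E) (y0 : F) : PolyBdd (StepData.scale (P := P) (x1 := x1) (R := R))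
    (fun i => P.slopeMax x0 y0 i.xk) 2 := by
  have hs := StepData.one_le_scale (P := P) (x1 := x1) (R := R)
  have h1 : PolyBdd (StepData.scale (P := P) (x1 := x1) (R := R))
      (fun i => ‖fderiv ℝ P.ωX i.xk‖) 2 := by
    refine ⟨‖fderiv ℝ P.ωX x1‖ + P.β * R, fun i => ?_⟩
    rw [abs_norm]
    have h2 := hS.ωX_lip _ i.xk_mem x1 hx1
    have h3 := mul_le_mul_of_nonneg_left i.dist_xk hS.β_pos.le
    have h4 : 1 ≤ i.scale ^ 2 := one_le_pow₀ (hs i)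
    have h5 := mul_le_mul_of_nonneg_left h4 (norm_nonneg (fderiv ℝ P.ωX x1))
    rw [← add_sub_cancel (fderiv ℝ P.ωX x1) (fderiv ℝ P.ωX i.xk)]
    refine (norm_add_le _ _).trans ?_
    simp only [StepData.scale] at *
    linarith
  exact (h1.const_mul hs (2 * P.γ)).add hs (PolyBdd.const _ _)

omit [FiniteDimensional ℝ E] hx0 hy0 in
lemma polyBdd_dualSlopeMax (x0 : E) (y0 : F) :
    PolyBdd (StepData.scale (P := P) (x1 := x1) (R := R))
    (fun i => P.dualSlopeMax x0 y0 i.xk) 2 := by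
  have hs := StepData.one_le_scale (P := P) (x1 := x1) (R := R)
  exact (PolyBdd.const _ _).add hs ((polyBdd_slopeMax hS hx1 x0 y0).const_mul hs _)

omit [FiniteDimensional ℝ E] hx0 hy0 in
lemma polyBdd_innerConst (x0 : E) (y0 : F) :
    PolyBdd (StepData.scale (P := P) (x1 := x1) (R := R))
    (fun i => P.innerConst (P.slopeMax x0 y0 i.xk)) 4 := by
  have hs := StepData.one_le_scale (P := P) (x1 := x1) (R := R)
  have h := polyBdd_slopeMax hS hx1 (R := R) x0 y0
  have h2 := (h.mul hs h).const_mul hs (2 / P.Lxx' + 42 * (P.Lxx' / P.mu) * (3 * P.β / P.mu))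
  refine PolyBdd.of_le (fun i => hS.innerConst_nonneg) (fun i => le_of_eq ?_) h2
  rw [innerConst, apgConst]; ring

omit hx1 in
lemma polyBdd_dist_xr [FiniteDimensional ℝ F] (hx1 : x1 ∈ P.X) (hD : P.DualSmooth) :
    PolyBdd (StepData.scale (P := P) (x1 := x1) (R := R)) (fun i => ‖i.xr - x0‖) 2 := by
  have hs := StepData.one_le_scale (P := P) (x1 := x1) (R := R)
  have h := (polyBdd_slopeMax hS hx1 (R := R) x0 y0).const_mul hs P.mu⁻¹
  refine PolyBdd.of_le (fun i => norm_nonneg _) (fun i => ?_) ((PolyBdd.const _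
    (1 / √P.mu * (1 + P.Lxy / √P.mu))).add hs h)
  have h1 := dist_xStar_le_slopeMax hS hx0 hy0 i.xk (hS.yStar_mem hD 1 i.xk)
  rw [← sub_add_sub_cancel i.xr (P.xStar i.xk (P.yStar 1 i.xk)) x0]
  refine (norm_add_le _ _).trans (add_le_add i.dist_xr ?_)
  rw [norm_sub_rev, inv_mul_eq_div]
  exact h1

end Bounds

/-! ### Growth of `η`, `ρ` and their inverses. -/

section Parameters

variable (hS : P.Standing) (hΩ : 0 < P.Omega) {x1 : E} {R : ℝ}
include hS

lemma etaOf_pos {ε : ℝ} (hε : 0 < ε) : 0 < P.etaOf ε := by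
  have := hS.lam_pos
  have := hS.β_pos
  unfold etaOf
  positivity

lemma etaOf_le {ε : ℝ} (hε : 0 < ε) (hε1 : ε ≤ 1) : P.etaOf ε ≤ P.lam / (64 * P.β ^ 2) := by
  have := hS.lam_pos
  have := hS.β_pos
  have h1 : ε ^ 2 ≤ 1 := pow_le_one₀ hε.le hε1
  have h2 : P.etaOf ε = ε ^ 2 * (P.lam / (64 * P.β ^ 2)) := by unfold etaOf; ring
  rw [h2]
  exact mul_le_of_le_one_left (by positivity) h1

lemma StepData.η_pos (i : StepData P x1 R) : 0 < i.η := etaOf_pos hS i.ε_pos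

lemma polyBdd_inv_η : PolyBdd (StepData.scale (P := P) (x1 := x1) (R := R)) (fun i => i.η⁻¹) 2 := by
  have := hS.lam_pos
  have := hS.β_pos
  refine ⟨64 * P.β ^ 2 / P.lam, fun i => le_of_eq ?_⟩
  have := i.ε_pos
  rw [abs_of_pos (inv_pos.2 (i.η_pos hS)), StepData.η, etaOf, StepData.scale]
  field_simp

include hΩ

lemma StepData.ρ_pos (i : StepData P x1 R) : 0 < i.ρ := rho_pos hΩ (i.η_pos hS)

lemma polyBdd_inv_ρ : PolyBdd (StepData.scale (P := P) (x1 := x1) (R := R)) (fun i => i.ρ⁻¹) 2 := by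
  have h := (polyBdd_inv_η hS (x1 := x1) (R := R)).const_mul StepData.one_le_scale (4 * P.Omega)
  refine PolyBdd.of_le (fun i => (inv_pos.2 (i.ρ_pos hS hΩ)).le) (fun i => le_of_eq ?_) h
  have := i.η_pos hS
  rw [StepData.ρ, rho]; field_simp

lemma polyBdd_ρ : PolyBdd (StepData.scale (P := P) (x1 := x1) (R := R)) (fun i => i.ρ) 0 := by
  refine PolyBdd.of_le (fun i => (i.ρ_pos hS hΩ).le) (fun i => ?_)
    (PolyBdd.const _ (P.lam / (64 * P.β ^ 2) / (4 * P.Omega)))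
  have := etaOf_le hS i.ε_pos i.ε_le
  rw [StepData.ρ, rho, StepData.η]
  gcongr

end Parameters

/-! ### Growth of the inverse accuracies and of the dual constants. -/

section Accuracies

variable [FiniteDimensional ℝ E] [FiniteDimensional ℝ F] (hS : P.Standing) (hD : P.DualSmooth)
  (hxy : 0 < P.Lxy) (hΩ : 0 < P.Omega) {x0 x1 : E} (hx0 : x0 ∈ P.X) (hx1 : x1 ∈ P.X) {y0 : F}
  (hy0 : y0 ∈ P.Y) {R : ℝ}
include hS hΩ

omit [FiniteDimensional ℝ E] [FiniteDimensional ℝ F] in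
lemma polyBdd_Lrho' : PolyBdd (StepData.scale (P := P) (x1 := x1) (R := R))
    (fun i => P.Lrho' i.ρ) 2 :=
  (PolyBdd.const _ _).add StepData.one_le_scale
    ((polyBdd_inv_ρ hS hΩ).const_mul StepData.one_le_scale _)

omit [FiniteDimensional ℝ E] [FiniteDimensional ℝ F] in
lemma polyBdd_refDist : PolyBdd (StepData.scale (P := P) (x1 := x1) (R := R))
    (fun i => P.refDist i.ρ) 0 := by
  have hs := StepData.one_le_scale (P := P) (x1 := x1) (R := R)
  have h1 : PolyBdd (StepData.scale (P := P) (x1 := x1) (R := R)) (fun i => √i.ρ) 0 :=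
    PolyBdd.of_le (fun i => Real.sqrt_nonneg _) (fun i => one_add_sqrt_le (i.ρ_pos hS hΩ).le)
      ((PolyBdd.const _ 1).add hs (polyBdd_ρ hS hΩ))
  exact ((PolyBdd.const _ _).add hs
    (((PolyBdd.const _ 1).add hs h1).const_mul hs (2 * √P.Omega))).const_mul hs (1 / √P.mu)

omit [FiniteDimensional ℝ E] [FiniteDimensional ℝ F] in
lemma polyBdd_Ldual : PolyBdd (StepData.scale (P := P) (x1 := x1) (R := R))
    (fun i => P.Ldual i.ρ) 0 := by
  refine PolyBdd.of_le (fun i => (i.ρ_pos hS hΩ).le.trans (P.le_Ldual _)) (fun i => ?_)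
    ((PolyBdd.const _ |P.Lpi|).add StepData.one_le_scale (polyBdd_ρ hS hΩ))
  have := i.ρ_pos hS hΩ
  exact max_le (by linarith [le_abs_self P.Lpi]) (by linarith [abs_nonneg P.Lpi])

include hx0 hx1 hy0 hD

lemma polyBdd_boundF : PolyBdd (StepData.scale (P := P) (x1 := x1) (R := R))
    (fun i => P.boundF i.ρ i.xk i.xr) 2 := by
  have hs := StepData.one_le_scale (P := P) (x1 := x1) (R := R)
  have h1 := polyBdd_slopeMax hS hx1 (R := R) x0 y0
  have h2 := (polyBdd_dist_xr hS hx0 hy0 (R := R) hx1 hD).const_mul hs P.Lxx'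
  have h3 : PolyBdd (StepData.scale (P := P) (x1 := x1) (R := R))
      (fun i => sSup ((fun y => ‖P.gradPsiX i.xk i.xr y‖) '' P.Y)) 2 := by
    refine PolyBdd.of_le (fun i => Real.sSup_nonneg ?_) (fun i => csSup_le
      (hS.Y_nonempty.image _) ?_) (h1.add hs h2)
    · rintro _ ⟨y, -, rfl⟩
      exact norm_nonneg _
    · rintro _ ⟨y, hy, rfl⟩
      have h4 := gradPsiX_le_slopeMax hS hx0 hy0 hy i.xk
      have h5 := hS.gradPsiX_lip i.xk hy _ i.xr_mem x0 hx0
      have h6 : 0 ≤ P.mu * ‖fderiv ℝ P.ωX x0‖ := mul_nonneg hS.mu_pos.le (norm_nonneg _)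
      have h7 := hS.Mr_nonneg
      simp only
      rw [← add_sub_cancel (P.gradPsiX i.xk x0 y) (P.gradPsiX i.xk i.xr y)]
      exact (norm_add_le _ _).trans (by linarith)
  have h4 : PolyBdd (StepData.scale (P := P) (x1 := x1) (R := R))
      (fun i => √(i.ρ * P.Omega / P.mu)) 0 := by
    simp only [mul_div_assoc]
    refine PolyBdd.of_le (fun i => Real.sqrt_nonneg _) (fun i => one_add_sqrt_le ?_)
      ((PolyBdd.const _ 1).add hs ((polyBdd_ρ hS hΩ).mul hs (PolyBdd.const _ (P.Omega / P.mu))))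
    have := i.ρ_pos hS hΩ
    have := hS.mu_pos
    positivity
  have h5 := ((polyBdd_Lrho' hS hΩ (x1 := x1) (R := R)).const_mul hs 2).mul hs h4
  exact (((PolyBdd.const _ (P.Lxy * Metric.diam P.Y)).add hs h3).add hs
    (PolyBdd.const _ (P.Lxx' / √P.mu * (1 + P.Lxy / √P.mu + 2 * √P.Omega)))).add hs h5

lemma polyBdd_boundOmega : PolyBdd (StepData.scale (P := P) (x1 := x1) (R := R))
    (fun i => P.boundOmega i.ρ i.xr) 2 := by
  have hs := StepData.one_le_scale (P := P) (x1 := x1) (R := R)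
  have h1 := (polyBdd_dist_xr hS hx0 hy0 (R := R) hx1 hD).const_mul hs P.β
  have h2 : PolyBdd (StepData.scale (P := P) (x1 := x1) (R := R))
      (fun i => ‖fderiv ℝ P.ωX i.xr‖) 2 := by
    refine PolyBdd.of_le (fun i => norm_nonneg _) (fun i => ?_)
      ((PolyBdd.const _ ‖fderiv ℝ P.ωX x0‖).add hs h1)
    have h3 := hS.ωX_lip _ i.xr_mem x0 hx0
    rw [← add_sub_cancel (fderiv ℝ P.ωX x0) (fderiv ℝ P.ωX i.xr)]
    exact (norm_add_le _ _).trans (by linarith)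
  have h4 := h2.add hs ((polyBdd_refDist hS hΩ (x1 := x1) (R := R)).const_mul hs P.β)
  simp only [boundOmega_eq]
  exact h4

lemma polyBdd_inv_accMin : PolyBdd (StepData.scale (P := P) (x1 := x1) (R := R))
    (fun i => (P.accMin i.ρ i.η i.xk i.xr)⁻¹) 6 := by
  have hs := StepData.one_le_scale (P := P) (x1 := x1) (R := R)
  have h1 := ((polyBdd_boundF hS hD hΩ hx0 hx1 hy0 (R := R)).add hs (PolyBdd.const _ P.Mr)).add hs
    ((polyBdd_boundOmega hS hD hΩ hx0 hx1 hy0 (R := R)).const_mul hs P.mu)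
  have h2 := ((h1.mul hs h1).const_mul hs 8).mul hs (polyBdd_inv_η hS)
  have h3 := (polyBdd_Lrho' hS hΩ (x1 := x1) (R := R)).add hs (PolyBdd.const _ (P.mu * P.β))
  refine PolyBdd.of_le (fun i => (inv_pos.2 (hS.accMin_pos (i.ρ_pos hS hΩ) (i.η_pos hS) _ _)).le)
    (fun i => ?_) (h2.add hs h3)
  have hT := hS.slopeBound_pos (i.ρ_pos hS hΩ) i.xk i.xr
  have hC := hS.curvature_pos (i.ρ_pos hS hΩ)
  have hη := i.η_pos hS
  set T := P.boundF i.ρ i.xk i.xr + P.Mr + P.mu * P.boundOmega i.ρ i.xr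
  have hTT : 0 < 8 * (T * T) * i.η⁻¹ := by positivity
  -- The inverse of a minimum is at most the sum of the inverses; the same device is used for `ε₃`.
  rw [accMin, inv_le_comm₀ (lt_min (by positivity) (by positivity)) (by positivity)]
  refine le_min ?_ ?_
  · rw [inv_le_comm₀ (by positivity) (by positivity)]
    have : (i.η / (8 * T ^ 2))⁻¹ = 8 * (T * T) * i.η⁻¹ := by rw [inv_div]; ring
    rw [this]; linarith
  · rw [one_div]
    exact inv_anti₀ hC (by linarith)

include hxy

lemma polyBdd_inv_eps3 : PolyBdd (StepData.scale (P := P) (x1 := x1) (R := R))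
    (fun i => (P.eps3 i.ρ i.η i.xk i.xr)⁻¹) 10 := by
  have hs := StepData.one_le_scale (P := P) (x1 := x1) (R := R)
  have hμ := hS.mu_pos
  have h1 := (((polyBdd_inv_η hS (x1 := x1) (R := R)).mul hs (polyBdd_inv_ρ hS hΩ)).mul hs
    (polyBdd_inv_accMin hS hD hΩ hx0 hx1 hy0 (R := R))).const_mul hs (64 * P.Lxy ^ 2 / P.mu ^ 2)
  have h2 := (polyBdd_inv_η hS (x1 := x1) (R := R)).const_mul hs 4
  refine PolyBdd.of_le (fun i => (inv_pos.2 (hS.eps3_pos hxy (i.ρ_pos hS hΩ) (i.η_pos hS) _ _)).le)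
    (fun i => ?_) (h1.add hs h2)
  have hη := i.η_pos hS
  have hρ := i.ρ_pos hS hΩ
  have hm := hS.accMin_pos hρ hη i.xk i.xr
  set m := P.accMin i.ρ i.η i.xk i.xr with hm'
  rw [eps3, ← hm', inv_le_comm₀ (lt_min (by positivity) (by positivity)) (by positivity)]
  refine le_min ?_ ?_
  · rw [inv_le_comm₀ (by positivity) (by positivity)]
    have e : (i.η * P.mu ^ 2 * i.ρ / (64 * P.Lxy ^ 2) * m)⁻¹ =
      64 * P.Lxy ^ 2 / P.mu ^ 2 * (i.η⁻¹ * i.ρ⁻¹ * m⁻¹) := by field_simp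
    rw [e]
    have : 0 ≤ 4 * i.η⁻¹ := by positivity
    linarith
  · rw [inv_le_comm₀ (by positivity) (by positivity)]
    have e : (i.η / 4)⁻¹ = 4 * i.η⁻¹ := by field_simp
    rw [e]
    have : 0 ≤ 64 * P.Lxy ^ 2 / P.mu ^ 2 * (i.η⁻¹ * i.ρ⁻¹ * m⁻¹) := by positivity
    linarith

omit hxy in
lemma polyBdd_inv_eps4 : PolyBdd (StepData.scale (P := P) (x1 := x1) (R := R))
    (fun i => (P.eps4 i.ρ i.η i.xk i.xr)⁻¹) 8 := by
  have hs := StepData.one_le_scale (P := P) (x1 := x1) (R := R)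
  have hμ := hS.mu_pos
  have h1 := ((polyBdd_inv_η hS (x1 := x1) (R := R)).mul hs
    (polyBdd_inv_accMin hS hD hΩ hx0 hx1 hy0 (R := R))).const_mul hs (64 / P.mu)
  refine PolyBdd.of_le (fun i => (inv_pos.2 (hS.eps4_pos (i.ρ_pos hS hΩ) (i.η_pos hS) _ _)).le)
    (fun i => le_of_eq ?_) h1
  have hη := i.η_pos hS
  have hm := hS.accMin_pos (i.ρ_pos hS hΩ) hη i.xk i.xr
  rw [eps4]
  field_simp

lemma polyBdd_inv_delta2 : PolyBdd (StepData.scale (P := P) (x1 := x1) (R := R))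
    (fun i => (P.delta2 i.ρ (P.eps3 i.ρ i.η i.xk i.xr))⁻¹) 16 := by
  have hs := StepData.one_le_scale (P := P) (x1 := x1) (R := R)
  have hμ := hS.mu_pos
  have hL := polyBdd_Ldual hS hΩ (x1 := x1) (R := R)
  have hρi := polyBdd_inv_ρ hS hΩ (x1 := x1) (R := R)
  have h1 := (PolyBdd.const _ 1).add hs hL
  have h2 := ((PolyBdd.const _ 1).add hs (hL.mul hs hρi)).const_mul hs 2
  have h3 := hρi.mul hs ((PolyBdd.const _ 1).add hs hρi)
  have h4 := ((((polyBdd_inv_eps3 hS hD hxy hΩ hx0 hx1 hy0 (R := R)).mul hs h1).mul hs h2).mul hs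
    h3).const_mul hs (392 * P.Lxy ^ 2 / P.mu)
  refine PolyBdd.of_le (fun i => (inv_pos.2 (delta2_pos hS hxy (i.ρ_pos hS hΩ)
    (hS.eps3_pos hxy (i.ρ_pos hS hΩ) (i.η_pos hS) _ _))).le) (fun i => ?_) h4
  have hρ := i.ρ_pos hS hΩ
  have hδ := hS.eps3_pos hxy hρ (i.η_pos hS) i.xk i.xr
  have hL0 : 0 < P.Ldual i.ρ := hρ.trans_le (P.le_Ldual _)
  set δ := P.eps3 i.ρ i.η i.xk i.xr
  set Ld := P.Ldual i.ρ with hLd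
  have e1 : i.ρ ^ (3 / 2 : ℝ) = i.ρ * √i.ρ := by
    rw [show (3 / 2 : ℝ) = 1 + 1 / 2 by norm_num, Real.rpow_add hρ, Real.rpow_one,
      ← Real.sqrt_eq_rpow]
  have e2 : (14 * √2) ^ 2 = (392 : ℝ) := by
    rw [mul_pow, Real.sq_sqrt (by norm_num)]; norm_num
  have hsρ : 0 < √i.ρ := Real.sqrt_pos.2 hρ
  rw [delta2, e1, e2, ← hLd]
  have e3 : (δ * P.mu * (i.ρ * √i.ρ) / (392 * P.Lxy ^ 2 * √Ld * (1 + √(Ld / i.ρ)) ^ 2))⁻¹ =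
      392 * P.Lxy ^ 2 / P.mu * (δ⁻¹ * √Ld * (1 + √(Ld / i.ρ)) ^ 2 * (i.ρ⁻¹ * (√i.ρ)⁻¹)) := by
    rw [inv_div]; field_simp
  rw [e3]
  -- Square roots are traded for integer powers, which wastes some degree but keeps it absolute.
  have h5 : (1 + √(Ld / i.ρ)) ^ 2 ≤ 2 * (1 + Ld * i.ρ⁻¹) := by
    have := Real.sq_sqrt (by positivity : 0 ≤ Ld / i.ρ)
    rw [← div_eq_mul_inv]
    nlinarith [sq_nonneg (1 - √(Ld / i.ρ))]
  have h6 : (√i.ρ)⁻¹ ≤ 1 + i.ρ⁻¹ := by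
    rw [← Real.sqrt_inv]
    exact one_add_sqrt_le (inv_pos.2 hρ).le
  have h7 := one_add_sqrt_le hL0.le
  gcongr

omit hy0 hx0 hD [FiniteDimensional ℝ E] in
lemma polyBdd_dualConst (x0 : E) (y0 : F) : PolyBdd (StepData.scale (P := P) (x1 := x1) (R := R))
    (fun i => P.dualConst y0 i.ρ (P.eps3 i.ρ i.η i.xk i.xr) (P.dualSlopeMax x0 y0 i.xk)) 6 := by
  have hs := StepData.one_le_scale (P := P) (x1 := x1) (R := R)
  have hρ0 := polyBdd_ρ hS hΩ (x1 := x1) (R := R)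
  have hρi := polyBdd_inv_ρ hS hΩ (x1 := x1) (R := R)
  have hL := polyBdd_Ldual hS hΩ (x1 := x1) (R := R)
  have hG := polyBdd_dualSlopeMax hS hx1 (R := R) x0 y0
  have h1 := ((hG.mul hs (PolyBdd.const _ (Metric.diam P.Y))).add hs
    (PolyBdd.const _ (P.Mg * Metric.diam P.Y))).add hs
    (hρ0.mul hs (PolyBdd.const _ (4 * P.Omega + ‖fderiv ℝ P.ωY y0‖ * Metric.diam P.Y))) |>.add hs
    (PolyBdd.const _ (P.lam / (64 * P.β ^ 2) / 4))
  have h2 := ((hG.mul hs hG).mul hs hρi).const_mul hs 2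
  have h3 := ((hL.mul hs hρi).const_mul hs 42).mul hs h1
  refine PolyBdd.of_le (fun i => hS.dualConst_nonneg (i.ρ_pos hS hΩ) (hS.eps3_pos hxy
    (i.ρ_pos hS hΩ) (i.η_pos hS) _ _) (dualSlopeMax_nonneg hS x0 y0 i.xk)) (fun i => ?_)
    (h2.add hs h3)
  have hρ := i.ρ_pos hS hΩ
  have hL0 : 0 < P.Ldual i.ρ := hρ.trans_le (P.le_Ldual _)
  have hε3 : P.eps3 i.ρ i.η i.xk i.xr ≤ P.lam / (64 * P.β ^ 2) / 4 :=
    (min_le_right _ _).trans (div_le_div_of_nonneg_right (etaOf_le hS i.ε_pos i.ε_le) (by norm_num))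
  have hG0 := dualSlopeMax_nonneg hS x0 y0 i.xk
  rw [dualConst, apgConst, mul_div_assoc, div_eq_mul_inv (_ ^ 2), div_eq_mul_inv (P.Ldual i.ρ),
    pow_two]
  have h5 : (P.Ldual i.ρ)⁻¹ ≤ i.ρ⁻¹ := inv_anti₀ hρ (P.le_Ldual _)
  gcongr

omit hy0 hx0 hxy hΩ hD [FiniteDimensional ℝ E] [FiniteDimensional ℝ F] in
lemma polyBdd_dualConst_one (x0 : E) (y0 : F) :
    PolyBdd (StepData.scale (P := P) (x1 := x1) (R := R))
    (fun i => P.dualConst y0 1 (1 / 2) (P.dualSlopeMax x0 y0 i.xk)) 4 := by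
  have hs := StepData.one_le_scale (P := P) (x1 := x1) (R := R)
  have hG := polyBdd_dualSlopeMax hS hx1 (R := R) x0 y0
  have h1 := (hG.mul hs (PolyBdd.const _ (Metric.diam P.Y))).add hs
    (PolyBdd.const _ (P.Mg * Metric.diam P.Y +
      1 * (4 * P.Omega + ‖fderiv ℝ P.ωY y0‖ * Metric.diam P.Y) + 1 / 2))
  have h2 := ((hG.mul hs hG).const_mul hs (2 / P.Ldual 1)).add hs
    (h1.const_mul hs (42 * (P.Ldual 1 / 1)))
  have e : (fun i : StepData P x1 R => P.dualConst y0 1 (1 / 2) (P.dualSlopeMax x0 y0 i.xk)) =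
      fun i => 2 / P.Ldual 1 * (P.dualSlopeMax x0 y0 i.xk * P.dualSlopeMax x0 y0 i.xk) +
        42 * (P.Ldual 1 / 1) * (P.dualSlopeMax x0 y0 i.xk * Metric.diam P.Y +
          (P.Mg * Metric.diam P.Y +
            1 * (4 * P.Omega + ‖fderiv ℝ P.ωY y0‖ * Metric.diam P.Y) + 1 / 2)) :=
    funext fun i => by rw [dualConst, apgConst]; ring
  rw [e]
  exact h2.mono hs (by norm_num)

end Accuracies

end Problem

lemma apgCount_le_log {ι : Type*} {s A δ L μ : ι → ℝ} {p q n : ℕ} (hs : ∀ i, 1 ≤ s i)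
    (hA : PolyBdd s A p) (hδ : PolyBdd s (fun i => (δ i)⁻¹) q) (hA0 : ∀ i, 0 ≤ A i)
    (hδ0 : ∀ i, 0 < δ i) (hμ : ∀ i, 0 < μ i) (hL : ∀ i, μ i ≤ L i) (hn : p + q + 1 ≤ n) :
    ∃ c, ∀ i, c ≤ s i →
      apgCount (L i) (μ i) (A i) (δ i) ≤ 2 * n * ((1 + apgTau (L i) (μ i)) * Real.log (s i)) := by
  obtain ⟨c, hc⟩ := (hA.mul hs hδ).log_le hs fun i => mul_nonneg (hA0 i) (inv_pos.2 (hδ0 i)).le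
  refine ⟨c, fun i hi => ?_⟩
  have h1 := hc i hi
  have h2 := one_le_apgTau (hμ i) (hL i)
  have h3 := Real.log_nonneg (hs i)
  have h4 : ((p + q : ℕ) : ℝ) + 1 ≤ n := by exact_mod_cast hn
  have h5 := h1.trans (mul_le_mul_of_nonneg_right h4 h3)
  rw [apgCount, mul_div_assoc, div_eq_mul_inv]
  have h6 := mul_le_mul_of_nonneg_left h5 (by linarith : 0 ≤ 2 * (1 + apgTau (L i) (μ i)))
  linarith

namespace Problem

variable {E : Type u} {F : Type v} [NormedAddCommGroup E] [NormedSpace ℝ E]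
  [NormedAddCommGroup F] [NormedSpace ℝ F] {P : Problem E F}

/-! ### Oracle calls of one step. -/

section Counts

variable [FiniteDimensional ℝ E] [FiniteDimensional ℝ F] (hS : P.Standing) (hD : P.DualSmooth)
  (hxy : 0 < P.Lxy) (hΩ : 0 < P.Omega) {x0 x1 : E} (hx0 : x0 ∈ P.X) (hx1 : x1 ∈ P.X) {y0 : F}
  (hy0 : y0 ∈ P.Y) (R : ℝ)

omit [FiniteDimensional ℝ E] [FiniteDimensional ℝ F] in
include hS hx0 hx1 hy0 in
-- The constant is `42 = 2·21` with `21 = 4 + 16 + 1`: degree `4` for the starting constant, `16`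
-- for the worst inverse accuracy (that of `δ₂`), and one for the coefficient.
lemma inner_apgCount_le {δ : StepData P x1 R → ℝ} (hδ0 : ∀ i, 0 < δ i)
    (hδ : PolyBdd StepData.scale (fun i => (δ i)⁻¹) 16) : ∃ c, ∀ i : StepData P x1 R,
      c ≤ i.scale → ∀ y ∈ P.Y, apgCount P.Lxx' P.mu (P.innerConst (P.slope x0 i.xk y)) (δ i) ≤
        42 * ((1 + apgTau P.Lxx' P.mu) * Real.log i.scale) := by
  obtain ⟨c, hc⟩ := apgCount_le_log (L := fun _ => P.Lxx') (μ := fun _ => P.mu) (n := 21)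
    StepData.one_le_scale (polyBdd_innerConst hS hx1 (R := R) x0 y0) hδ
    (fun i => hS.innerConst_nonneg) hδ0 (fun _ => hS.mu_pos) (fun _ => hS.mu_le_Lxx')
    (by norm_num)
  refine ⟨c, fun i hi y hy => ?_⟩
  have h1 := apgCount_mono hS.mu_pos hS.mu_le_Lxx' hS.innerConst_nonneg (innerConst_mono hS
    (hS.slope_nonneg x0 i.xk y) (gradPsiX_le_slopeMax hS hx0 hy0 hy i.xk)) (hδ0 i)
  refine (h1.trans (hc i hi)).trans (le_of_eq ?_)
  norm_num

include hS hD hxy hΩ hx0 hx1 hy0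

lemma eventually_apgCount_le : ∃ c, ∀ i : StepData P x1 R, c ≤ i.scale →
    (∀ y ∈ P.Y, apgCount P.Lxx' P.mu (P.innerConst (P.slope x0 i.xk y)) (P.delta2 1 (1 / 2)) ≤
      42 * ((1 + apgTau P.Lxx' P.mu) * Real.log i.scale)) ∧
    (∀ y ∈ P.Y, apgCount P.Lxx' P.mu (P.innerConst (P.slope x0 i.xk y)) (1 / 2) ≤
      42 * ((1 + apgTau P.Lxx' P.mu) * Real.log i.scale)) ∧
    (∀ y ∈ P.Y, apgCount P.Lxx' P.mu (P.innerConst (P.slope x0 i.xk y))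
        (P.delta2 i.ρ (P.eps3 i.ρ i.η i.xk i.xr)) ≤
      42 * ((1 + apgTau P.Lxx' P.mu) * Real.log i.scale)) ∧
    (∀ y ∈ P.Y, apgCount P.Lxx' P.mu (P.innerConst (P.slope x0 i.xk y))
        (P.eps4 i.ρ i.η i.xk i.xr) ≤
      42 * ((1 + apgTau P.Lxx' P.mu) * Real.log i.scale)) ∧
    apgCount (P.Ldual 1) 1 (P.dualConst y0 1 (1 / 2) (P.dualSlopeMax x0 y0 i.xk)) (1 / 2) ≤
      42 * ((1 + apgTau (P.Ldual 1) 1) * Real.log i.scale) ∧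
    apgCount (P.Ldual i.ρ) i.ρ (P.dualConst y0 i.ρ (P.eps3 i.ρ i.η i.xk i.xr)
        (P.dualSlopeMax x0 y0 i.xk)) (P.eps3 i.ρ i.η i.xk i.xr) ≤
      42 * ((1 + apgTau (P.Ldual i.ρ) i.ρ) * Real.log i.scale) := by
  have hs := StepData.one_le_scale (P := P) (x1 := x1) (R := R)
  have hε3 : ∀ i : StepData P x1 R, 0 < P.eps3 i.ρ i.η i.xk i.xr := fun i =>
    hS.eps3_pos hxy (i.ρ_pos hS hΩ) (i.η_pos hS) _ _
  obtain ⟨c1, h1⟩ := inner_apgCount_le hS hx0 hx1 hy0 R (fun _ => delta2_pos hS hxy one_pos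
    (one_half_pos (α := ℝ))) ((PolyBdd.const _ _).mono hs (by norm_num))
  obtain ⟨c2, h2⟩ := inner_apgCount_le hS hx0 hx1 hy0 R (fun _ => one_half_pos (α := ℝ))
    ((PolyBdd.const _ _).mono hs (by norm_num))
  obtain ⟨c3, h3⟩ := inner_apgCount_le hS hx0 hx1 hy0 R
    (fun i => delta2_pos hS hxy (i.ρ_pos hS hΩ) (hε3 i))
    (polyBdd_inv_delta2 hS hD hxy hΩ hx0 hx1 hy0)
  obtain ⟨c4, h4⟩ := inner_apgCount_le hS hx0 hx1 hy0 R
    (fun i => hS.eps4_pos (i.ρ_pos hS hΩ) (i.η_pos hS) i.xk i.xr)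
    ((polyBdd_inv_eps4 hS hD hΩ hx0 hx1 hy0).mono hs (by norm_num))
  obtain ⟨c5, h5⟩ := apgCount_le_log (L := fun _ => P.Ldual 1) (μ := fun _ => (1 : ℝ)) (n := 21)
    hs (polyBdd_dualConst_one hS hx1 (R := R) x0 y0) (PolyBdd.const _ (1 / 2)⁻¹)
    (fun i => hS.dualConst_nonneg one_pos one_half_pos (dualSlopeMax_nonneg hS x0 y0 i.xk))
    (fun _ => one_half_pos (α := ℝ)) (fun _ => one_pos) (fun _ => P.le_Ldual 1) (by norm_num)
  obtain ⟨c6, h6⟩ := apgCount_le_log (L := fun i : StepData P x1 R => P.Ldual i.ρ)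
    (μ := fun i => i.ρ) (n := 21)
    hs (polyBdd_dualConst hS hxy hΩ hx1 (R := R) x0 y0)
    (polyBdd_inv_eps3 hS hD hxy hΩ hx0 hx1 hy0)
    (fun i => hS.dualConst_nonneg (i.ρ_pos hS hΩ) (hε3 i) (dualSlopeMax_nonneg hS x0 y0 i.xk))
    hε3 (fun i => i.ρ_pos hS hΩ) (fun i => P.le_Ldual i.ρ) (by norm_num)
  norm_num at h5 h6
  refine ⟨max c1 (max c2 (max c3 (max c4 (max c5 c6)))), fun i hi => ?_⟩
  simp only [max_le_iff] at hi
  obtain ⟨i1, i2, i3, i4, i5, i6⟩ := hi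
  refine ⟨h1 i i1, h2 i i2, h3 i i3, h4 i i4, ?_, h6 i i6⟩
  simpa using h5 i i5

/-- Oracle calls of one proximal step. -/
lemma caseIIStep_count (hT : P.DualTractable) (hy0' : y0 ∈ core P.Y P.domY) :
    ∃ c, ∀ ε : ℝ, 0 < ε → ε ≤ 1 → c ≤ ε⁻¹ → ∀ xk ∈ P.X, ‖xk - x1‖ ≤ R * ε⁻¹ ^ 2 →
      ∀ (xnext : E) (np nd : ℕ), P.CaseIIStep x0 y0 (P.etaOf ε) xk xnext np nd →
        (nd : ℝ) ≤ 43 * ((1 + apgTau (P.Ldual 1) 1) * Real.log ε⁻¹) +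
          43 * ((1 + apgTau (P.Ldual (P.rho (P.etaOf ε))) (P.rho (P.etaOf ε))) *
            Real.log ε⁻¹) ∧
        (np : ℝ) ≤ (nd + 2) * (43 * ((1 + apgTau P.Lxx' P.mu) * Real.log ε⁻¹)) := by
  obtain ⟨c, hc⟩ := eventually_apgCount_le hS hD hxy hΩ hx0 hx1 hy0 R
  -- `ε⁻¹ ≥ 3 > e` makes the logarithm at least `1`, so the final iteration of each solver is
  -- absorbed by raising `42` to `43`.
  refine ⟨max c 3, fun ε hε hε1 hcε xk hxk hdist xnext np nd hstep => ?_⟩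
  rw [max_le_iff] at hcε
  obtain ⟨yr, xr, y, np₁, nd₁, n₁, np₂, nd₂, n₂, h1, h2, h3, h4, rfl, rfl⟩ := hstep
  obtain ⟨hc1, hc2, hc3, hc4, hc5, hc6⟩ := hc ⟨ε, xk, xr, hε, hε1, hxk, h2.mem hS, hdist,
    hS.dist_reference_one hD h1 h2⟩ hcε.1
  have hη := etaOf_pos hS hε
  have hρ := rho_pos hΩ hη
  simp only [StepData.scale, StepData.ρ, StepData.η] at hc1 hc2 hc3 hc4 hc5 hc6
  have hℓ : 1 ≤ Real.log ε⁻¹ := by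
    rw [Real.le_log_iff_exp_le (inv_pos.2 hε)]
    exact Real.exp_one_lt_three.le.trans hcε.2
  set ℓ := Real.log ε⁻¹
  have hε3 := hS.eps3_pos hxy hρ hη xk xr
  have hyr := hS.dualSolve_mem one_pos h1
  have hy := hS.dualSolve_mem hρ h3
  have hG := norm_gradPi_le hS hx0 hy0 hD xk
  have hτx := one_le_apgTau hS.mu_pos hS.mu_le_Lxx'
  have hτ1 := one_le_apgTau one_pos (P.le_Ldual 1)
  have hτρ := one_le_apgTau hρ (P.le_Ldual (P.rho (P.etaOf ε)))
  have k1 := hS.dualSolve_count hD hT hxy hy0' one_pos one_half_pos hG h1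
  have k3 := hS.dualSolve_count hD hT hxy hy0' hρ hε3 hG h3
  have k2 := hS.innerSolve_count hx0 hyr one_half_pos h2
  have k4 := hS.innerSolve_count hx0 hy (hS.eps4_pos hρ hη xk xr) h4
  have hxℓ : 1 ≤ (1 + apgTau P.Lxx' P.mu) * ℓ := by nlinarith
  have h1ℓ : 1 ≤ (1 + apgTau (P.Ldual 1) 1) * ℓ := by nlinarith
  have hρℓ : 1 ≤ (1 + apgTau (P.Ldual (P.rho (P.etaOf ε))) (P.rho (P.etaOf ε))) * ℓ := by
    nlinarith
  have m1 := hS.dualSolve_primal_count hxy hx0 hy0' one_pos one_half_pos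
    (c := 43 * ((1 + apgTau P.Lxx' P.mu) * ℓ)) (fun y hy => by linarith [hc1 y hy]) h1
  have m3 := hS.dualSolve_primal_count hxy hx0 hy0' hρ hε3
    (c := 43 * ((1 + apgTau P.Lxx' P.mu) * ℓ)) (fun y hy => by linarith [hc3 y hy]) h3
  have k2' := hc2 _ hyr
  have k4' := hc4 _ hy
  push_cast
  constructor
  · linarith
  · linarith

end Counts

/-! #### The leading constants -/

section Constants

variable (hS : P.Standing) (hD : P.DualSmooth)
include hS

lemma one_add_apgTau_primal_le : 1 + apgTau P.Lxx' P.mu ≤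
    4 * P.β * √(P.γ * (P.Lxx + P.γ)) / P.γ := by
  have hγ := hS.γ_pos
  have hL := hS.γ_le
  have hβ := hS.one_le_β
  have h1 := one_le_apgTau hS.mu_pos hS.mu_le_Lxx'
  have h2 : apgTau P.Lxx' P.mu ≤ 2 * P.β * √(P.γ * (P.Lxx + P.γ)) / P.γ := by
    rw [apgTau, Real.sqrt_le_iff]
    refine ⟨by positivity, ?_⟩
    rw [div_pow, mul_pow, Real.sq_sqrt (by nlinarith), mu_eq, Lxx', lam_inv]
    have e : (2 * P.β) ^ 2 * (P.γ * (P.Lxx + P.γ)) / P.γ ^ 2 =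
      (2 * P.β) ^ 2 * (P.Lxx + P.γ) / P.γ := by field_simp
    rw [e]
    gcongr
    have h3 : P.Lxx ≤ P.Lxx * (4 * P.β ^ 2) := by
      apply le_mul_of_one_le_right (by linarith); nlinarith
    have h4 : 2 * P.γ * P.β ≤ P.γ * (4 * P.β ^ 2) := by
      have : 2 * P.β ≤ 4 * P.β ^ 2 := by nlinarith
      nlinarith
    linarith
  have e : 4 * P.β * √(P.γ * (P.Lxx + P.γ)) / P.γ =
    2 * P.β * √(P.γ * (P.Lxx + P.γ)) / P.γ + 2 * P.β * √(P.γ * (P.Lxx + P.γ)) / P.γ := by ring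
  linarith

include hD

lemma apgTau_dual_le (hΩ : 0 < P.Omega) {ε : ℝ} (hε : 0 < ε)
    (hρ : P.rho (P.etaOf ε) ≤ P.Lpi) :
    apgTau (P.Ldual (P.rho (P.etaOf ε))) (P.rho (P.etaOf ε)) ≤
      23 * √P.Omega * P.β * (√(P.Lyy * P.γ) + P.Lxy) * ε⁻¹ := by
  have hγ := hS.γ_pos
  have hβ := hS.β_pos
  have hxy := hS.Lxy_nonneg
  have hyy : 0 ≤ P.Lyy * P.γ := mul_nonneg hD.Lyy_nonneg hγ.le
  have hs := Real.sqrt_nonneg (P.Lyy * P.γ)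
  rw [apgTau, Ldual, max_eq_left hρ, Real.sqrt_le_iff]
  refine ⟨by positivity, ?_⟩
  -- `512` collects the constants of `ρ`, `η` and `λ`; `23² = 529` is the next square.
  have h1 : P.Lpi / P.rho (P.etaOf ε) =
      512 * P.Omega * P.β ^ 2 * (P.Lyy * P.γ + P.Lxy ^ 2) * ε⁻¹ ^ 2 := by
    rw [Lpi, rho, etaOf, mu_eq, lam]
    field_simp
    ring
  have h2 : (23 * √P.Omega * P.β * (√(P.Lyy * P.γ) + P.Lxy) * ε⁻¹) ^ 2 =
      529 * P.Omega * P.β ^ 2 * (√(P.Lyy * P.γ) + P.Lxy) ^ 2 * ε⁻¹ ^ 2 := by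
    rw [mul_pow, mul_pow, mul_pow, mul_pow, Real.sq_sqrt hΩ.le]; norm_num
  rw [h1, h2]
  have h3 : P.Lyy * P.γ + P.Lxy ^ 2 ≤ (√(P.Lyy * P.γ) + P.Lxy) ^ 2 := by
    have := Real.sq_sqrt hyy
    nlinarith
  gcongr
  norm_num

end Constants

/-- The constant of the complexity bounds. -/
noncomputable def complexityConst (β Ω Δ : ℝ) : ℝ :=
  172 * β * (1 + 20 * β ^ 2 * Δ) * (88 + 989 * √Ω * β)

/-! ### Total oracle complexity. -/

section Complexity

variable [FiniteDimensional ℝ E] [FiniteDimensional ℝ F] (hS : P.Standing) (hD : P.DualSmooth)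
  (hT : P.DualTractable) (hxy : 0 < P.Lxy) (hΩ : 0 < P.Omega) {x0 x1 : E} (hx0 : x0 ∈ P.X)
  (hx1 : x1 ∈ P.X) {y0 : F} (hy0 : y0 ∈ core P.Y P.domY)
include hS hD hxy hΩ hx1

lemma IsRun.length_le_of_small {ε : ℝ} (hε : 0 < ε) (hεγ : ε ^ 2 ≤ P.γ) {x : ℕ → E}
    {np nd : ℕ → ℕ} {K : ℕ} (h : P.IsRun x0 y0 (P.etaOf ε) x1 x np nd K) :
    (K : ℝ) ≤ (1 + 20 * P.β ^ 2 * (P.q x1 - P.qStar)) * (P.γ * ε⁻¹ ^ 2) := by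
  have hη := etaOf_pos hS hε
  have h1 := h.length_le hS hD hxy hΩ hη hx1
  have hβ := hS.β_pos
  have hγ := hS.γ_pos
  have hΔ := qStar_le hS hx1
  -- This absorbs the last step, which need not decrease `q`; `20` rounds up `256/13`.
  have h2 : 1 ≤ P.γ * ε⁻¹ ^ 2 := by
    rw [inv_pow, ← div_eq_mul_inv, one_le_div (by positivity)]; exact hεγ
  have e : 13 / 2 * P.etaOf ε = 13 / 256 * (P.β ^ 2 * (P.γ * ε⁻¹ ^ 2))⁻¹ := by
    rw [etaOf, lam]; field_simp; norm_num
  rw [e] at h1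
  have h3 : ((K : ℝ) - 1) * (13 / 256) ≤
      (P.q x1 - P.qStar) * (P.β ^ 2 * (P.γ * ε⁻¹ ^ 2)) := by
    rw [← div_le_iff₀ (by positivity)]
    refine le_trans (le_of_eq ?_) h1
    field_simp
  have h4 : 0 ≤ (P.q x1 - P.qStar) * (P.β ^ 2 * (P.γ * ε⁻¹ ^ 2)) :=
    mul_nonneg (by linarith) (by positivity)
  linarith

lemma IsRun.dist_le_of_le_one {ε : ℝ} (hε : 0 < ε) (hε1 : ε ≤ 1) {x : ℕ → E}
    {np nd : ℕ → ℕ} {K : ℕ} (h : P.IsRun x0 y0 (P.etaOf ε) x1 x np nd K) {k : ℕ} (hk : 1 ≤ k)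
    (hkK : k ≤ K) : ‖x k - x1‖ ≤ ((P.q x1 - P.qStar) / (13 / 2 * P.etaOf 1) *
      √((P.q x1 - P.qStar + 3 / 2 * P.etaOf 1) / P.γ)) * ε⁻¹ ^ 2 := by
  have hη := etaOf_pos hS hε
  have hη1 := etaOf_pos hS one_pos
  have h1 := h.length_le hS hD hxy hΩ hη hx1
  have h2 := h.dist_le hS hD hxy hΩ hη hx1 hk hkK
  have hγ := hS.γ_pos
  have hΔ := qStar_le hS hx1
  have e : P.etaOf ε = P.etaOf 1 * ε ^ 2 := by rw [etaOf, etaOf]; ring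
  have h3 : P.etaOf ε ≤ P.etaOf 1 := by
    rw [e]; exact mul_le_of_le_one_right hη1.le (pow_le_one₀ hε.le hε1)
  have hkK' : (k : ℝ) ≤ K := by exact_mod_cast hkK
  have h4 : (k : ℝ) - 1 ≤ (P.q x1 - P.qStar) / (13 / 2 * P.etaOf 1) * ε⁻¹ ^ 2 := by
    have e2 : (P.q x1 - P.qStar) / (13 / 2 * P.etaOf 1) * ε⁻¹ ^ 2 =
        (P.q x1 - P.qStar) / (13 / 2 * P.etaOf ε) := by rw [e]; field_simp
    rw [e2, le_div_iff₀ (by positivity)]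
    have : ((k : ℝ) - 1) * (13 / 2 * P.etaOf ε) ≤ ((K : ℝ) - 1) * (13 / 2 * P.etaOf ε) := by
      gcongr
    linarith
  have h5 : √((P.q x1 - P.qStar + 3 / 2 * P.etaOf ε) / P.γ) ≤
      √((P.q x1 - P.qStar + 3 / 2 * P.etaOf 1) / P.γ) := by
    apply Real.sqrt_le_sqrt
    gcongr
  have h6 : (0 : ℝ) ≤ (k : ℝ) - 1 := by rw [sub_nonneg]; exact_mod_cast hk
  refine h2.trans ((mul_le_mul h4 h5 (Real.sqrt_nonneg _) (h6.trans h4)).trans (le_of_eq ?_))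
  ring

include hT hx0 hy0

lemma IsRun.oracle_calls_le : ∃ ε0 : ℝ, 0 < ε0 ∧ ∀ ε : ℝ, 0 < ε → ε < ε0 →
    ∀ (x : ℕ → E) (np nd : ℕ → ℕ) (K : ℕ), P.IsRun x0 y0 (P.etaOf ε) x1 x np nd K →
      ((∑ k ∈ Finset.Icc 1 K, np k : ℕ) : ℝ) ≤
        complexityConst P.β P.Omega (P.q x1 - P.qStar) *
          (√(P.γ * (P.Lxx + P.γ)) * (√(P.Lyy * P.γ) + P.Lxy) *
            (ε ^ 3)⁻¹ * Real.log (1 / ε) ^ 2) ∧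
      ((∑ k ∈ Finset.Icc 1 K, nd k : ℕ) : ℝ) ≤
        complexityConst P.β P.Omega (P.q x1 - P.qStar) *
          (P.γ * (√(P.Lyy * P.γ) + P.Lxy) * (ε ^ 3)⁻¹ * Real.log (1 / ε)) := by
  obtain ⟨c, hc⟩ := caseIIStep_count hS hD hxy hΩ hx0 hx1 hy0.1 ((P.q x1 - P.qStar) /
    (13 / 2 * P.etaOf 1) * √((P.q x1 - P.qStar + 3 / 2 * P.etaOf 1) / P.γ)) hT hy0
  have hγ := hS.γ_pos
  have hβ := hS.one_le_β
  have hη1 := etaOf_pos hS one_pos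
  have hρ1 := rho_pos hΩ hη1
  have hτ1 := one_le_apgTau one_pos (P.le_Ldual 1)
  have hΔ := qStar_le hS hx1
  have hπ : 0 < P.Lpi := by
    have := hD.Lyy_nonneg
    have := hS.mu_pos
    unfold Lpi
    positivity
  set κ := √(P.Lyy * P.γ) + P.Lxy with hκ'
  have hκ : 0 < κ := add_pos_of_nonneg_of_pos (Real.sqrt_nonneg _) hxy
  set M := √(P.γ * (P.Lxx + P.γ))
  have hM : 0 ≤ M := Real.sqrt_nonneg _
  have hsΩ := Real.sqrt_nonneg P.Omega
  set c' := max c 3 with hc'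
  have hc'0 : 0 < c' := lt_of_lt_of_le three_pos (le_max_right _ _)
  -- The thresholds make the per-step counts valid, absorb the last outer step, make the reference
  -- solve cheaper than `κ/ε`, and ensure `ρ ≤ L_π`.
  refine ⟨min (min 1 c'⁻¹) (min (min P.γ (κ / (1 + apgTau (P.Ldual 1) 1)))
    (P.Lpi / P.rho (P.etaOf 1))), by positivity, fun ε hε hlt x np nd K hrun => ?_⟩
  simp only [lt_min_iff] at hlt
  obtain ⟨⟨hε1, hεc⟩, ⟨hεγ, hεκ⟩, hερ⟩ := hlt
  have hcε : c' ≤ ε⁻¹ := by rw [le_inv_comm₀ hc'0 hε]; exact hεc.le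
  have hε2 : ε ^ 2 ≤ ε := by rw [pow_two]; exact mul_le_of_le_one_left hε.le hε1.le
  have hK := hrun.length_le_of_small hS hD hxy hΩ hx1 hε (hε2.trans hεγ.le)
  have hρ : P.rho (P.etaOf ε) ≤ P.Lpi := by
    have e : P.rho (P.etaOf ε) = ε ^ 2 * P.rho (P.etaOf 1) := by
      rw [rho, rho, etaOf, etaOf]; ring
    rw [lt_div_iff₀ hρ1] at hερ
    rw [e]
    exact (mul_le_mul_of_nonneg_right hε2 hρ1.le).trans hερ.le
  have hτρ := apgTau_dual_le hS hD hΩ hε hρ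
  have hτx := one_add_apgTau_primal_le hS
  rw [← hκ'] at hτρ
  have hℓ : 1 ≤ Real.log ε⁻¹ := by
    rw [Real.le_log_iff_exp_le (inv_pos.2 hε)]
    exact Real.exp_one_lt_three.le.trans ((le_max_right _ _).trans hcε)
  rw [one_div]
  set ℓ := Real.log ε⁻¹
  have hκε : 1 + apgTau (P.Ldual 1) 1 ≤ κ * ε⁻¹ := by
    rw [lt_div_iff₀ (by linarith)] at hεκ
    rw [← div_eq_mul_inv, le_div_iff₀ hε]
    linarith
  set Z := κ * ε⁻¹ with hZ
  have hZ1 : 1 ≤ Z := by linarith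
  have hZℓ : 1 ≤ Z * ℓ := one_le_mul_of_one_le_of_one_le hZ1 hℓ
  set D := 88 + 989 * √P.Omega * P.β with hDdef
  have hsβ : 0 ≤ √P.Omega * P.β := by positivity
  -- In `D`, `88 = 43 + 43 + 2` covers the reference solve, the summand `1` in `1 + τ`, and the two
  -- separate primal solves; `989 = 43·23` comes from the dual condition number. The primal factor
  -- is `172 = 43·4`.
  have hstep : ∀ k ∈ Finset.Icc 1 K, (nd k : ℝ) + 2 ≤ D * (Z * ℓ) ∧
      (np k : ℝ) ≤ D * (Z * ℓ) * (172 * P.β * M / P.γ * ℓ) := by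
    intro k hk
    rw [Finset.mem_Icc] at hk
    obtain ⟨h1, h2⟩ := hc ε hε hε1.le ((le_max_left _ _).trans hcε) (x k)
      (hrun.mem hS hx1 hk.1 hk.2) (hrun.dist_le_of_le_one hS hD hxy hΩ hx1 hε hε1.le hk.1 hk.2)
      _ _ _ (hrun.step k hk.1 hk.2)
    have h3 := mul_le_mul_of_nonneg_right hκε (zero_le_one.trans hℓ)
    have h4 := mul_le_mul_of_nonneg_right hτρ (zero_le_one.trans hℓ)
    have h5 := mul_le_mul_of_nonneg_right hτx (zero_le_one.trans hℓ)
    have h6 : ℓ ≤ Z * ℓ := le_mul_of_one_le_left (by linarith) hZ1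
    have e1 : 23 * √P.Omega * P.β * κ * ε⁻¹ * ℓ = 23 * (√P.Omega * P.β) * (Z * ℓ) := by
      rw [hZ]; ring
    have e2 : D * (Z * ℓ) = 88 * (Z * ℓ) + 43 * (23 * (√P.Omega * P.β) * (Z * ℓ)) := by
      rw [hDdef]; ring
    have h7 : (nd k : ℝ) + 2 ≤ D * (Z * ℓ) := by rw [e2]; linarith
    refine ⟨h7, h2.trans ?_⟩
    have h8 : 43 * ((1 + apgTau P.Lxx' P.mu) * ℓ) ≤ 172 * P.β * M / P.γ * ℓ := by
      have e3 : 172 * P.β * M / P.γ * ℓ = 43 * (4 * P.β * M / P.γ * ℓ) := by ring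
      rw [e3]; linarith
    have hτ := one_le_apgTau hS.mu_pos hS.mu_le_Lxx'
    exact mul_le_mul h7 h8 (by positivity) (by positivity)
  have hlen : 0 ≤ 1 + 20 * P.β ^ 2 * (P.q x1 - P.qStar) := by
    have : 0 ≤ P.q x1 - P.qStar := by linarith
    positivity
  have hcard : ((Finset.Icc 1 K).card : ℝ) = K := by simp
  push_cast
  constructor
  · refine (Finset.sum_le_card_nsmul _ _ _ fun k hk => (hstep k hk).2).trans ?_
    rw [nsmul_eq_mul, hcard]
    refine (mul_le_mul_of_nonneg_right hK (by positivity)).trans (le_of_eq ?_)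
    rw [complexityConst, hZ]
    field_simp
    rw [hDdef]
    ring
  · refine (Finset.sum_le_card_nsmul _ _ (D * (Z * ℓ)) fun k hk => by
      linarith [(hstep k hk).1]).trans ?_
    rw [nsmul_eq_mul, hcard]
    refine (mul_le_mul_of_nonneg_right hK (by positivity)).trans ?_
    have e : complexityConst P.β P.Omega (P.q x1 - P.qStar) *
        (P.γ * κ * (ε ^ 3)⁻¹ * ℓ) = (172 * P.β) *
        ((1 + 20 * P.β ^ 2 * (P.q x1 - P.qStar)) * (P.γ * ε⁻¹ ^ 2) * (D * (Z * ℓ))) := by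
      rw [complexityConst, hZ, ← hDdef]; field_simp
    rw [e]
    exact le_mul_of_one_le_left (by positivity) (by linarith)

end Complexity

end Problem
end PDSmooth

/-! ### Assembly: correctness for every `ε`, call bounds below the threshold. -/

theorem mainTheorem1 :
    ∃ C : ℝ → ℝ → ℝ → ℝ,
      ∀ (E : Type u) (F : Type v)
        [NormedAddCommGroup E] [NormedSpace ℝ E] [FiniteDimensional ℝ E]
        [NormedAddCommGroup F] [NormedSpace ℝ F] [FiniteDimensional ℝ F]
        (P : PDSmooth.Problem E F),
        P.Standing → P.DualSmooth → P.DualTractable →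
        0 < P.Lxy → 0 < P.Omega →
        ∀ x1 ∈ PDSmooth.core P.X P.domX, ∀ x0 ∈ PDSmooth.core P.X P.domX,
        ∀ y0 ∈ PDSmooth.core P.Y P.domY,
        ∃ ε0 : ℝ, 0 < ε0 ∧ ∀ ε η : ℝ, 0 < ε → η = ε ^ 2 * P.lam / (64 * P.β ^ 2) →
          (∃ (x : ℕ → E) (np nd : ℕ → ℕ) (K : ℕ), P.IsRun x0 y0 η x1 x np nd K) ∧
          ∀ (x : ℕ → E) (np nd : ℕ → ℕ) (K : ℕ), P.IsRun x0 y0 η x1 x np nd K →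
            (∀ k, 1 ≤ k → k ≤ K → P.StepOK η (x k) (x (k + 1))) ∧
            P.NearStationary ε (x K) ∧
            (ε < ε0 →
              ((∑ k ∈ Finset.Icc 1 K, np k : ℕ) : ℝ) ≤
                C P.β P.Omega (P.q x1 - P.qStar) *
                  (Real.sqrt (P.γ * (P.Lxx + P.γ)) * (Real.sqrt (P.Lyy * P.γ) + P.Lxy) *
                    (ε ^ 3)⁻¹ * Real.log (1 / ε) ^ 2) ∧
              ((∑ k ∈ Finset.Icc 1 K, nd k : ℕ) : ℝ) ≤
                C P.β P.Omega (P.q x1 - P.qStar) *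
                  (P.γ * (Real.sqrt (P.Lyy * P.γ) + P.Lxy) *
                    (ε ^ 3)⁻¹ * Real.log (1 / ε))) := by
  refine ⟨PDSmooth.Problem.complexityConst, ?_⟩
  intro E F _ _ _ _ _ _ P hS hD hT hxy hΩ x1 hx1 x0 hx0 y0 hy0
  obtain ⟨ε0, hε0, hcalls⟩ := PDSmooth.Problem.IsRun.oracle_calls_le hS hD hT hxy hΩ hx0.1 hx1.1 hy0
  refine ⟨ε0, hε0, ?_⟩
  rintro ε η hε hη
  have hη0 : 0 < η := by rw [hη]; exact PDSmooth.Problem.etaOf_pos hS hε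
  refine ⟨PDSmooth.Problem.exists_isRun hS hD hxy hΩ hT hx0.1 hx1.1 hy0 hη0, ?_⟩
  intro x np nd K hrun
  have hok : ∀ k, 1 ≤ k → k ≤ K → P.StepOK η (x k) (x (k + 1)) := fun k hk hkK =>
    hS.stepOK_of_caseIIStep hD hxy hΩ hη0 (hrun.step k hk hkK)
  refine ⟨hok, ?_, fun hlt => ?_⟩
  · exact hS.nearStationary hD hΩ hε hη (hrun.mem hS hx1.1 hrun.one_le le_rfl)
      (hok K hrun.one_le le_rfl) hrun.stops
  · subst hη
    exact hcalls ε hε hlt x np nd K hrun
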